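/- Let $M$ be a smooth manifold, let $E$ and $F$ be smooth real vector bundles over $M$ (of possibly different ranks), and let $A\to M$ be a Lie algebroid with anchor $\rho\colon A\to TM$. Write $\Omega^s(A,E)=\Gamma(\wedge^sA^*\otimes E)$ and $\Omega^s(A)=\Omega^s(A,\mathbb R)$, let $\mathbf d_A$ be the Lie algebroid differential on $\Omega^\bullet(A)$ and $H^\bullet(A)$ its cohomology algebra. For a linear $A$-connection $\nabla$ on $E$, i.e. an $\mathbb R$-bilinear map $\nabla\colon\Gamma(A)\times\Gamma(E)\to\Gamma(E)$ with $\nabla_{fa}e=f\nabla_ae$ and $\nabla_a(fe)=f\nabla_ae+(\rho(a)f)e$, let $\mathbf d_\nabla$ be the induced operator on $\Omega^\bullet(A,E)$, and let $R_\nabla^l\in\Omega^{2l}(A,\operatorname{End}E)$ be the $l$-th power of its curvature, given by $R_\nabla^l(a_1,\dots,a_{2l})e=(\mathbf d_\nabla^{2l}e)(a_1,\dots,a_{2l})$. The $A$-Pontryagin characters of $E$ are the classes $$\sigma^l_A(E)=[\operatorname{tr}R_\nabla^l]\in H^{2l}(A),\qquad l\ge 1,$$ the $A$-Pontryagin algebra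 $\operatorname{Pont}_A^\bullet(E)\subseteq H^\bullet(A)$ is the $\mathbb R$-subalgebra generated by them, and the $A$-Pontryagin classes of $E$ are $$p^i_A(E)=\left[f_{2i}\left(\tfrac{\sqrt{-1}}{2\pi}R_\nabla\right)\right]\in H^{4i}(A),\qquad i\ge1,$$ where $\det(\lambda I_k+X)=\sum_{j=0}^kf_j(X)\lambda^{k-j}$ for $k\times k$ matrices $X$, $k=\operatorname{rank}E$, and $f_j=0$ for $j>k$; an invariant polynomial, written as $X\mapsto q(\operatorname{tr}X,\operatorname{tr}X^2,\dots)$ with a polynomial $q$, is evaluated on $R_\nabla$ as $q(\operatorname{tr}R_\nabla,\operatorname{tr}R_\nabla^2,\dots)$. Suppose that $A$ has a $2$-term representation up to homotopy on $E[0]\oplus F[1]$, i.e. there is an $\mathbb R$-linear operator $\mathcal D$ of degree $1$ on the total complex with $n$-th term $\Omega^n(A,E)\oplus\Omega^{n-1}(A,F)$ such that $\mathcal D(\omega\wedge\eta)=\mathbf d_A\omega\wedge\eta+(-1)^{s}\omega\wedge\mathcal D\eta$ for $\omega\in\Omega^s(A)$ and all $\eta$, and $\mathcal D^2=0$. Then,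 the classes above being well defined (connections exist, and the classes depend neither on the connection nor on the choice of $q$), $$\sigma^l_A(E)=\sigma^l_A(F)\ \text{ for all } l\ge1,\qquad p^i_A(E)=p^i_A(F)\ \text{ for all } i\ge1,\qquad \operatorname{Pont}_A^\bullet(E)=\operatorname{Pont}_A^\bullet(F)\subseteq H^\bullet(A).$$ -/

import Mathlib

open scoped DirectSum
set_option linter.unusedSectionVars false

noncomputable section

namespace LieRinehartForms

/-! Antisymmetrization of functions -/
section Alt
variable {L N N₁ N₂ N₃ : Type*} [AddCommGroup N] [AddCommGroup N₁] [AddCommGroup N₂]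
  [AddCommGroup N₃]

/-- The (unnormalised) antisymmetrization of a function of `n` arguments. -/
def Alt {n : ℕ} (g : (Fin n → L) → N) (v : Fin n → L) : N :=
  ∑ σ : Equiv.Perm (Fin n), Equiv.Perm.sign σ • g (v ∘ σ)

theorem Alt_comp_perm {n : ℕ} (g : (Fin n → L) → N) (v : Fin n → L) (τ : Equiv.Perm (Fin n)) :
    Alt g (v ∘ τ) = Equiv.Perm.sign τ • Alt g v := by
  unfold Alt
  rw [Finset.smul_sum, ← Equiv.sum_comp (Equiv.mulLeft τ⁻¹)]
  refine Finset.sum_congr rfl fun σ _ => ?_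
  have : (v ∘ τ) ∘ ((Equiv.mulLeft τ⁻¹) σ) = v ∘ σ := by
    ext i; simp
  rw [this, smul_smul]; simp

theorem Alt_domPerm {n : ℕ} (g : (Fin n → L) → N) (τ : Equiv.Perm (Fin n)) (v : Fin n → L) :
    Alt (fun w => g (w ∘ τ)) v = Equiv.Perm.sign τ • Alt g v := by
  unfold Alt
  rw [Finset.smul_sum, ← Equiv.sum_comp (Equiv.mulRight τ⁻¹)]
  refine Finset.sum_congr rfl fun σ _ => ?_
  have : (v ∘ ((Equiv.mulRight τ⁻¹) σ)) ∘ τ = v ∘ σ := by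
    ext i; simp
  beta_reduce
  rw [this, smul_smul]; simp [mul_comm]

theorem Alt_add {n : ℕ} (g h : (Fin n → L) → N) (v : Fin n → L) :
    Alt (fun w => g w + h w) v = Alt g v + Alt h v := by
  simp [Alt, Finset.sum_add_distrib]

theorem Alt_map {n : ℕ} (φ : N₁ →+ N) (g : (Fin n → L) → N₁) (v : Fin n → L) :
    Alt (fun w => φ (g w)) v = φ (Alt g v) := by
  simp only [Alt, map_sum]
  refine Finset.sum_congr rfl fun σ _ => ?_
  rcases Int.units_eq_one_or (Equiv.Perm.sign σ) with h | h <;> simp [h]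

theorem Alt_smul {S : Type*} [Monoid S] [DistribMulAction S N] {n : ℕ} (c : S)
    (g : (Fin n → L) → N) (v : Fin n → L) :
    Alt (fun w => c • g w) v = c • Alt g v :=
  Alt_map (DistribSMul.toAddMonoidHom N c) g v

theorem Alt_succ {n : ℕ} (g : (Fin (n + 1) → L) → N) (v : Fin (n + 1) → L) :
    Alt g v = ∑ p : Fin (n + 1), (-1 : ℤ) ^ (p : ℕ) •
      Alt (fun w : Fin n → L => g (Fin.cons (v p) w)) (p.removeNth v) := by
  classical
  let f : Fin (n + 1) × Equiv.Perm (Fin n) → Equiv.Perm (Fin (n + 1)) :=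
    fun x => (Fin.cycleRange x.1)⁻¹ * Equiv.Perm.decomposeFin.symm (0, x.2)
  have f0 : ∀ x, f x 0 = x.1 := by
    intro x; simp [f, Equiv.Perm.inv_def, Equiv.Perm.decomposeFin_symm_apply_zero]
  have fs : ∀ x j, f x (Fin.succ j) = x.1.succAbove (x.2 j) := by
    intro x j
    simp [f, Equiv.Perm.inv_def, Equiv.Perm.decomposeFin_symm_apply_succ, Fin.cycleRange_symm_succ]
  have finj : Function.Injective f := by
    intro x y h
    have h1 : x.1 = y.1 := by rw [← f0 x, ← f0 y, h]
    refine Prod.ext h1 (Equiv.ext fun j => ?_)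
    have h2 : f x j.succ = f y j.succ := by rw [h]
    rw [fs, fs, h1] at h2
    exact Fin.succAbove_right_injective h2
  have fbij : Function.Bijective f := by
    rw [Fintype.bijective_iff_injective_and_card]
    refine ⟨finj, ?_⟩
    simp [Fintype.card_prod, Fintype.card_perm, Nat.factorial_succ]
  unfold Alt
  rw [← fbij.sum_comp, Fintype.sum_prod_type]
  refine Finset.sum_congr rfl fun p _ => ?_
  rw [Finset.smul_sum]
  refine Finset.sum_congr rfl fun e _ => ?_
  have h1 : v ∘ f (p, e) = Fin.cons (v p) ((p.removeNth v) ∘ e) := by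
    ext i
    refine Fin.cases ?_ (fun j => ?_) i
    · simp [f0]
    · simp [fs, Fin.removeNth]
  have h2 : Equiv.Perm.sign (f (p, e)) = (-1) ^ (p : ℕ) * Equiv.Perm.sign e := by
    simp [f, Fin.sign_cycleRange]
  rw [h1, h2, mul_smul]
  rcases Nat.even_or_odd (p : ℕ) with h | h <;> simp [h.neg_one_pow]

/-- The product of functions of several arguments along a pairing `B`: the first `p` arguments
are fed to `a` and the last `q` arguments to `b`. -/
def tensorFun (B : N₁ →+ N₂ →+ N₃) {p q : ℕ} (a : (Fin p → L) → N₁) (b : (Fin q → L) → N₂)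
    (v : Fin (p + q) → L) : N₃ :=
  B (a (v ∘ Fin.castAdd q)) (b (v ∘ Fin.natAdd p))

theorem Alt_tensorFun_Alt (B : N₁ →+ N₂ →+ N₃) {p q : ℕ} (a : (Fin p → L) → N₁)
    (b : (Fin q → L) → N₂) (v : Fin (p + q) → L) :
    Alt (tensorFun B (Alt a) (Alt b)) v
      = (p.factorial * q.factorial) • Alt (tensorFun B a b) v := by
  have key : ∀ w : Fin (p + q) → L, tensorFun B (Alt a) (Alt b) w =
      ∑ τ₁ : Equiv.Perm (Fin p), ∑ τ₂ : Equiv.Perm (Fin q),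
        (Equiv.Perm.sign τ₁ * Equiv.Perm.sign τ₂) • tensorFun B a b
          (w ∘ (finSumFinEquiv.permCongr (Equiv.Perm.sumCongr τ₁ τ₂))) := by
    intro w
    simp only [tensorFun, Alt, map_sum, AddMonoidHom.finsetSum_apply]
    rw [Finset.sum_comm]
    refine Finset.sum_congr rfl fun τ₁ _ => Finset.sum_congr rfl fun τ₂ _ => ?_
    have h1 : (w ∘ (finSumFinEquiv.permCongr (Equiv.Perm.sumCongr τ₁ τ₂))) ∘ Fin.castAdd q
        = (w ∘ Fin.castAdd q) ∘ τ₁ := by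
      ext i; simp [Equiv.permCongr_apply]
    have h2 : (w ∘ (finSumFinEquiv.permCongr (Equiv.Perm.sumCongr τ₁ τ₂))) ∘ Fin.natAdd p
        = (w ∘ Fin.natAdd p) ∘ τ₂ := by
      ext i; simp [Equiv.permCongr_apply]
    rw [h1, h2]
    rcases Int.units_eq_one_or (Equiv.Perm.sign τ₁) with h | h <;>
    rcases Int.units_eq_one_or (Equiv.Perm.sign τ₂) with h' | h' <;> simp [h, h']
  have e : Alt (tensorFun B (Alt a) (Alt b)) v = Alt (fun w =>
      ∑ τ₁ : Equiv.Perm (Fin p), ∑ τ₂ : Equiv.Perm (Fin q),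
        (Equiv.Perm.sign τ₁ * Equiv.Perm.sign τ₂) • tensorFun B a b
          (w ∘ (finSumFinEquiv.permCongr (Equiv.Perm.sumCongr τ₁ τ₂)))) v := by
    congr 1; funext w; exact key w
  have e2 : ∀ τ₁ : Equiv.Perm (Fin p), ∀ τ₂ : Equiv.Perm (Fin q),
      Alt (fun w => (Equiv.Perm.sign τ₁ * Equiv.Perm.sign τ₂) • tensorFun B a b
          (w ∘ (finSumFinEquiv.permCongr (Equiv.Perm.sumCongr τ₁ τ₂)))) v
        = Alt (tensorFun B a b) v := by
    intro τ₁ τ₂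
    rw [Alt_smul, Alt_domPerm, smul_smul]
    have : Equiv.Perm.sign (finSumFinEquiv.permCongr (Equiv.Perm.sumCongr τ₁ τ₂))
        = Equiv.Perm.sign τ₁ * Equiv.Perm.sign τ₂ := by
      rw [Equiv.Perm.sign_permCongr, Equiv.Perm.sign_sumCongr]
    rw [this, Int.units_mul_self, one_smul]
  have e3 : ∀ (ι : Type) (s : Finset ι) (g : ι → (Fin (p + q) → L) → N₃),
      Alt (fun w => ∑ i ∈ s, g i w) v = ∑ i ∈ s, Alt (g i) v := by
    intro ι s g
    simp only [Alt, Finset.smul_sum]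
    rw [Finset.sum_comm]
  rw [e, e3]
  simp only [e3, e2]
  simp only [Finset.sum_const, Finset.card_univ, Fintype.card_perm, Fintype.card_fin]
  rw [← mul_nsmul, mul_comm]

end Alt

/-! Forms with values in a module. Here `R` is a commutative `ℝ`-algebra of functions and `L` a
Lie-Rinehart algebra over it; the case of interest is `R = C^∞(M)` and `L = Γ(A)` for a Lie
algebroid `A → M`. -/
section Forms
variable {R L N N₁ N₂ N₃ : Type*} [CommRing R] [Algebra ℝ R]
  [LieRing L] [LieAlgebra ℝ L] [Module R L] [LieRingModule L R] [LieRinehartRing R L]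
  [LieRinehartAlgebra ℝ R L]
  [AddCommGroup N] [Module ℝ N] [Module R N] [IsScalarTower ℝ R N]
  [AddCommGroup N₁] [Module ℝ N₁] [Module R N₁] [IsScalarTower ℝ R N₁]
  [AddCommGroup N₂] [Module ℝ N₂] [Module R N₂] [IsScalarTower ℝ R N₂]
  [AddCommGroup N₃] [Module ℝ N₃] [Module R N₃] [IsScalarTower ℝ R N₃]

variable (R L N) in
/-- The `N`-valued `s`-forms: alternating `R`-multilinear maps `L × ⋯ × L → N`. -/
abbrev Form (s : ℕ) := L [⋀^Fin s]→ₗ[R] N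

/-- The additive pairing underlying a bilinear pairing. -/
def pairingHom (B : N₁ →ₗ[R] N₂ →ₗ[R] N₃) : N₁ →+ N₂ →+ N₃ :=
  AddMonoidHom.mk' (fun x => (B x).toAddMonoidHom) (fun x x' => by ext y; simp)

@[simp] theorem pairingHom_apply (B : N₁ →ₗ[R] N₂ →ₗ[R] N₃) (x : N₁) (y : N₂) :
    pairingHom B x y = B x y := rfl

/-- The wedge product of an `N₁`-valued and an `N₂`-valued form along a pairing
`B : N₁ × N₂ → N₃`: the signed sum over all shuffles. -/
def wedge (B : N₁ →ₗ[R] N₂ →ₗ[R] N₃) (p q : ℕ) :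
    Form R L N₁ p →ₗ[R] Form R L N₂ q →ₗ[R] Form R L N₃ (p + q) :=
  LinearMap.mk₂ R (fun α β =>
      ((TensorProduct.lift B).compAlternatingMap (α.domCoprod β)).domDomCongr finSumFinEquiv)
    (fun α α' β => by
      rw [← AlternatingMap.domCoprod'_apply, TensorProduct.add_tmul, map_add]; ext v; simp)
    (fun c α β => by
      rw [← AlternatingMap.domCoprod'_apply, ← TensorProduct.smul_tmul', map_smul]
      ext v; simp)
    (fun α β β' => by
      rw [← AlternatingMap.domCoprod'_apply, TensorProduct.tmul_add, map_add]; ext v; simp)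
    (fun c α β => by
      rw [← AlternatingMap.domCoprod'_apply, TensorProduct.tmul_smul, map_smul]
      ext v; simp)

theorem factorial_smul_wedge (B : N₁ →ₗ[R] N₂ →ₗ[R] N₃) {p q : ℕ} (α : Form R L N₁ p)
    (β : Form R L N₂ q) (v : Fin (p + q) → L) :
    (p.factorial * q.factorial) • wedge B p q α β v = Alt (tensorFun (pairingHom B) α β) v := by
  have h := congrArg (fun m => TensorProduct.lift B (m (v ∘ finSumFinEquiv)))
    (MultilinearMap.domCoprod_alternization_eq α β)
  simp only [Fintype.card_fin, AlternatingMap.smul_apply, map_nsmul] at h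
  rw [show wedge B p q α β v = TensorProduct.lift B ((α.domCoprod β) (v ∘ finSumFinEquiv)) from rfl,
    ← h, MultilinearMap.alternatization_apply, map_sum]
  unfold Alt
  rw [← Equiv.sum_comp (finSumFinEquiv (m := p) (n := q)).permCongr]
  refine Finset.sum_congr rfl fun σ _ => ?_
  rw [Equiv.Perm.sign_permCongr]
  have : TensorProduct.lift B ((MultilinearMap.domDomCongr σ (MultilinearMap.domCoprod
      (α : MultilinearMap R _ _) (β : MultilinearMap R _ _))) (v ∘ finSumFinEquiv))
      = tensorFun (pairingHom B) α β (v ∘ (finSumFinEquiv.permCongr σ)) := by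
    have h1 : (v ∘ (finSumFinEquiv.permCongr σ)) ∘ Fin.castAdd q
        = fun i => (v ∘ finSumFinEquiv) (σ (Sum.inl i)) := by
      ext i; simp [Equiv.permCongr_apply]
    have h2 : (v ∘ (finSumFinEquiv.permCongr σ)) ∘ Fin.natAdd p
        = fun i => (v ∘ finSumFinEquiv) (σ (Sum.inr i)) := by
      ext i; simp [Equiv.permCongr_apply]
    simp only [MultilinearMap.domDomCongr_apply, MultilinearMap.domCoprod_apply,
      TensorProduct.lift.tmul, tensorFun, pairingHom_apply, h1, h2]
    rfl
  rw [← this]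
  rcases Int.units_eq_one_or (Equiv.Perm.sign σ) with h | h <;> simp [h]

theorem tensorFun_smul_smul (B : N₁ →ₗ[R] N₂ →ₗ[R] N₃) {p q : ℕ} (c c' : ℝ)
    (a : (Fin p → L) → N₁) (b : (Fin q → L) → N₂) (v : Fin (p + q) → L) :
    tensorFun (pairingHom B) (fun w => c • a w) (fun w => c' • b w) v
      = (c * c') • tensorFun (pairingHom B) a b v := by
  simp only [tensorFun, pairingHom_apply]
  rw [← algebraMap_smul R c (a _), ← algebraMap_smul R c' (b _), map_smul, map_smul,
    LinearMap.smul_apply, smul_smul, ← map_mul, algebraMap_smul, mul_comm]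

theorem wedge_eq_Alt (B : N₁ →ₗ[R] N₂ →ₗ[R] N₃) {p q : ℕ} (α : Form R L N₁ p)
    (β : Form R L N₂ q) {c c' : ℝ} {a : (Fin p → L) → N₁} {b : (Fin q → L) → N₂}
    (ha : ∀ v, α v = c • Alt a v) (hb : ∀ v, β v = c' • Alt b v) (v : Fin (p + q) → L) :
    wedge B p q α β v = (c * c') • Alt (tensorFun (pairingHom B) a b) v := by
  have h := factorial_smul_wedge B α β v
  have h1 : (⇑α : (Fin p → L) → N₁) = fun w => c • Alt a w := funext ha
  have h2 : (⇑β : (Fin q → L) → N₂) = fun w => c' • Alt b w := funext hb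
  have h3 : tensorFun (pairingHom B) α β
      = fun w => (c * c') • tensorFun (pairingHom B) (Alt a) (Alt b) w := by
    funext w; rw [h1, h2, tensorFun_smul_smul]
  rw [h3, Alt_smul, Alt_tensorFun_Alt, smul_comm] at h
  have hne : ((p.factorial * q.factorial : ℕ) : ℝ) ≠ 0 := by positivity
  rw [← Nat.cast_smul_eq_nsmul ℝ, ← Nat.cast_smul_eq_nsmul ℝ] at h
  exact smul_right_injective N₃ hne h

theorem eq_Alt {s : ℕ} (θ : Form R L N s) (v : Fin s → L) :
    θ v = ((s.factorial : ℝ)⁻¹) • Alt θ v := by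
  have : Alt θ v = s.factorial • θ v := by
    unfold Alt
    rw [Finset.sum_congr rfl (fun σ _ => show _ = θ v from ?_)]
    · simp [Fintype.card_perm]
    · rw [θ.map_perm, smul_smul]; simp
  rw [this, ← Nat.cast_smul_eq_nsmul ℝ, smul_smul, inv_mul_cancel₀ (by positivity), one_smul]

theorem wedge_eq_Alt' (B : N₁ →ₗ[R] N₂ →ₗ[R] N₃) {p q : ℕ} (α : Form R L N₁ p)
    (β : Form R L N₂ q) (v : Fin (p + q) → L) :
    wedge B p q α β v = ((p.factorial : ℝ)⁻¹ * (q.factorial : ℝ)⁻¹) •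
      Alt (tensorFun (pairingHom B) α β) v :=
  wedge_eq_Alt B α β (eq_Alt α) (eq_Alt β) v

theorem Alt_cast {m n : ℕ} (h : m = n) (g : (Fin m → L) → N) (v : Fin n → L) :
    Alt (fun w : Fin n → L => g (w ∘ Fin.cast h)) v = Alt g (v ∘ Fin.cast h) := by
  subst h; rfl

variable (R L) in
/-- A linear `L`-connection on the `R`-module `N`; `⁅a, f⁆` is the action of `a` on `f`, which for a
Lie algebroid is `ρ(a) f`. -/
structure LinearConnection (N : Type*) [AddCommGroup N] [Module ℝ N] [Module R N]
    [IsScalarTower ℝ R N] where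
  /-- The covariant derivative `(a, e) ↦ ∇_a e`. -/
  nabla : L →ₗ[R] N →ₗ[ℝ] N
  leibniz : ∀ (a : L) (f : R) (e : N), nabla a (f • e) = f • nabla a e + ⁅a, f⁆ • e

variable (R L) in
/-- The canonical flat connection `∇_a f = ⁅a, f⁆` on `R`. -/
def flatConnection : LinearConnection R L R where
  nabla :=
    { toFun := fun a =>
        { toFun := fun f => ⁅a, f⁆
          map_add' := fun f g => lie_add a f g
          map_smul' := fun c f => lie_smul c a f }
      map_add' := fun a b => by ext f; exact add_lie a b f
      map_smul' := fun f a => by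
        ext g; exact LieRinehartRing.lie_smul_eq_mul f g a }
  leibniz := fun a f e => by simp [smul_eq_mul]

@[simp] theorem flatConnection_nabla (a : L) (f : R) :
    (flatConnection R L).nabla a f = ⁅a, f⁆ := rfl

namespace LinearConnection
variable (D : LinearConnection R L N)

/-- An auxiliary expression: `∇_a (g w) - (1/2) ∑_j g (w_1, …, ⁅a, w_j⁆, …, w_s)`. -/
def lieTerm {s : ℕ} (g : (Fin s → L) → N) (a : L) (w : Fin s → L) : N :=
  D.nabla a (g w) - (1 / 2 : ℝ) • ∑ j, g (Function.update w j ⁅a, w j⁆)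

/-- The Koszul formula. Because of the factor `1/2` in `lieTerm`, each pair of arguments
contributes one bracket term, see `d_apply_koszul`. -/
def koszul {s : ℕ} (g : (Fin s → L) → N) (v : Fin (s + 1) → L) : N :=
  ∑ i : Fin (s + 1), (-1 : ℤ) ^ (i : ℕ) • D.lieTerm g (v i) (i.removeNth v)

theorem lieTerm_Alt {s : ℕ} (c : ℝ) (g : (Fin s → L) → N) (a : L) (w : Fin s → L) :
    D.lieTerm (fun u => c • Alt g u) a w = c • Alt (D.lieTerm g a) w := by
  have h1 : Alt (D.lieTerm g a) w = Alt (fun u => D.nabla a (g u)) w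
      + (-(1 / 2) : ℝ) • Alt (fun u => ∑ j, g (Function.update u j ⁅a, u j⁆)) w := by
    rw [← Alt_smul, ← Alt_add]
    congr 1
    funext u
    rw [lieTerm, neg_smul, sub_eq_add_neg]
  have h2 : Alt (fun u => D.nabla a (g u)) w = D.nabla a (Alt g w) :=
    Alt_map (D.nabla a).toAddMonoidHom g w
  have h3 : Alt (fun u => ∑ j, g (Function.update u j ⁅a, u j⁆)) w
      = ∑ j, Alt g (Function.update w j ⁅a, w j⁆) := by
    simp only [Alt, Finset.smul_sum]
    rw [Finset.sum_comm]
    conv_rhs => rw [Finset.sum_comm]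
    rw [Finset.sum_comm]
    refine Finset.sum_congr rfl fun σ _ => ?_
    rw [← Equiv.sum_comp σ (fun j => Equiv.Perm.sign σ • g ((Function.update w j ⁅a, w j⁆) ∘ σ))]
    refine Finset.sum_congr rfl fun j _ => ?_
    congr 2
    rw [Function.update_comp_equiv]
    simp
  rw [h1, h2, h3, lieTerm, map_smul, ← Finset.smul_sum, smul_add, sub_eq_add_neg, neg_smul,
    smul_neg, smul_comm c]

theorem koszul_Alt {s : ℕ} (c : ℝ) (g : (Fin s → L) → N) (v : Fin (s + 1) → L) :
    D.koszul (fun u => c • Alt g u) v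
      = c • Alt (fun u : Fin (s + 1) → L => D.lieTerm g (u 0) (Fin.tail u)) v := by
  rw [Alt_succ, koszul, Finset.smul_sum]
  refine Finset.sum_congr rfl fun i _ => ?_
  rw [lieTerm_Alt, smul_comm c]
  simp only [Fin.cons_zero, Fin.tail_cons]

end LinearConnection
end Forms

section Diff
variable {R L N N₁ N₂ N₃ : Type*} [CommRing R] [Algebra ℝ R]
  [LieRing L] [LieAlgebra ℝ L] [Module R L] [LieRingModule L R] [LieRinehartRing R L]
  [LieRinehartAlgebra ℝ R L]
  [AddCommGroup N] [Module ℝ N] [Module R N] [IsScalarTower ℝ R N]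
  [AddCommGroup N₁] [Module ℝ N₁] [Module R N₁] [IsScalarTower ℝ R N₁]
  [AddCommGroup N₂] [Module ℝ N₂] [Module R N₂] [IsScalarTower ℝ R N₂]
  [AddCommGroup N₃] [Module ℝ N₃] [Module R N₃] [IsScalarTower ℝ R N₃]

/-- An antisymmetric function that is linear in the first slot is an alternating map. -/
def alternatingOfFirstSlot {n : ℕ} (g : (Fin (n + 1) → L) → N)
    (hperm : ∀ (v : Fin (n + 1) → L) (τ : Equiv.Perm (Fin (n + 1))),
      g (v ∘ τ) = Equiv.Perm.sign τ • g v)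
    (hadd : ∀ (x y : L) (w : Fin n → L),
      g (Fin.cons (x + y) w) = g (Fin.cons x w) + g (Fin.cons y w))
    (hsmul : ∀ (f : R) (x : L) (w : Fin n → L), g (Fin.cons (f • x) w) = f • g (Fin.cons x w)) :
    Form R L N (n + 1) where
  toFun := g
  map_update_add' := by
    intro dec v i x y
    obtain rfl : dec = instDecidableEqFin (n + 1) := Subsingleton.elim _ _
    have key : ∀ z : L, g (Function.update v i z)
        = Equiv.Perm.sign (Equiv.swap 0 i) • g (Fin.cons z (Fin.tail (v ∘ Equiv.swap 0 i))) := by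
      intro z
      rw [← hperm]
      congr 1
      ext j
      rcases eq_or_ne j i with rfl | hj
      · simp
      · rcases eq_or_ne j 0 with rfl | hj0
        · obtain ⟨k, rfl⟩ := Fin.exists_succ_eq.mpr hj.symm
          simp [Function.update_of_ne hj, Fin.tail]
        · obtain ⟨k, rfl⟩ := Fin.exists_succ_eq.mpr hj0
          have hh : Equiv.swap 0 i k.succ = k.succ := Equiv.swap_apply_of_ne_of_ne hj0 hj
          simp [Function.update_of_ne hj, Fin.tail, hh]
    rw [key, key, key, hadd, smul_add]
  map_update_smul' := by
    intro dec v i f x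
    obtain rfl : dec = instDecidableEqFin (n + 1) := Subsingleton.elim _ _
    have key : ∀ z : L, g (Function.update v i z)
        = Equiv.Perm.sign (Equiv.swap 0 i) • g (Fin.cons z (Fin.tail (v ∘ Equiv.swap 0 i))) := by
      intro z
      rw [← hperm]
      congr 1
      ext j
      rcases eq_or_ne j i with rfl | hj
      · simp
      · rcases eq_or_ne j 0 with rfl | hj0
        · obtain ⟨k, rfl⟩ := Fin.exists_succ_eq.mpr hj.symm
          simp [Function.update_of_ne hj, Fin.tail]
        · obtain ⟨k, rfl⟩ := Fin.exists_succ_eq.mpr hj0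
          have hh : Equiv.swap 0 i k.succ = k.succ := Equiv.swap_apply_of_ne_of_ne hj0 hj
          simp [Function.update_of_ne hj, Fin.tail, hh]
    rw [key, key, hsmul, smul_comm]
  map_eq_zero_of_eq' := by
    intro v i j hv hij
    have h1 : v ∘ Equiv.swap i j = v := by
      ext k
      rcases eq_or_ne k i with rfl | hki
      · simp [hv]
      · rcases eq_or_ne k j with rfl | hkj
        · simp [hv]
        · simp [Equiv.swap_apply_of_ne_of_ne hki hkj]
    have h2 := hperm v (Equiv.swap i j)
    rw [h1, Equiv.Perm.sign_swap hij] at h2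
    have h3 : (2 : ℝ) • g v = 0 := by
      rw [two_smul]; nth_rewrite 1 [h2]; simp
    exact (smul_eq_zero.mp h3).resolve_left two_ne_zero

namespace LinearConnection
variable (D : LinearConnection R L N)

theorem koszul_form {s : ℕ} (η : Form R L N s) (v : Fin (s + 1) → L) :
    D.koszul η v = ((s.factorial : ℝ)⁻¹) •
      Alt (fun u : Fin (s + 1) → L => D.lieTerm η (u 0) (Fin.tail u)) v := by
  rw [← koszul_Alt]
  congr 1
  funext w
  exact eq_Alt η w

theorem koszul_perm {s : ℕ} (η : Form R L N s) (v : Fin (s + 1) → L)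
    (τ : Equiv.Perm (Fin (s + 1))) :
    D.koszul η (v ∘ τ) = Equiv.Perm.sign τ • D.koszul η v := by
  rw [koszul_form, koszul_form, Alt_comp_perm, smul_comm]

theorem removeNth_succ_cons {n : ℕ} (k : Fin (n + 1)) (x : L) (w : Fin (n + 1) → L) :
    (k.succ).removeNth (Fin.cons x w : Fin (n + 2) → L) = Fin.cons x (k.removeNth w) := by
  ext j
  refine Fin.cases ?_ (fun j => ?_) j
  · simp [Fin.removeNth]
  · simp [Fin.removeNth]

theorem update_succ_cons {n : ℕ} (k : Fin n) (x y : L) (w : Fin n → L) :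
    Function.update (Fin.cons x w : Fin (n + 1) → L) k.succ y
      = Fin.cons x (Function.update w k y) := (Fin.cons_update (α := fun _ => L) x w k y).symm

/-- Expansion of the Koszul sum along the first slot. -/
theorem koszul_cons {s : ℕ} (η : Form R L N (s + 1)) (x : L) (w : Fin (s + 1) → L) :
    D.koszul η (Fin.cons x w) = D.lieTerm η x w - ∑ k : Fin (s + 1), (-1 : ℤ) ^ (k : ℕ) •
      D.lieTerm η (w k) (Fin.cons x (k.removeNth w)) := by
  rw [koszul, Fin.sum_univ_succ, sub_eq_add_neg, ← Finset.sum_neg_distrib]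
  congr 1
  · simp [Fin.removeNth_zero]
  · refine Finset.sum_congr rfl fun k _ => ?_
    rw [removeNth_succ_cons, Fin.cons_succ, Fin.val_succ, pow_succ, mul_neg_one, neg_smul]

theorem cons_add {s : ℕ} (η : Form R L N (s + 1)) (x y : L) (w : Fin s → L) :
    η (Fin.cons (x + y) w) = η (Fin.cons x w) + η (Fin.cons y w) := by
  exact η.map_vecCons_add w x y

theorem cons_smul {s : ℕ} (η : Form R L N (s + 1)) (f : R) (x : L) (w : Fin s → L) :
    η (Fin.cons (f • x) w) = f • η (Fin.cons x w) := by
  exact η.map_vecCons_smul w f x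

theorem lieTerm_cons {s : ℕ} (η : Form R L N (s + 1)) (a x : L) (w : Fin s → L) :
    D.lieTerm η a (Fin.cons x w) = D.nabla a (η (Fin.cons x w))
      - (1 / 2 : ℝ) • (η (Fin.cons ⁅a, x⁆ w)
        + ∑ j, η (Fin.cons x (Function.update w j ⁅a, w j⁆))) := by
  rw [lieTerm, Fin.sum_univ_succ]
  simp only [Fin.cons_zero, Fin.cons_succ, update_succ_cons, Fin.update_cons_zero]

theorem koszul_add_slot {s : ℕ} (η : Form R L N s) (x y : L) (w : Fin s → L) :
    D.koszul η (Fin.cons (x + y) w) = D.koszul η (Fin.cons x w) + D.koszul η (Fin.cons y w) := by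
  cases s with
  | zero => simp [koszul, lieTerm, Fin.removeNth_zero]
  | succ s =>
    rw [koszul_cons, koszul_cons, koszul_cons]
    have h1 : D.lieTerm η (x + y) w = D.lieTerm η x w + D.lieTerm η y w := by
      simp only [lieTerm, map_add, LinearMap.add_apply, add_lie, AlternatingMap.map_update_add,
        Finset.sum_add_distrib, smul_add]
      abel
    have h2 : ∀ k : Fin (s + 1), D.lieTerm η (w k) (Fin.cons (x + y) (k.removeNth w))
        = D.lieTerm η (w k) (Fin.cons x (k.removeNth w))
          + D.lieTerm η (w k) (Fin.cons y (k.removeNth w)) := by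
      intro k
      simp only [lieTerm_cons, lie_add, cons_add, map_add, Finset.sum_add_distrib, smul_add]
      abel
    simp only [h1, h2, smul_add, Finset.sum_add_distrib]
    abel

theorem koszul_smul_slot {s : ℕ} (η : Form R L N s) (f : R) (x : L) (w : Fin s → L) :
    D.koszul η (Fin.cons (f • x) w) = f • D.koszul η (Fin.cons x w) := by
  cases s with
  | zero => simp [koszul, lieTerm, Fin.removeNth_zero]
  | succ s =>
    rw [koszul_cons, koszul_cons]
    have hb : ∀ y : L, ⁅f • x, y⁆ = f • ⁅x, y⁆ - ⁅y, f⁆ • x := by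
      intro y
      rw [← lie_skew, LieRinehartRing.leibniz_smul_right, neg_add, ← smul_neg, lie_skew,
        sub_eq_add_neg]
    have hup : ∀ k : Fin (s + 1), η (Function.update w k x)
        = (-1 : ℤ) ^ (k : ℕ) • η (Fin.cons x (k.removeNth w)) := by
      intro k
      rw [← Fin.insertNth_removeNth, AlternatingMap.map_insertNth]
      rfl
    have h1 : D.lieTerm η (f • x) w = f • D.lieTerm η x w
        + (1 / 2 : ℝ) • ∑ k : Fin (s + 1), (-1 : ℤ) ^ (k : ℕ) •
          ⁅w k, f⁆ • η (Fin.cons x (k.removeNth w)) := by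
      simp only [lieTerm, map_smul, LinearMap.smul_apply, hb, AlternatingMap.map_update_sub,
        AlternatingMap.map_update_smul, Finset.sum_sub_distrib, smul_sub, hup, Finset.smul_sum]
      simp only [smul_comm f ((1 : ℝ) / 2), smul_comm _ ((-1 : ℤ) ^ _)]
      abel
    have h2 : ∀ k : Fin (s + 1), D.lieTerm η (w k) (Fin.cons (f • x) (k.removeNth w))
        = f • D.lieTerm η (w k) (Fin.cons x (k.removeNth w))
          + (1 / 2 : ℝ) • ⁅w k, f⁆ • η (Fin.cons x (k.removeNth w)) := by
      intro k
      simp only [lieTerm_cons, LieRinehartRing.leibniz_smul_right, cons_add, cons_smul, D.leibniz,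
        ← Finset.smul_sum, smul_add, smul_sub]
      simp only [smul_comm f ((1 : ℝ) / 2)]
      have : ∀ z : N, z - (1 / 2 : ℝ) • z = (1 / 2 : ℝ) • z := by
        intro z
        nth_rewrite 1 [← one_smul ℝ z]
        rw [← sub_smul]; norm_num
      have h3 := this (⁅w k, f⁆ • η (Fin.cons x (k.removeNth w)))
      rw [← sub_eq_zero] at h3 ⊢
      rw [← h3]
      abel
    simp only [h1, h2, smul_add, Finset.sum_add_distrib, smul_sub, Finset.smul_sum]
    simp only [smul_comm ((1 : ℝ) / 2) ((-1 : ℤ) ^ _), smul_comm f ((-1 : ℤ) ^ _)]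
    abel

/-- The covariant differential `d_∇` on `s`-forms; `d_apply_koszul` is the usual formula for it. -/
def d (s : ℕ) : Form R L N s →ₗ[ℝ] Form R L N (s + 1) where
  toFun η := alternatingOfFirstSlot (D.koszul η) (D.koszul_perm η) (D.koszul_add_slot η)
    (D.koszul_smul_slot η)
  map_add' η θ := by
    ext v
    change D.koszul (⇑(η + θ)) v = D.koszul η v + D.koszul θ v
    simp only [koszul, lieTerm, AlternatingMap.add_apply, map_add, Finset.sum_add_distrib,
      smul_add, smul_sub]
    rw [← Finset.sum_add_distrib]
    exact Finset.sum_congr rfl fun i _ => by abel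
  map_smul' c η := by
    ext v
    change D.koszul (⇑(c • η)) v = c • D.koszul η v
    simp only [koszul, lieTerm, AlternatingMap.smul_apply, map_smul, Finset.smul_sum, smul_sub]
    exact Finset.sum_congr rfl fun i _ => by
      simp only [smul_comm c]

theorem d_apply {s : ℕ} (η : Form R L N s) (v : Fin (s + 1) → L) :
    D.d s η v = D.koszul η v := rfl

/-- The usual formula
`(d_∇ η)(v_0, …, v_n) = ∑_i (-1)^i ∇_{v_i} η(…, v̂_i, …)
  + ∑_{i < j} (-1)^{i + j} η(⁅v_i, v_j⁆, …, v̂_i, …, v̂_j, …)`;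
the index `j` below is one less than the `j` here. -/
theorem d_apply_koszul {s : ℕ} (η : Form R L N (s + 1)) (v : Fin (s + 2) → L) :
    D.d (s + 1) η v = (∑ i : Fin (s + 2), (-1 : ℤ) ^ (i : ℕ) • D.nabla (v i) (η (i.removeNth v)))
      - ∑ i : Fin (s + 1), ∑ j ≥ i, (-1 : ℤ) ^ ((i : ℕ) + (j : ℕ)) •
        η (Fin.cons ⁅v i.castSucc, v j.succ⁆ (j.removeNth (i.castSucc.removeNth v))) := by
  rw [d_apply, koszul]
  simp only [lieTerm, smul_sub, Finset.sum_sub_distrib]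
  congr 1
  simp only [Finset.smul_sum]
  rw [Fin.sum_sum_eq_sum_triangle_add]
  refine Finset.sum_congr rfl fun i _ => Finset.sum_congr rfl fun j hj => ?_
  rw [Finset.mem_Ici] at hj
  have H₁ : i.castSucc.succAbove j = j.succ := by simp [Fin.succAbove_of_le_castSucc, hj]
  have H₃ : j.succ.succAbove i = i.castSucc := by simp [Fin.succAbove_of_castSucc_lt, hj]
  have H₂ : j.predAbove i.castSucc = i := by simp [Fin.predAbove_of_le_castSucc, hj]
  have e1 : η (Function.update (i.castSucc.removeNth v) j
      ⁅v i.castSucc, i.castSucc.removeNth v j⁆) = (-1 : ℤ) ^ (j : ℕ) •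
        η (Fin.cons ⁅v i.castSucc, v j.succ⁆ (j.removeNth (i.castSucc.removeNth v))) := by
    rw [← Fin.insertNth_removeNth, AlternatingMap.map_insertNth]
    simp only [Fin.removeNth, H₁]
    rfl
  have e2 : η (Function.update (j.succ.removeNth v) i
      ⁅v j.succ, j.succ.removeNth v i⁆) = -((-1 : ℤ) ^ (i : ℕ) •
        η (Fin.cons ⁅v i.castSucc, v j.succ⁆ (j.removeNth (i.castSucc.removeNth v)))) := by
    rw [← Fin.insertNth_removeNth, AlternatingMap.map_insertNth]
    have : i.removeNth (j.succ.removeNth v) = j.removeNth (i.castSucc.removeNth v) := by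
      rw [Fin.removeNth_removeNth_eq_swap v j i.castSucc, H₁, H₂]
    rw [this]
    simp only [Fin.removeNth, H₃]
    rw [← lie_skew, ← smul_neg]
    congr 1
    rw [← neg_one_smul R, ← neg_one_smul R (η _)]
    exact cons_smul η (-1) _ _
  rw [e1, e2]
  simp only [Fin.val_castSucc, Fin.val_succ]
  generalize η (Fin.cons ⁅v i.castSucc, v j.succ⁆ (j.removeNth (i.castSucc.removeNth v))) = z
  simp only [smul_neg, smul_comm ((-1 : ℤ) ^ _) ((1 : ℝ) / 2), smul_smul, ← pow_add, pow_succ,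
    mul_neg_one, neg_smul]
  have hz : ∀ y : N, (1 / 2 : ℝ) • y + (1 / 2 : ℝ) • y = y := by
    intro y; rw [← add_smul]; norm_num
  conv_rhs => rw [← hz ((-1 : ℤ) ^ ((i : ℕ) + (j : ℕ)) • z)]
  simp [pow_add, mul_comm]

end LinearConnection
end Diff

section Total
variable {R L N N₁ N₂ N₃ N₁₂ N₂₃ : Type*} [CommRing R] [Algebra ℝ R]
  [LieRing L] [LieAlgebra ℝ L] [Module R L] [LieRingModule L R] [LieRinehartRing R L]
  [LieRinehartAlgebra ℝ R L]
  [AddCommGroup N] [Module ℝ N] [Module R N] [IsScalarTower ℝ R N]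
  [AddCommGroup N₁] [Module ℝ N₁] [Module R N₁] [IsScalarTower ℝ R N₁]
  [AddCommGroup N₂] [Module ℝ N₂] [Module R N₂] [IsScalarTower ℝ R N₂]
  [AddCommGroup N₃] [Module ℝ N₃] [Module R N₃] [IsScalarTower ℝ R N₃]
  [AddCommGroup N₁₂] [Module ℝ N₁₂] [Module R N₁₂] [IsScalarTower ℝ R N₁₂]
  [AddCommGroup N₂₃] [Module ℝ N₂₃] [Module R N₂₃] [IsScalarTower ℝ R N₂₃]

theorem wedge_assoc_apply (B₁ : N₁ →ₗ[R] N₂ →ₗ[R] N₁₂) (B₂ : N₁₂ →ₗ[R] N₃ →ₗ[R] N)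
    (B₃ : N₂ →ₗ[R] N₃ →ₗ[R] N₂₃) (B₄ : N₁ →ₗ[R] N₂₃ →ₗ[R] N)
    (hB : ∀ x y z, B₂ (B₁ x y) z = B₄ x (B₃ y z)) {p q r : ℕ}
    (α : Form R L N₁ p) (β : Form R L N₂ q) (γ : Form R L N₃ r) (v : Fin (p + (q + r)) → L) :
    wedge B₂ (p + q) r (wedge B₁ p q α β) γ (v ∘ Fin.cast (add_assoc p q r))
      = wedge B₄ p (q + r) α (wedge B₃ q r β γ) v := by
  rw [wedge_eq_Alt B₂ _ _ (wedge_eq_Alt' B₁ α β) (eq_Alt γ),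
    wedge_eq_Alt B₄ _ _ (eq_Alt α) (wedge_eq_Alt' B₃ β γ), ← Alt_cast]
  congr 1
  · ring
  · congr 1
    funext w
    have h1 : ((w ∘ Fin.cast (add_assoc p q r)) ∘ Fin.castAdd r) ∘ Fin.castAdd q
        = w ∘ Fin.castAdd (q + r) := by
      funext i; exact congrArg w (Fin.ext (by simp))
    have h2 : ((w ∘ Fin.cast (add_assoc p q r)) ∘ Fin.castAdd r) ∘ Fin.natAdd p
        = (w ∘ Fin.natAdd p) ∘ Fin.castAdd r := by
      funext i; exact congrArg w (Fin.ext (by simp))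
    have h3 : (w ∘ Fin.cast (add_assoc p q r)) ∘ Fin.natAdd (p + q)
        = (w ∘ Fin.natAdd p) ∘ Fin.natAdd q := by
      funext i; exact congrArg w (Fin.ext (by simp [add_assoc]))
    simp only [tensorFun, pairingHom_apply, hB, h1, h2, h3]

theorem lieTerm_tensorFun (B : N₁ →ₗ[R] N₂ →ₗ[R] N₃) (D₁ : LinearConnection R L N₁)
    (D₂ : LinearConnection R L N₂) (D₃ : LinearConnection R L N₃)
    (hB : ∀ a x y, D₃.nabla a (B x y) = B (D₁.nabla a x) y + B x (D₂.nabla a y))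
    {p q : ℕ} (g : (Fin p → L) → N₁) (h : (Fin q → L) → N₂) (a : L) (w : Fin (p + q) → L) :
    D₃.lieTerm (tensorFun (pairingHom B) g h) a w
      = tensorFun (pairingHom B) (D₁.lieTerm g a) h w
        + tensorFun (pairingHom B) g (D₂.lieTerm h a) w := by
  have h1 : ∀ j : Fin p, ∀ y : L, (Function.update w (Fin.castAdd q j) y) ∘ Fin.castAdd q
      = Function.update (w ∘ Fin.castAdd q) j y := by
    intro j y
    exact Function.update_comp_eq_of_injective w (Fin.castAdd_injective p q) j y
  have h2 : ∀ j : Fin p, ∀ y : L, (Function.update w (Fin.castAdd q j) y) ∘ Fin.natAdd p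
      = w ∘ Fin.natAdd p := by
    intro j y
    refine Function.update_comp_eq_of_forall_ne w y fun x => ?_
    intro hx
    have := congrArg Fin.val hx
    simp at this
    omega
  have h3 : ∀ j : Fin q, ∀ y : L, (Function.update w (Fin.natAdd p j) y) ∘ Fin.natAdd p
      = Function.update (w ∘ Fin.natAdd p) j y := by
    intro j y
    exact Function.update_comp_eq_of_injective w (Fin.natAdd_injective q p) j y
  have h4 : ∀ j : Fin q, ∀ y : L, (Function.update w (Fin.natAdd p j) y) ∘ Fin.castAdd q
      = w ∘ Fin.castAdd q := by
    intro j y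
    refine Function.update_comp_eq_of_forall_ne w y fun x => ?_
    intro hx
    have := congrArg Fin.val hx
    simp at this
    omega
  have hr : ∀ (c : ℝ) (x : N₁) (y : N₂), B (c • x) y = c • B x y := by
    intro c x y
    rw [← algebraMap_smul R c x, map_smul, LinearMap.smul_apply, algebraMap_smul]
  have hr' : ∀ (c : ℝ) (x : N₁) (y : N₂), B x (c • y) = c • B x y := by
    intro c x y
    rw [← algebraMap_smul R c y, map_smul, algebraMap_smul]
  simp only [LinearConnection.lieTerm, tensorFun, pairingHom_apply]
  simp only [Fin.sum_univ_add, h1, h2, h3, h4, hB, map_sub, LinearMap.sub_apply, hr, hr', map_sum, LinearMap.sum_apply, smul_add,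
    Function.comp_apply]
  abel

/-- The graded Leibniz rule. -/
theorem d_wedge_apply (B : N₁ →ₗ[R] N₂ →ₗ[R] N₃) (D₁ : LinearConnection R L N₁)
    (D₂ : LinearConnection R L N₂) (D₃ : LinearConnection R L N₃)
    (hB : ∀ a x y, D₃.nabla a (B x y) = B (D₁.nabla a x) y + B x (D₂.nabla a y))
    {p q : ℕ} (α : Form R L N₁ p) (β : Form R L N₂ q) (v : Fin (p + q + 1) → L) :
    D₃.d (p + q) (wedge B p q α β) v
      = wedge B (p + 1) q (D₁.d p α) β (v ∘ Fin.cast (by omega))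
        + (-1 : ℤ) ^ p • wedge B p (q + 1) α (D₂.d q β) v := by
  have e1 : (⇑(wedge B p q α β) : (Fin (p + q) → L) → N₃) = fun u =>
      ((p.factorial : ℝ)⁻¹ * (q.factorial : ℝ)⁻¹) • Alt (tensorFun (pairingHom B) α β) u :=
    funext (wedge_eq_Alt' B α β)
  rw [LinearConnection.d_apply, e1, LinearConnection.koszul_Alt,
    wedge_eq_Alt B _ _ (fun u => D₁.koszul_form α u) (eq_Alt β),
    wedge_eq_Alt B _ _ (eq_Alt α) (fun u => D₂.koszul_form β u), ← Alt_cast,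
    smul_comm ((-1 : ℤ) ^ p), ← smul_add]
  congr 1
  have e2 : ∀ u : Fin (p + (q + 1)) → L, tensorFun (pairingHom B) α (D₂.lieTerm β (u 0)) (Fin.tail u)
      = (fun w : Fin (p + (q + 1)) → L => tensorFun (pairingHom B) α
          (fun z : Fin (q + 1) → L => D₂.lieTerm β (z 0) (Fin.tail z)) w)
          (u ∘ Fin.cycleRange (Fin.natAdd p (0 : Fin (q + 1)))) := by
    intro u
    simp only [tensorFun]
    congr 1
    · congr 2
      ext i
      have : Fin.cycleRange (Fin.natAdd p (0 : Fin (q + 1))) (Fin.castAdd (q + 1) i)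
          = Fin.succ (Fin.castAdd q i) := by
        rw [Fin.cycleRange_of_lt (by simp [Fin.lt_def])]
        ext
        rw [Fin.val_add_one_of_lt' (by simp; omega)]
        simp
      simp only [Function.comp_apply, this]
      rfl
    · have h0 : Fin.cycleRange (Fin.natAdd p (0 : Fin (q + 1))) (Fin.natAdd p (0 : Fin (q + 1)))
          = 0 := by rw [Fin.cycleRange_self]
      congr 1
      · simp only [Function.comp_apply, h0]
      · ext i
        have : Fin.cycleRange (Fin.natAdd p (0 : Fin (q + 1))) (Fin.natAdd p i.succ)
            = Fin.natAdd p i.succ := by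
          rw [Fin.cycleRange_of_gt (by simp [Fin.lt_def])]
        simp only [Function.comp_apply, Fin.tail, this]
        rfl
  have e3 : Alt (fun u : Fin (p + q + 1) → L =>
      D₃.lieTerm (tensorFun (pairingHom B) α β) (u 0) (Fin.tail u)) v
      = Alt (fun u : Fin (p + q + 1) → L =>
          tensorFun (pairingHom B) (D₁.lieTerm α (u 0)) β (Fin.tail u)) v
        + Alt (fun u : Fin (p + q + 1) → L =>
          tensorFun (pairingHom B) α (D₂.lieTerm β (u 0)) (Fin.tail u)) v := by
    rw [← Alt_add]
    congr 1
    funext u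
    exact lieTerm_tensorFun B D₁ D₂ D₃ hB _ _ _ _
  rw [e3]
  congr 1
  · congr 1
    funext u
    have h1 : (u ∘ Fin.cast (show p + 1 + q = p + q + 1 by omega)) ∘ Fin.natAdd (p + 1)
        = Fin.tail u ∘ Fin.natAdd p := by
      funext i; exact congrArg u (Fin.ext (by simp; omega))
    have h2 : Fin.tail ((u ∘ Fin.cast (show p + 1 + q = p + q + 1 by omega)) ∘ Fin.castAdd q)
        = Fin.tail u ∘ Fin.castAdd q := by
      funext i; exact congrArg u (Fin.ext (by simp))
    have h3 : ((u ∘ Fin.cast (show p + 1 + q = p + q + 1 by omega)) ∘ Fin.castAdd q) 0 = u 0 :=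
      congrArg u (Fin.ext (by simp))
    simp only [tensorFun, h1, h2, h3]
  · have := Alt_domPerm (fun w : Fin (p + (q + 1)) → L => tensorFun (pairingHom B) α
          (fun z : Fin (q + 1) → L => D₂.lieTerm β (z 0) (Fin.tail z)) w)
          (Fin.cycleRange (Fin.natAdd p (0 : Fin (q + 1)))) v
    have e4 := congrArg (fun F => Alt F v) (funext e2)
    refine e4.trans (this.trans ?_)
    rw [Fin.sign_cycleRange]
    simp only [Fin.val_natAdd, Fin.val_zero, add_zero]
    rcases Nat.even_or_odd p with h | h <;> simp [h.neg_one_pow]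

end Total

section Complex
variable {R L N N₁ N₂ N₃ N₁₂ N₂₃ : Type*} [CommRing R] [Algebra ℝ R]
  [LieRing L] [LieAlgebra ℝ L] [Module R L] [LieRingModule L R] [LieRinehartRing R L]
  [LieRinehartAlgebra ℝ R L]
  [AddCommGroup N] [Module ℝ N] [Module R N] [IsScalarTower ℝ R N]
  [AddCommGroup N₁] [Module ℝ N₁] [Module R N₁] [IsScalarTower ℝ R N₁]
  [AddCommGroup N₂] [Module ℝ N₂] [Module R N₂] [IsScalarTower ℝ R N₂]
  [AddCommGroup N₃] [Module ℝ N₃] [Module R N₃] [IsScalarTower ℝ R N₃]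
  [AddCommGroup N₁₂] [Module ℝ N₁₂] [Module R N₁₂] [IsScalarTower ℝ R N₁₂]
  [AddCommGroup N₂₃] [Module ℝ N₂₃] [Module R N₂₃] [IsScalarTower ℝ R N₂₃]

instance instTowerForm (s : ℕ) : IsScalarTower ℝ R (Form R L N s) :=
  ⟨fun c f θ => by ext v; exact smul_assoc c f (θ v)⟩

variable (R L N) in
/-- The graded space of all `N`-valued forms, `Ω^•(L, N)`. -/
abbrev Forms := ⨁ s : ℕ, Form R L N s

/-- Inclusion of `s`-forms. -/
abbrev homog (s : ℕ) : Form R L N s →ₗ[ℝ] Forms R L N :=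
  DirectSum.lof ℝ ℕ (fun s => Form R L N s) s

theorem homog_cast {m n : ℕ} (h : m = n) (x : Form R L N m) (y : Form R L N n)
    (hxy : ∀ v, y v = x (v ∘ Fin.cast h)) : homog m x = homog n y := by
  subst h
  congr 1
  ext v
  exact (hxy v).symm

/-- The wedge product along a pairing, on forms of all degrees. -/
def totalWedge (B : N₁ →ₗ[R] N₂ →ₗ[R] N₃) :
    Forms R L N₁ →ₗ[ℝ] Forms R L N₂ →ₗ[ℝ] Forms R L N₃ :=
  DirectSum.toModule ℝ ℕ _ fun p => LinearMap.flip <| DirectSum.toModule ℝ ℕ _ fun q =>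
    LinearMap.mk₂ ℝ (fun β α => homog (p + q) (wedge B p q α β))
      (fun β β' α => by simp)
      (fun c β α => by
        rw [← algebraMap_smul R c β, map_smul, algebraMap_smul, map_smul])
      (fun β α α' => by simp)
      (fun c β α => by
        rw [← algebraMap_smul R c α, map_smul, LinearMap.smul_apply, algebraMap_smul, map_smul])

@[simp] theorem totalWedge_homog (B : N₁ →ₗ[R] N₂ →ₗ[R] N₃) (p q : ℕ) (α : Form R L N₁ p)
    (β : Form R L N₂ q) :
    totalWedge B (homog p α) (homog q β) = homog (p + q) (wedge B p q α β) := by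
  simp [totalWedge, homog]

theorem Forms.induction {P : Forms R L N → Prop} (x : Forms R L N) (h0 : P 0)
    (h1 : ∀ s (θ : Form R L N s), P (homog s θ)) (h2 : ∀ y z, P y → P z → P (y + z)) : P x :=
  DirectSum.induction_on x h0 h1 h2

theorem totalWedge_assoc (B₁ : N₁ →ₗ[R] N₂ →ₗ[R] N₁₂) (B₂ : N₁₂ →ₗ[R] N₃ →ₗ[R] N)
    (B₃ : N₂ →ₗ[R] N₃ →ₗ[R] N₂₃) (B₄ : N₁ →ₗ[R] N₂₃ →ₗ[R] N)
    (hB : ∀ x y z, B₂ (B₁ x y) z = B₄ x (B₃ y z))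
    (x : Forms R L N₁) (y : Forms R L N₂) (z : Forms R L N₃) :
    totalWedge B₂ (totalWedge B₁ x y) z = totalWedge B₄ x (totalWedge B₃ y z) := by
  induction x using Forms.induction with
  | h0 => simp
  | h2 a b ha hb => simp [ha, hb]
  | h1 p α =>
    induction y using Forms.induction with
    | h0 => simp
    | h2 a b ha hb => simp [ha, hb]
    | h1 q β =>
      induction z using Forms.induction with
      | h0 => simp
      | h2 a b ha hb => rw [map_add, map_add, map_add, ha, hb]
      | h1 r γ =>
        simp only [totalWedge_homog]
        exact homog_cast (add_assoc p q r) _ _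
          fun v => (wedge_assoc_apply B₁ B₂ B₃ B₄ hB α β γ v).symm

/-- A function or section as a 0-form. -/
def zeroForm : N →ₗ[ℝ] Forms R L N where
  toFun e := homog 0 (AlternatingMap.constOfIsEmpty R L (Fin 0) e)
  map_add' e e' := by rw [← map_add]; rfl
  map_smul' c e := by rw [RingHom.id_apply, ← map_smul]; rfl

theorem zeroForm_wedge (B : N₁ →ₗ[R] N₂ →ₗ[R] N₃) (f : N₁) (q : ℕ) (β : Form R L N₂ q) :
    totalWedge B (zeroForm f) (homog q β) = homog q ((B f).compAlternatingMap β) := by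
  change totalWedge B (homog 0 _) _ = _
  rw [totalWedge_homog]
  refine homog_cast (zero_add q) _ _ fun v => ?_
  rw [wedge_eq_Alt', ← Alt_cast (zero_add q), LinearMap.compAlternatingMap_apply, eq_Alt β v]
  have h : (fun w : Fin q → L => tensorFun (pairingHom B)
      (AlternatingMap.constOfIsEmpty R L (Fin 0) f) β (w ∘ Fin.cast (zero_add q)))
      = fun w => (B f).toAddMonoidHom (β w) := by
    funext w
    have : (w ∘ Fin.cast (zero_add q)) ∘ Fin.natAdd 0 = w := by
      funext i; exact congrArg w (Fin.ext (by simp))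
    simp only [tensorFun, pairingHom_apply, this]
    rfl
  rw [h, Alt_map, ← algebraMap_smul R (_ : ℝ) (Alt (β : (Fin q → L) → N₂) v), map_smul,
    algebraMap_smul]
  simp

theorem wedge_zeroForm (B : N₁ →ₗ[R] N₂ →ₗ[R] N₃) (e : N₂) (p : ℕ) (α : Form R L N₁ p) :
    totalWedge B (homog p α) (zeroForm e) = homog p ((B.flip e).compAlternatingMap α) := by
  change totalWedge B _ (homog 0 _) = _
  rw [totalWedge_homog]
  refine homog_cast (add_zero p) _ _ fun v => ?_
  rw [wedge_eq_Alt', ← Alt_cast (add_zero p), LinearMap.compAlternatingMap_apply, eq_Alt α v]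
  have h : (fun w : Fin p → L => tensorFun (pairingHom B) α
      (AlternatingMap.constOfIsEmpty R L (Fin 0) e) (w ∘ Fin.cast (add_zero p)))
      = fun w => (B.flip e).toAddMonoidHom (α w) := by
    funext w
    simp only [tensorFun, pairingHom_apply]
    rfl
  rw [h, Alt_map, ← algebraMap_smul R (_ : ℝ) (Alt (α : (Fin p → L) → N₁) v), map_smul,
    algebraMap_smul]
  simp

/-- The wedge product of scalar forms. -/
instance instMulForms : Mul (Forms R L R) := ⟨fun x y => totalWedge (LinearMap.mul R R) x y⟩
instance instOneForms : One (Forms R L R) := ⟨zeroForm 1⟩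

theorem mul_def (x y : Forms R L R) : x * y = totalWedge (LinearMap.mul R R) x y := rfl
theorem one_def : (1 : Forms R L R) = zeroForm 1 := rfl

instance instNonUnitalNonAssocRingForms : NonUnitalNonAssocRing (Forms R L R) where
  __ := (inferInstance : AddCommGroup (Forms R L R))
  left_distrib x y z := by simp [mul_def]
  right_distrib x y z := by simp [mul_def]
  zero_mul x := by simp [mul_def]
  mul_zero x := by simp [mul_def]

instance instRingForms : Ring (Forms R L R) where
  __ := (inferInstance : NonUnitalNonAssocRing (Forms R L R))
  mul_assoc x y z := totalWedge_assoc _ _ _ _ (fun a b c => mul_assoc a b c) x y z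
  one_mul x := by
    rw [mul_def, one_def]
    induction x using Forms.induction with
    | h0 => simp
    | h2 a b ha hb => rw [map_add, ha, hb]
    | h1 s θ =>
      rw [zeroForm_wedge]
      congr 1; ext v; simp
  mul_one x := by
    rw [mul_def, one_def]
    induction x using Forms.induction with
    | h0 => simp
    | h2 a b ha hb => rw [map_add, LinearMap.add_apply, ha, hb]
    | h1 s θ =>
      rw [wedge_zeroForm]
      congr 1; ext v; simp

instance instAlgebraForms : Algebra ℝ (Forms R L R) :=
  Algebra.ofModule (fun c x y => by simp [mul_def]) (fun c x y => by simp [mul_def])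

/-- The grading involution, `(-1)^s` on `s`-forms. -/
def gradeInv : Forms R L N →ₗ[ℝ] Forms R L N :=
  DirectSum.toModule ℝ ℕ _ fun s => (-1 : ℝ) ^ s • homog s

@[simp] theorem gradeInv_homog (s : ℕ) (θ : Form R L N s) :
    gradeInv (homog s θ) = (-1 : ℝ) ^ s • homog s θ := by
  simp [gradeInv, homog]

@[simp] theorem gradeInv_gradeInv (x : Forms R L N) : gradeInv (gradeInv x) = x := by
  induction x using Forms.induction with
  | h0 => simp
  | h2 a b ha hb => simp [ha, hb]
  | h1 s θ => simp [smul_smul, ← mul_pow]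

namespace LinearConnection

/-- `d_∇` on all forms. -/
def totalD (D : LinearConnection R L N) : Forms R L N →ₗ[ℝ] Forms R L N :=
  DirectSum.toModule ℝ ℕ _ fun s => homog (s + 1) ∘ₗ D.d s

@[simp] theorem totalD_homog (D : LinearConnection R L N) (s : ℕ) (θ : Form R L N s) :
    D.totalD (homog s θ) = homog (s + 1) (D.d s θ) := by
  simp [totalD, homog]

theorem totalD_gradeInv (D : LinearConnection R L N) (x : Forms R L N) :
    D.totalD (gradeInv x) = -gradeInv (D.totalD x) := by
  induction x using Forms.induction with
  | h0 => simp
  | h2 a b ha hb => simp [ha, hb]; abel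
  | h1 s θ =>
    rw [gradeInv_homog, map_smul, totalD_homog, gradeInv_homog]
    refine eq_neg_of_add_eq_zero_left ?_
    rw [← add_smul, pow_succ, mul_neg_one, add_neg_cancel, zero_smul]

theorem totalD_wedge (B : N₁ →ₗ[R] N₂ →ₗ[R] N₃) (D₁ : LinearConnection R L N₁)
    (D₂ : LinearConnection R L N₂) (D₃ : LinearConnection R L N₃)
    (hB : ∀ a x y, D₃.nabla a (B x y) = B (D₁.nabla a x) y + B x (D₂.nabla a y))
    (x : Forms R L N₁) (y : Forms R L N₂) :
    D₃.totalD (totalWedge B x y)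
      = totalWedge B (D₁.totalD x) y + totalWedge B (gradeInv x) (D₂.totalD y) := by
  induction x using Forms.induction with
  | h0 => simp
  | h2 a b ha hb => simp [ha, hb]; abel
  | h1 p α =>
    induction y using Forms.induction with
    | h0 => simp
    | h2 a b ha hb => simp [ha, hb]; abel
    | h1 q β =>
      simp only [totalWedge_homog, totalD_homog, gradeInv_homog, map_smul, LinearMap.smul_apply]
      rw [homog_cast (show p + 1 + q = p + q + 1 by omega) (wedge B (p + 1) q (D₁.d p α) β)
        ((wedge B (p + 1) q (D₁.d p α) β).domDomCongr (finCongr (by omega))) (fun v => rfl)]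
      rw [← map_smul (homog (p + (q + 1)))]
      change _ = homog (p + q + 1) _ + homog (p + q + 1) _
      rw [← map_add]
      congr 1
      ext v
      rw [d_wedge_apply B D₁ D₂ D₃ hB]
      change _ = wedge B (p + 1) q (D₁.d p α) β (v ∘ Fin.cast (show p + 1 + q = p + q + 1 by omega))
        + (-1 : ℝ) ^ p • wedge B p (q + 1) α (D₂.d q β) v
      congr 1
      rcases Nat.even_or_odd p with h | h <;> simp [h.neg_one_pow]

end LinearConnection

variable (R L) in
/-- The differential `d_A` on all scalar forms: the covariant differential of the canonical flat
connection. -/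
def dA : Forms R L R →ₗ[ℝ] Forms R L R := (flatConnection R L).totalD

theorem dA_mul (x y : Forms R L R) : dA R L (x * y) = dA R L x * y + gradeInv x * dA R L y :=
  LinearConnection.totalD_wedge _ _ _ _ (fun a x y => by
    simp [add_comm, mul_comm]) x y

theorem dA_gradeInv (x : Forms R L R) : dA R L (gradeInv x) = -gradeInv (dA R L x) :=
  LinearConnection.totalD_gradeInv _ x

theorem dA_algebraMap (c : ℝ) : dA R L (algebraMap ℝ (Forms R L R) c) = 0 := by
  rw [Algebra.algebraMap_eq_smul_one, map_smul, one_def]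
  change c • (flatConnection R L).totalD (homog 0 _) = 0
  rw [LinearConnection.totalD_homog]
  have : (flatConnection R L).d 0 (AlternatingMap.constOfIsEmpty R L (Fin 0) 1) = 0 := by
    ext v
    have h1 : ∀ a : L, ⁅a, (1 : R)⁆ = 0 := by
      intro a
      have := LieRinehartRing.leibniz_mul_right a (1 : R) (1 : R)
      simpa using this
    rw [LinearConnection.d_apply]
    simp [LinearConnection.koszul, LinearConnection.lieTerm, h1]
  rw [this, map_zero, smul_zero]

variable (R L) in
/-- The closed forms. -/
def closedForms : Subalgebra ℝ (Forms R L R) where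
  carrier := {x | dA R L x = 0}
  mul_mem' := by
    intro x y hx hy
    change dA R L x = 0 at hx
    change dA R L y = 0 at hy
    change dA R L (x * y) = 0
    rw [dA_mul, hx, hy, zero_mul, mul_zero, add_zero]
  add_mem' := by
    intro x y hx hy
    change dA R L x = 0 at hx
    change dA R L y = 0 at hy
    change dA R L (x + y) = 0
    rw [map_add, hx, hy, add_zero]
  algebraMap_mem' := dA_algebraMap

variable (R L) in
/-- The exact forms, a two-sided ideal of the closed forms. -/
def exactForms : Ideal (closedForms R L) where
  carrier := {x | ∃ y, dA R L y = x}
  add_mem' := by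
    rintro x x' ⟨y, hy⟩ ⟨y', hy'⟩
    exact ⟨y + y', by rw [map_add, hy, hy']; rfl⟩
  zero_mem' := ⟨0, by simp⟩
  smul_mem' := by
    rintro ⟨c, hc⟩ ⟨x, hx⟩ ⟨y, hy⟩
    have hc' : dA R L c = 0 := hc
    refine ⟨gradeInv c * y, ?_⟩
    rw [dA_mul, dA_gradeInv, hc', gradeInv_gradeInv, hy]
    simp

instance instIsTwoSidedExactForms : (exactForms R L).IsTwoSided where
  mul_mem_of_left := by
    rintro ⟨x, hx⟩ ⟨c, hc⟩ ⟨y, hy⟩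
    have hc' : dA R L c = 0 := hc
    refine ⟨y * c, ?_⟩
    rw [dA_mul, hc', mul_zero, add_zero, hy]
    rfl

variable (R L) in
/-- The cohomology algebra `H^• = ker d_A / im d_A`. -/
abbrev Cohomology := closedForms R L ⧸ exactForms R L

theorem dA_dA_zeroForm (f : R) : dA R L (dA R L (zeroForm f)) = 0 := by
  change (flatConnection R L).totalD ((flatConnection R L).totalD (homog 0 _)) = 0
  rw [LinearConnection.totalD_homog, LinearConnection.totalD_homog]
  have : (flatConnection R L).d 1 ((flatConnection R L).d 0
      (AlternatingMap.constOfIsEmpty R L (Fin 0) f)) = 0 := by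
    ext v
    rw [LinearConnection.d_apply_koszul]
    simp [LinearConnection.d_apply, LinearConnection.koszul, LinearConnection.lieTerm,
      Fin.sum_univ_two, Fin.removeNth, lie_lie]
  rw [this, map_zero]

namespace LinearConnection
variable (D : LinearConnection R L N)

theorem totalD_smul (f : R) (x : Forms R L N) :
    D.totalD (D.totalD (f • x)) = f • D.totalD (D.totalD x) := by
  have hs : ∀ y : Forms R L N, totalWedge (LinearMap.lsmul R N) (zeroForm f) y = f • y := by
    intro y
    induction y using Forms.induction with
    | h0 => simp
    | h2 a b ha hb => rw [map_add, ha, hb, smul_add]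
    | h1 s θ =>
      rw [zeroForm_wedge]
      exact ((DirectSum.lof R ℕ (fun s => Form R L N s) s).map_smul f θ)
  have hB : ∀ (a : L) (x : R) (y : N), D.nabla a (LinearMap.lsmul R N x y)
      = LinearMap.lsmul R N ((flatConnection R L).nabla a x) y
        + LinearMap.lsmul R N x (D.nabla a y) := by
    intro a x y
    simp [D.leibniz, add_comm]
  have h2 := dA_dA_zeroForm (L := L) f
  rw [dA] at h2
  rw [← hs, totalD_wedge _ _ D D hB, map_add, totalD_wedge _ _ D D hB, totalD_wedge _ _ D D hB,
    h2, totalD_gradeInv, gradeInv_gradeInv, hs]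
  simp

theorem totalD_pow_smul (i : ℕ) (f : R) (x : Forms R L N) :
    (D.totalD ^ (2 * i)) (f • x) = f • (D.totalD ^ (2 * i)) x := by
  induction i with
  | zero => simp
  | succ i ih =>
    have : 2 * (i + 1) = 2 + 2 * i := by ring
    rw [this, pow_add, Module.End.mul_apply, Module.End.mul_apply, ih, pow_two,
      Module.End.mul_apply, Module.End.mul_apply, totalD_smul]

/-- The power `R_∇^i ∈ Ω^{2i}(L, End N)` of the curvature, given for `e ∈ N` by
`R_∇^i(v_1, …, v_{2i}) e = (d_∇^{2i} e)(v_1, …, v_{2i})`. -/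
def curvaturePow (i : ℕ) : Form R L (Module.End R N) (2 * i) where
  toFun v :=
    { toFun := fun e => ((D.totalD ^ (2 * i)) (zeroForm e)) (2 * i) v
      map_add' := fun e e' => by simp
      map_smul' := fun f e => by
        have : (zeroForm (f • e) : Forms R L N) = f • zeroForm e := by
          exact ((DirectSum.lof R ℕ (fun s => Form R L N s) 0).map_smul f
            (AlternatingMap.constOfIsEmpty R L (Fin 0) e))
        rw [this, totalD_pow_smul]
        rfl }
  map_update_add' v i x y := by ext e; simp
  map_update_smul' v i f x := by ext e; simp
  map_eq_zero_of_eq' v i j h hij := by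
    ext e
    exact AlternatingMap.map_eq_zero_of_eq _ v h hij

end LinearConnection

variable (R L N N₁) in
/-- The elements of total degree `n`: an `N`-valued `n`-form and an `N₁`-valued `(n - 1)`-form. -/
def totalDegree (n : ℕ) : Submodule ℝ (Forms R L N × Forms R L N₁) where
  carrier := {x | (∀ s, s ≠ n → x.1 s = 0) ∧ ∀ s, s + 1 ≠ n → x.2 s = 0}
  add_mem' := by
    rintro x y ⟨h1, h2⟩ ⟨h3, h4⟩
    exact ⟨fun s hs => by simp [h1 s hs, h3 s hs], fun s hs => by simp [h2 s hs, h4 s hs]⟩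
  zero_mem' := ⟨fun s _ => rfl, fun s _ => rfl⟩
  smul_mem' := by
    rintro c x ⟨h1, h2⟩
    refine ⟨fun s hs => ?_, fun s hs => ?_⟩
    · change c • x.1 s = 0
      rw [h1 s hs, smul_zero]
    · change c • x.2 s = 0
      rw [h2 s hs, smul_zero]

/-- The left action of scalar forms on `Ω(L, N) × Ω(L, N₁)` by the wedge product. -/
def wedgePair (θ : Forms R L R) (x : Forms R L N × Forms R L N₁) :
    Forms R L N × Forms R L N₁ :=
  (totalWedge (LinearMap.lsmul R N) θ x.1, totalWedge (LinearMap.lsmul R N₁) θ x.2)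

variable (R L N N₁) in
/-- A representation up to homotopy on the graded module `N[0] ⊕ N₁[1]`: an operator `D` of
degree `1` on the total complex that is a graded derivation with respect to `d_A` and
satisfies `D ∘ D = 0`. -/
structure TwoTermRepresentation where
  D : Forms R L N × Forms R L N₁ →ₗ[ℝ] Forms R L N × Forms R L N₁
  degree_one : ∀ n, ∀ x ∈ totalDegree R L N N₁ n, D x ∈ totalDegree R L N N₁ (n + 1)
  leibniz : ∀ (l : ℕ) (θ : Form R L R l) (x : Forms R L N × Forms R L N₁),
    D (wedgePair (homog l θ) x)
      = wedgePair (dA R L (homog l θ)) x + (-1 : ℝ) ^ l • wedgePair (homog l θ) (D x)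
  square_zero : D ∘ₗ D = 0

end Complex

section Classes
variable {R L N : Type*} [CommRing R] [Algebra ℝ R]
  [LieRing L] [LieAlgebra ℝ L] [Module R L] [LieRingModule L R] [LieRinehartRing R L]
  [LieRinehartAlgebra ℝ R L]
  [AddCommGroup N] [Module ℝ N] [Module R N] [IsScalarTower ℝ R N]

/-- The form `x` is closed and `c` is its cohomology class. -/
def IsClassOf (x : Forms R L R) (c : Cohomology R L) : Prop :=
  ∃ h : x ∈ closedForms R L, c = Ideal.Quotient.mk (exactForms R L) ⟨x, h⟩

/-- The `2i`-form `tr (R_∇^i)`, for a given trace `End N → R`. -/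
def traceForm (tr : Module.Dual R (Module.End R N)) (D : LinearConnection R L N) (i : ℕ) :
    Forms R L R :=
  homog (2 * i) (tr.compAlternatingMap (D.curvaturePow i))

/-- `c` is the class of `tr (R_∇^i)` for some linear connection `∇` on `N`. -/
def IsTraceCharacter (tr : Module.Dual R (Module.End R N)) (i : ℕ) (c : Cohomology R L) : Prop :=
  ∃ D : LinearConnection R L N, IsClassOf (traceForm tr D i) c

variable (R L) in
/-- The `ℝ`-subalgebras of the cohomology algebra. -/
abbrev CohomologySubalgebra := Subalgebra ℝ (Cohomology R L)

/-- The `ℝ`-subalgebra of the cohomology that is generated by the classes of `tr (R_∇^i)`,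
`i ≥ 1`. -/
def characterAlgebra (tr : Module.Dual R (Module.End R N)) : CohomologySubalgebra R L :=
  Algebra.adjoin ℝ {c | ∃ i ≥ 1, IsTraceCharacter tr i c}

/-- The coefficient `f_j(X)` of `λ ^ (k - j)` in `det (λ I + X)`, and `0` if `j > k`. -/
def detCoeff {k : ℕ} (j : ℕ) (X : Matrix (Fin k) (Fin k) ℂ) : ℂ :=
  if j ≤ k then
    (Matrix.det (Matrix.scalar (Fin k) (Polynomial.X : Polynomial ℂ) + X.map Polynomial.C)).coeff
      (k - j)
  else 0

/-- `q` expresses the invariant polynomial `X ↦ f_j ((√-1 / 2π) X)` on real `k × k` matrices as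
a polynomial in `tr X, tr X ^ 2, …`; the variable with index `n` stands for `tr X ^ (n + 1)`.
The variables of `q` need not commute, so that `q` can be evaluated in any `ℝ`-algebra. -/
def ExpressesDetCoeff (k j : ℕ) (q : FreeAlgebra ℝ ℕ) : Prop :=
  ∀ X : Matrix (Fin k) (Fin k) ℝ,
    ((FreeAlgebra.lift ℝ (fun n : ℕ => (X ^ (n + 1)).trace) q : ℝ) : ℂ)
      = detCoeff j ((Complex.I / (2 * (Real.pi : ℂ))) • X.map (fun r : ℝ => (r : ℂ)))

/-- `c` is the class of `f_{2i} ((√-1 / 2π) R_∇)` for some linear connection `∇` on the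
module `N` of rank `k`. -/
def IsDetClass (tr : Module.Dual R (Module.End R N)) (k i : ℕ) (c : Cohomology R L) : Prop :=
  ∃ (D : LinearConnection R L N) (σ : ℕ → Cohomology R L) (q : FreeAlgebra ℝ ℕ),
    (∀ n, IsClassOf (traceForm tr D (n + 1)) (σ n)) ∧ ExpressesDetCoeff k (2 * i) q ∧
      c = FreeAlgebra.lift ℝ σ q

end Classes
end LieRinehartForms

end

open Bundle
open scoped Manifold ContDiff

noncomputable section


namespace SmoothBundle

variable (EM : Type*) [NormedAddCommGroup EM] [NormedSpace ℝ EM] (M : Type*) [TopologicalSpace M]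
  [ChartedSpace EM M]

/-- The algebra `C^∞(M)`. -/
def SmoothFunction := C^∞⟮𝓘(ℝ, EM), M; 𝓘(ℝ, ℝ), ℝ⟯

namespace SmoothFunction

instance instFunLike : FunLike (SmoothFunction EM M) M ℝ :=
  inferInstanceAs (FunLike C^∞⟮𝓘(ℝ, EM), M; 𝓘(ℝ, ℝ), ℝ⟯ M ℝ)

instance instCommRing : CommRing (SmoothFunction EM M) :=
  inferInstanceAs (CommRing C^∞⟮𝓘(ℝ, EM), M; 𝓘(ℝ, ℝ), ℝ⟯)

instance instAlgebra : Algebra ℝ (SmoothFunction EM M) :=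
  inferInstanceAs (Algebra ℝ C^∞⟮𝓘(ℝ, EM), M; 𝓘(ℝ, ℝ), ℝ⟯)

variable {EM M}

/-- The element of `C^∞(M)` given by a smooth function. -/
def mk (f : M → ℝ) (hf : ContMDiff 𝓘(ℝ, EM) 𝓘(ℝ, ℝ) ∞ f) : SmoothFunction EM M :=
  ⟨f, hf⟩

theorem contMDiff (f : SmoothFunction EM M) : ContMDiff 𝓘(ℝ, EM) 𝓘(ℝ, ℝ) ∞ f :=
  ContMDiffMap.contMDiff (I := 𝓘(ℝ, EM)) (I' := 𝓘(ℝ, ℝ)) f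

@[simp] theorem mk_apply (f : M → ℝ) (hf : ContMDiff 𝓘(ℝ, EM) 𝓘(ℝ, ℝ) ∞ f) (x : M) :
    mk f hf x = f x := rfl

@[ext] theorem ext {f g : SmoothFunction EM M} (h : ∀ x, f x = g x) : f = g := DFunLike.ext f g h

@[simp] theorem coe_add (f g : SmoothFunction EM M) : ⇑(f + g) = f + g := rfl
@[simp] theorem coe_mul (f g : SmoothFunction EM M) : ⇑(f * g) = f * g := rfl
@[simp] theorem coe_one : ⇑(1 : SmoothFunction EM M) = 1 := rfl
@[simp] theorem coe_zero : ⇑(0 : SmoothFunction EM M) = 0 := rfl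
@[simp] theorem coe_smul (c : ℝ) (f : SmoothFunction EM M) : ⇑(c • f) = c • ⇑f := rfl

end SmoothFunction

variable {M} (FE : Type*) [NormedAddCommGroup FE] [NormedSpace ℝ FE] (E : M → Type*)
  [TopologicalSpace (TotalSpace FE E)] [∀ x, TopologicalSpace (E x)] [FiberBundle FE E]

/-- The smooth sections `Γ(E)`. -/
abbrev Section := Cₛ^∞⟮𝓘(ℝ, EM); FE, E⟯

variable {EM FE E}
variable [∀ x, AddCommGroup (E x)] [∀ x, Module ℝ (E x)] [VectorBundle ℝ FE E]

instance instSMulSection : SMul (SmoothFunction EM M) (Section EM FE E) :=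
  ⟨fun f e => ⟨(f : M → ℝ) • (e : ∀ x, E x), f.contMDiff.smul_section e.contMDiff⟩⟩

@[simp] theorem smul_section_apply (f : SmoothFunction EM M) (e : Section EM FE E) (x : M) :
    (f • e) x = f x • e x := rfl

/-- `Γ(E)` as a module over `C^∞(M)`, pointwise. -/
instance instModuleSection : Module (SmoothFunction EM M) (Section EM FE E) where
  one_smul e := by ext x; exact one_smul ℝ (e x)
  mul_smul f g e := by ext x; exact mul_smul (f x) (g x) (e x)
  smul_zero f := by ext x; exact smul_zero (f x)
  smul_add f e e' := by ext x; exact smul_add (f x) (e x) (e' x)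
  add_smul f g e := by ext x; exact add_smul (f x) (g x) (e x)
  zero_smul e := by ext x; exact zero_smul ℝ (e x)

instance instIsScalarTowerSection : IsScalarTower ℝ (SmoothFunction EM M) (Section EM FE E) :=
  ⟨fun c f e => by ext x; exact smul_assoc c (f x) (e x)⟩

theorem section_sum_apply {ι : Type*} (u : Finset ι) (s : ι → Section EM FE E) (x : M) :
    (∑ i ∈ u, s i) x = ∑ i ∈ u, s i x := by
  rw [← ContMDiffSection.coeAddHom_apply, map_sum, Finset.sum_apply]
  rfl

section Trace
variable [FiniteDimensional ℝ EM] [T2Space M] [IsManifold 𝓘(ℝ, EM) ∞ M]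
  [FiniteDimensional ℝ FE] [ContMDiffVectorBundle ∞ FE E 𝓘(ℝ, EM)]

/-- A bump function supported in a given neighbourhood. -/
theorem exists_bump (x : M) {u : Set M} (hu : u ∈ nhds x) :
    ∃ ρ : SmoothFunction EM M, (∀ᶠ y in nhds x, ρ y = 1) ∧ tsupport ρ ⊆ u := by
  obtain ⟨f, -, hf⟩ := (SmoothBumpFunction.nhds_basis_tsupport (I := 𝓘(ℝ, EM)) x).mem_iff.mp hu
  exact ⟨.mk f f.contMDiff, f.eventuallyEq_one, hf⟩

/-- Near every point there are global sections forming a frame, and the coefficients of a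
section near the point are global functions. -/
theorem exists_frame (x : M) :
    ∃ (ρ : SmoothFunction EM M) (s : Fin (Module.finrank ℝ FE) → Section EM FE E),
      (∀ᶠ y in nhds x, ρ y = 1) ∧
      (∀ i y, s i y = ρ y • (trivializationAt FE E x).localFrame (Module.finBasis ℝ FE) i y) ∧
      ∀ e : Section EM FE E, ∃ c : Fin (Module.finrank ℝ FE) → SmoothFunction EM M,
        (∀ i y, c i y = ρ y * (trivializationAt FE E x).localFrameCoeff 𝓘(ℝ, EM)
            (Module.finBasis ℝ FE) i y (e y)) ∧
        (ρ * ρ) • e = ∑ i, c i • s i := by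
  set t := trivializationAt FE E x
  have hx : x ∈ t.baseSet := FiberBundle.mem_baseSet_trivializationAt FE E x
  obtain ⟨ρ, h1, h2⟩ := exists_bump (EM := EM) x (t.open_baseSet.mem_nhds hx)
  have hs := fun i => ContMDiffOn.smul_section_of_tsupport (I := 𝓘(ℝ, EM)) (n := ∞)
    ρ.contMDiff.contMDiffOn t.open_baseSet h2
    (t.contMDiffOn_localFrame_baseSet ∞ (Module.finBasis ℝ FE) i)
  have hc : ∀ (e : Section EM FE E) i, ContMDiff 𝓘(ℝ, EM) 𝓘(ℝ, ℝ) ∞ fun y =>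
      ρ y * t.localFrameCoeff 𝓘(ℝ, EM) (Module.finBasis ℝ FE) i y (e y) := by
    intro e i y
    by_cases hy : y ∈ t.baseSet
    · exact ρ.contMDiff.contMDiffAt.mul
        (contMDiffAt_localFrameCoeff (Module.finBasis ℝ FE) hy e.contMDiff.contMDiffAt i)
    · have : y ∈ (tsupport ρ)ᶜ := fun h => hy (h2 h)
      refine (contMDiffAt_const (c := (0 : ℝ))).congr_of_eventuallyEq ?_
      filter_upwards [(isClosed_tsupport ρ).isOpen_compl.mem_nhds this] with z hz
      rw [image_eq_zero_of_notMem_tsupport hz, zero_mul]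
  refine ⟨ρ, fun i => ⟨(ρ : M → ℝ) • t.localFrame (Module.finBasis ℝ FE) i, hs i⟩, h1,
    fun i y => rfl, fun e => ⟨fun i => .mk (fun y => ρ y * t.localFrameCoeff 𝓘(ℝ, EM)
            (Module.finBasis ℝ FE) i y (e y)) (hc e i), fun i y => rfl, ?_⟩⟩
  · ext y
    let c : Fin (Module.finrank ℝ FE) → SmoothFunction EM M := fun i => .mk _ (hc e i)
    let s : Fin (Module.finrank ℝ FE) → Section EM FE E := fun i => ⟨_, hs i⟩
    have hsum : (∑ i, c i • s i) y
        = (ρ y * ρ y) • ∑ i, t.localFrameCoeff 𝓘(ℝ, EM) (Module.finBasis ℝ FE) i y (e y) •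
          t.localFrame (Module.finBasis ℝ FE) i y := by
      rw [section_sum_apply, Finset.smul_sum]
      refine Finset.sum_congr rfl fun i _ => ?_
      change (ρ y * t.localFrameCoeff 𝓘(ℝ, EM) (Module.finBasis ℝ FE) i y (e y)) •
        (ρ y • t.localFrame (Module.finBasis ℝ FE) i y) = _
      rw [smul_smul, smul_smul]
      congr 1
      ring
    refine Eq.trans ?_ hsum.symm
    change (ρ y * ρ y) • e y = _
    by_cases hy : y ∈ t.baseSet
    · rw [← t.eq_sum_localFrameCoeff_smul (s := fun y => e y) hy]
    · have : ρ y = 0 := image_eq_zero_of_notMem_tsupport fun h => hy (h2 h)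
      rw [this, mul_zero, zero_smul, zero_smul]

/-- A global section through a given point of the bundle. -/
theorem exists_section (x : M) (v : E x) : ∃ e : Section EM FE E, e x = v := by
  obtain ⟨ρ, s, h1, h2, -⟩ := exists_frame (EM := EM) (FE := FE) (E := E) x
  set t := trivializationAt FE E x
  have hx : x ∈ t.baseSet := FiberBundle.mem_baseSet_trivializationAt FE E x
  refine ⟨∑ i, (t.basisAt (Module.finBasis ℝ FE) hx).repr v i • s i, ?_⟩
  rw [section_sum_apply]
  conv_rhs => rw [← (t.basisAt (Module.finBasis ℝ FE) hx).sum_repr v]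
  refine Finset.sum_congr rfl fun i _ => ?_
  rw [ContMDiffSection.coe_smul, Pi.smul_apply, h2, h1.self_of_nhds, one_smul,
    t.localFrame_apply_of_mem_baseSet _ hx]

/-- A `C^∞(M)`-linear endomorphism of `Γ(E)` is local in the strongest sense: its value at a point
depends only on the value of the section at that point. -/
theorem endomorphism_pointwise (T : Module.End (SmoothFunction EM M) (Section EM FE E)) {x : M}
    {e e' : Section EM FE E} (h : e x = e' x) : T e x = T e' x := by
  obtain ⟨ρ, s, h1, -, h3⟩ := exists_frame (EM := EM) (FE := FE) (E := E) x
  have hρ : ρ x = 1 := h1.self_of_nhds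
  have key : ∀ z : Section EM FE E, z x = 0 → T z x = 0 := by
    intro z hz
    obtain ⟨c, hc, hsum⟩ := h3 z
    have h4 := congrArg (fun w => T w x) hsum
    simp only [map_smul, map_sum, section_sum_apply, smul_section_apply] at h4
    rw [SmoothFunction.coe_mul, Pi.mul_apply, hρ, one_mul, one_smul] at h4
    rw [h4]
    refine Finset.sum_eq_zero fun i _ => ?_
    rw [hc, hz, map_zero, mul_zero, zero_smul]
  have := key (e - e') (by rw [ContMDiffSection.coe_sub, Pi.sub_apply, h, sub_self])
  rwa [map_sub, ContMDiffSection.coe_sub, Pi.sub_apply, sub_eq_zero] at this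

/-- The endomorphism `T_x` of the fibre `E x` induced by a `C^∞(M)`-linear endomorphism `T` of
`Γ(E)`; it is determined by `T_x (e x) = (T e) x`, see `fibreMap_apply`. -/
def fibreMap (T : Module.End (SmoothFunction EM M) (Section EM FE E)) (x : M) : E x →ₗ[ℝ] E x where
  toFun v := T (Classical.choose (exists_section (EM := EM) (FE := FE) x v)) x
  map_add' v w := by
    rw [← Pi.add_apply, ← ContMDiffSection.coe_add, ← map_add]
    refine endomorphism_pointwise T ?_
    rw [ContMDiffSection.coe_add, Pi.add_apply]
    simp only [Classical.choose_spec (exists_section (EM := EM) (FE := FE) x _)]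
  map_smul' c v := by
    rw [RingHom.id_apply, ← Pi.smul_apply, ← ContMDiffSection.coe_smul, ← LinearMap.map_smul_of_tower]
    refine endomorphism_pointwise T ?_
    rw [ContMDiffSection.coe_smul, Pi.smul_apply]
    simp only [Classical.choose_spec (exists_section (EM := EM) (FE := FE) x _)]

theorem fibreMap_apply (T : Module.End (SmoothFunction EM M) (Section EM FE E)) (x : M)
    (e : Section EM FE E) : fibreMap T x (e x) = T e x :=
  endomorphism_pointwise T (Classical.choose_spec (exists_section (EM := EM) (FE := FE) x (e x)))

theorem contMDiff_trace (T : Module.End (SmoothFunction EM M) (Section EM FE E)) :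
    ContMDiff 𝓘(ℝ, EM) 𝓘(ℝ, ℝ) ∞ fun x => LinearMap.trace ℝ (E x) (fibreMap T x) := by
  intro x
  obtain ⟨ρ, s, h1, h2, -⟩ := exists_frame (EM := EM) (FE := FE) (E := E) x
  set t := trivializationAt FE E x
  have hx : x ∈ t.baseSet := FiberBundle.mem_baseSet_trivializationAt FE E x
  have h5 : ContMDiffAt 𝓘(ℝ, EM) 𝓘(ℝ, ℝ) ∞ (fun y => ∑ i,
      t.localFrameCoeff 𝓘(ℝ, EM) (Module.finBasis ℝ FE) i y (T (s i) y)) x :=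
    contMDiffAt_finsetSum fun i _ =>
      contMDiffAt_localFrameCoeff (Module.finBasis ℝ FE) hx (T (s i)).contMDiff.contMDiffAt i
  refine h5.congr_of_eventuallyEq ?_
  filter_upwards [h1, t.open_baseSet.mem_nhds hx] with y hy hyt
  rw [LinearMap.trace_eq_matrix_trace ℝ (t.basisAt (Module.finBasis ℝ FE) hyt), Matrix.trace]
  refine Finset.sum_congr rfl fun i _ => ?_
  rw [Matrix.diag_apply, LinearMap.toMatrix_apply,
    t.localFrameCoeff_apply_of_mem_baseSet (Module.finBasis ℝ FE) hyt (fun y => T (s i) y)]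
  rw [← fibreMap_apply, h2, hy, one_smul, t.localFrame_apply_of_mem_baseSet _ hyt]

/-- The fibrewise trace of a `C^∞(M)`-linear endomorphism of `Γ(E)`, that is of a section of
`End E`. -/
def sectionTrace : Module.Dual (SmoothFunction EM M)
    (Module.End (SmoothFunction EM M) (Section EM FE E)) where
  toFun T := .mk (fun x => LinearMap.trace ℝ (E x) (fibreMap T x)) (contMDiff_trace T)
  map_add' S T := by
    ext x
    have : fibreMap (S + T) x = fibreMap S x + fibreMap T x := by
      ext v
      obtain ⟨e, rfl⟩ := exists_section (EM := EM) (FE := FE) x v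
      simp only [LinearMap.add_apply, fibreMap_apply]
      rfl
    change LinearMap.trace ℝ (E x) (fibreMap (S + T) x) = _
    rw [this, map_add]
    rfl
  map_smul' f T := by
    ext x
    have : fibreMap (f • T) x = f x • fibreMap T x := by
      ext v
      obtain ⟨e, rfl⟩ := exists_section (EM := EM) (FE := FE) x v
      simp only [LinearMap.smul_apply, fibreMap_apply]
      rfl
    change LinearMap.trace ℝ (E x) (fibreMap (f • T) x) = _
    rw [this, map_smul]
    rfl
end Trace
end SmoothBundle

namespace SmoothBundle

section Algebroid
variable (EM : Type*) [NormedAddCommGroup EM] [NormedSpace ℝ EM] {M : Type*} [TopologicalSpace M]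
  [ChartedSpace EM M] [IsManifold 𝓘(ℝ, EM) ∞ M]
  (FA : Type*) [NormedAddCommGroup FA] [NormedSpace ℝ FA] (A : M → Type*)
  [TopologicalSpace (TotalSpace FA A)] [∀ x, TopologicalSpace (A x)] [FiberBundle FA A]
  [∀ x, AddCommGroup (A x)] [∀ x, Module ℝ (A x)] [VectorBundle ℝ FA A]

/-- A Lie algebroid structure on the vector bundle `A → M`: an anchor, i.e. a smooth vector bundle
morphism `ρ : A → TM`, and a Lie bracket on `Γ(A)` such that `[a, f b] = f [a, b] + (ρ(a) f) b`
and `ρ[a, b] = [ρ(a), ρ(b)]` as derivations of functions. -/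
class LieAlgebroid where
  anchor : ∀ x, A x →ₗ[ℝ] TangentSpace 𝓘(ℝ, EM) x
  contMDiff_anchor : ContMDiff (𝓘(ℝ, EM).prod 𝓘(ℝ, FA)) 𝓘(ℝ, EM).tangent ∞
    fun v : TotalSpace FA A => (⟨v.proj, anchor v.proj v.snd⟩ : TangentBundle 𝓘(ℝ, EM) M)
  bracket : Section EM FA A →ₗ[ℝ] Section EM FA A →ₗ[ℝ] Section EM FA A
  bracket_self : ∀ a, bracket a a = 0
  jacobi : ∀ a b c, bracket a (bracket b c) = bracket (bracket a b) c + bracket b (bracket a c)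
  bracket_smul : ∀ (a b : Section EM FA A) (f : SmoothFunction EM M) (x : M),
    bracket a (f • b) x = f x • bracket a b x + mvfderiv 𝓘(ℝ, EM) f x (anchor x (a x)) • b x
  anchor_bracket : ∀ (a b : Section EM FA A) (f : SmoothFunction EM M) (x : M),
    mvfderiv 𝓘(ℝ, EM) f x (anchor x (bracket a b x))
      = mvfderiv 𝓘(ℝ, EM) (fun y => mvfderiv 𝓘(ℝ, EM) f y (anchor y (b y))) x (anchor x (a x))
        - mvfderiv 𝓘(ℝ, EM) (fun y => mvfderiv 𝓘(ℝ, EM) f y (anchor y (a y))) x (anchor x (b x))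

variable {EM FA A}
variable [LieAlgebroid EM FA A]

/-- The function `ρ(a) f`. -/
def anchorDeriv (a : Section EM FA A) (f : SmoothFunction EM M) : SmoothFunction EM M :=
  .mk (fun x => mvfderiv 𝓘(ℝ, EM) f x (LieAlgebroid.anchor FA x (a x))) <| by
    have h1 : ContMDiff 𝓘(ℝ, EM) 𝓘(ℝ, EM).tangent ∞ fun x =>
        (⟨x, LieAlgebroid.anchor FA x (a x)⟩ : TangentBundle 𝓘(ℝ, EM) M) :=
      (LieAlgebroid.contMDiff_anchor (EM := EM) (FA := FA) (A := A)).comp a.contMDiff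
    have h2 := f.contMDiff.contMDiff_tangentMap (m := ∞) le_rfl
    exact (contMDiff_snd_tangentBundle_modelSpace ℝ 𝓘(ℝ, ℝ)).comp (h2.comp h1)

instance instBracketSection : Bracket (Section EM FA A) (Section EM FA A) :=
  ⟨fun a b => LieAlgebroid.bracket a b⟩

/-- `Γ(A)` is a Lie ring under the bracket of the Lie algebroid. -/
instance instLieRingSection : LieRing (Section EM FA A) where
  add_lie a b c := by
    change LieAlgebroid.bracket (a + b) c = _
    rw [map_add]; rfl
  lie_add a b c := map_add (LieAlgebroid.bracket a) b c
  lie_self a := LieAlgebroid.bracket_self a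
  leibniz_lie a b c := LieAlgebroid.jacobi a b c

instance instLieAlgebraSection : LieAlgebra ℝ (Section EM FA A) where
  lie_smul c a b := map_smul (LieAlgebroid.bracket a) c b

theorem mdiff (f : SmoothFunction EM M) (x : M) : MDifferentiableAt 𝓘(ℝ, EM) 𝓘(ℝ, ℝ) f x :=
  f.contMDiff.mdifferentiableAt (by simp)

instance instBracketFunction : Bracket (Section EM FA A) (SmoothFunction EM M) := ⟨anchorDeriv⟩

theorem lie_apply (a : Section EM FA A) (f : SmoothFunction EM M) (x : M) :
    ⁅a, f⁆ x = mvfderiv 𝓘(ℝ, EM) f x (LieAlgebroid.anchor FA x (a x)) := rfl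

/-- The action `a ↦ ρ(a)` of `Γ(A)` on `C^∞(M)`. -/
instance instLieRingModuleFunction : LieRingModule (Section EM FA A) (SmoothFunction EM M) where
  add_lie a b f := by
    ext x
    change _ = ⁅a, f⁆ x + ⁅b, f⁆ x
    simp only [lie_apply, ContMDiffSection.coe_add, Pi.add_apply, map_add]
  lie_add a f g := by
    ext x
    change _ = ⁅a, f⁆ x + ⁅a, g⁆ x
    simp only [lie_apply]
    rw [SmoothFunction.coe_add, mvfderiv_add (mdiff f x) (mdiff g x)]
    rfl
  leibniz_lie a b f := by
    ext x
    change _ = ⁅⁅a, b⁆, f⁆ x + ⁅b, ⁅a, f⁆⁆ x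
    rw [lie_apply ⁅a, b⁆]
    refine Eq.trans ?_ (congrArg (· + _) (LieAlgebroid.anchor_bracket a b f x).symm)
    exact (sub_add_cancel _ _).symm

instance instLieRinehartRing : LieRinehartRing (SmoothFunction EM M) (Section EM FA A) where
  lie_smul_eq_mul' f g a := by
    ext x
    change _ = f x * ⁅a, g⁆ x
    simp only [lie_apply, smul_section_apply, map_smul]
    rfl
  leibniz_mul_right' a f g := by
    ext x
    change _ = f x * ⁅a, g⁆ x + ⁅a, f⁆ x * g x
    simp only [lie_apply]
    rw [SmoothFunction.coe_mul, mvfderiv_mul (mdiff f x) (mdiff g x)]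
    simp only [add_apply, smul_apply, smul_eq_mul]
    ring
  leibniz_smul_right' a b f := by
    ext x
    exact LieAlgebroid.bracket_smul a b f x

instance instLieRinehartAlgebra : LieRinehartAlgebra ℝ (SmoothFunction EM M) (Section EM FA A) where
  smul_lie c a f := by
    ext x
    change _ = c * ⁅a, f⁆ x
    simp only [lie_apply, ContMDiffSection.coe_smul, Pi.smul_apply, map_smul]
    rfl
  lie_smul c a f := by
    ext x
    change _ = c * ⁅a, f⁆ x
    simp only [lie_apply]
    have : (⇑(c • f) : M → ℝ) = fun y => c * f y := rfl
    rw [this, mvfderiv_fun_mul mdifferentiableAt_const (mdiff f x), mvfderiv_const, smul_zero,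
      add_zero]
    rfl

end Algebroid

section Pontryagin
variable (EM : Type*) [NormedAddCommGroup EM] [NormedSpace ℝ EM] [FiniteDimensional ℝ EM]
  {M : Type*} [TopologicalSpace M] [T2Space M]
  [ChartedSpace EM M] [IsManifold 𝓘(ℝ, EM) ∞ M]
  (FA : Type*) [NormedAddCommGroup FA] [NormedSpace ℝ FA] (A : M → Type*)
  [TopologicalSpace (TotalSpace FA A)] [∀ x, TopologicalSpace (A x)] [FiberBundle FA A]
  [∀ x, AddCommGroup (A x)] [∀ x, Module ℝ (A x)] [VectorBundle ℝ FA A] [LieAlgebroid EM FA A]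
  (FE : Type*) [NormedAddCommGroup FE] [NormedSpace ℝ FE] [FiniteDimensional ℝ FE] (E : M → Type*)
  [TopologicalSpace (TotalSpace FE E)] [∀ x, TopologicalSpace (E x)] [FiberBundle FE E]
  [∀ x, AddCommGroup (E x)] [∀ x, Module ℝ (E x)] [VectorBundle ℝ FE E]
  [ContMDiffVectorBundle ∞ FE E 𝓘(ℝ, EM)]
  (FF : Type*) [NormedAddCommGroup FF] [NormedSpace ℝ FF] (F : M → Type*)
  [TopologicalSpace (TotalSpace FF F)] [∀ x, TopologicalSpace (F x)] [FiberBundle FF F]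
  [∀ x, AddCommGroup (F x)] [∀ x, Module ℝ (F x)] [VectorBundle ℝ FF F]

open LieRinehartForms

/-- The Lie algebroid cohomology `H^•(A)`, as an algebra. -/
abbrev AlgebroidCohomology := Cohomology (SmoothFunction EM M) (Section EM FA A)

/-- The 2-term representations up to homotopy of `A` on `E[0] ⊕ F[1]`. -/
abbrev TwoRepresentation := TwoTermRepresentation (SmoothFunction EM M) (Section EM FA A)
  (Section EM FE E) (Section EM FF F)

/-- `c` is the `l`-th `A`-Pontryagin character `σ^l_A(E) = [tr (R_∇^l)]` of `E`. -/
def IsPontryaginCharacter (l : ℕ) (c : AlgebroidCohomology EM FA A) : Prop :=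
  IsTraceCharacter (sectionTrace (EM := EM) (FE := FE) (E := E)) l c

/-- The `A`-Pontryagin algebra `Pont_A(E)`. -/
def PontryaginAlgebra :=
  characterAlgebra (L := Section EM FA A) (sectionTrace (EM := EM) (FE := FE) (E := E))

/-- `c` is the `i`-th `A`-Pontryagin class `p^i_A(E) = [f_{2i} ((√-1 / 2π) R_∇)]` of `E`. -/
def IsPontryaginClass (i : ℕ) (c : AlgebroidCohomology EM FA A) : Prop :=
  IsDetClass (sectionTrace (EM := EM) (FE := FE) (E := E)) (Module.finrank ℝ FE) i c

end Pontryagin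
end SmoothBundle

end

open SmoothBundle

/-! Evaluated on sections, the operator `T.D` has four components: connections ∇ on E and ∇' on F, a
bundle map φ : E → F, and a 2-form -ζ with values in Hom(F, E). Two of the components of `T.D ∘ T.D
= 0` read R_∇ = ζ∘φ and R_∇' = φ∘ζ (`exists_connections`). Hence R_∇^l = (ζφ)^l and R_∇'^l = (φζ)^l
(`exists_curvaturePow_eq`), and for l ≥ 1 cyclicity of the trace (`IsRankOneTrace.comp_comm`) makes
the forms tr R_∇^l and tr R_∇'^l equal, before any passage to cohomology. No sign intervenes, since
φ has form degree 0 and ζ has form degree 2. The ranks would only be seen at l = 0.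

The rest is Chern-Weil theory. The trace forms are closed by the Bianchi identity, and their classes
are independent of the connection by transgression (`IsRankOneTrace.exists_dA_eq_sub`). End-valued
forms embed into the operators on N-valued forms (`act_injective`), where R_∇^l becomes d_∇^(2l), so
these arguments are computations with powers of one operator.

For the Pontryagin classes, Newton's identities give a polynomial in the traces of powers that is
the same for all ranks (`expressesDetCoeff_newtonPoly`). Any other choice gives the same form: the
difference is a trace identity for real matrices, hence for matrices with commuting entries, such as
the matrix of curvature 2-forms (`IsRankOneTrace.lift_traceForm_eq_zero`).

All of this takes place over the ring R of functions. Local frames are replaced by functions ρ for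
which ρ times the identity factors through R^k, and identities are tested after multiplication by
such ρ (`FrameSeparated`). The identity d_A² = 0 is used only after multiplication by a section, and
in that form it follows from `T.D ∘ T.D = 0` (`wedgePair_dA_dA`). -/

noncomputable section

namespace LieRinehartForms

/-! ### Functoriality of forms in the coefficients -/

section Maps
variable {R L N N₁ N₂ N₃ P P₁ P₂ P₃ : Type*} [CommRing R] [Algebra ℝ R]
  [LieRing L] [LieAlgebra ℝ L] [Module R L] [LieRingModule L R] [LieRinehartRing R L]
  [LieRinehartAlgebra ℝ R L]
  [AddCommGroup N] [Module ℝ N] [Module R N] [IsScalarTower ℝ R N]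
  [AddCommGroup N₁] [Module ℝ N₁] [Module R N₁] [IsScalarTower ℝ R N₁]
  [AddCommGroup N₂] [Module ℝ N₂] [Module R N₂] [IsScalarTower ℝ R N₂]
  [AddCommGroup N₃] [Module ℝ N₃] [Module R N₃] [IsScalarTower ℝ R N₃]
  [AddCommGroup P] [Module ℝ P] [Module R P] [IsScalarTower ℝ R P]
  [AddCommGroup P₁] [Module ℝ P₁] [Module R P₁] [IsScalarTower ℝ R P₁]
  [AddCommGroup P₂] [Module ℝ P₂] [Module R P₂] [IsScalarTower ℝ R P₂]
  [AddCommGroup P₃] [Module ℝ P₃] [Module R P₃] [IsScalarTower ℝ R P₃]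

/-- The map on forms induced by an `R`-linear map of the coefficients. -/
def mapForms (φ : N →ₗ[R] P) : Forms R L N →ₗ[ℝ] Forms R L P :=
  DirectSum.toModule ℝ ℕ _ fun s => homog s ∘ₗ
    { toFun := fun α => φ.compAlternatingMap α
      map_add' := fun α β => by ext v; simp
      map_smul' := fun c α => by ext v; simp }

@[simp] theorem mapForms_homog (φ : N →ₗ[R] P) (s : ℕ) (α : Form R L N s) :
    mapForms φ (homog s α) = homog s (φ.compAlternatingMap α) := by
  simp [mapForms, homog]

theorem homog_smul (f : R) (s : ℕ) (α : Form R L N s) : homog s (f • α) = f • homog s α :=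
  (DirectSum.lof R ℕ (fun s => Form R L N s) s).map_smul f α

theorem zeroForm_smul (f : R) (e : N) :
    (zeroForm (f • e) : Forms R L N) = f • zeroForm e :=
  homog_smul f 0 (AlternatingMap.constOfIsEmpty R L (Fin 0) e)

theorem mapForms_zeroForm (φ : N →ₗ[R] P) (e : N) :
    mapForms φ (zeroForm e : Forms R L N) = zeroForm (φ e) :=
  mapForms_homog φ 0 _

theorem homog_apply_self (s : ℕ) (α : Form R L N s) : (homog s α) s = α :=
  DirectSum.of_eq_same (β := fun s => Form R L N s) s α

theorem homog_apply_ne {s t : ℕ} (α : Form R L N s) (h : s ≠ t) : (homog s α) t = 0 :=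
  DirectSum.of_eq_of_ne (β := fun s => Form R L N s) s t α h.symm

theorem eq_homog_of_forall_ne {n : ℕ} {x : Forms R L N} (h : ∀ s, s ≠ n → x s = 0) :
    x = homog n (x n) := by
  refine DFinsupp.ext fun s => ?_
  rcases eq_or_ne s n with rfl | hs
  · exact (homog_apply_self s _).symm
  · exact (h s hs).trans (homog_apply_ne _ hs.symm).symm

theorem Forms.linearMap_ext {V : Type*} [AddCommGroup V] [Module ℝ V]
    {S T : Forms R L N →ₗ[ℝ] V} (h : ∀ s θ, S (homog s θ) = T (homog s θ)) : S = T := by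
  refine LinearMap.ext fun x => ?_
  induction x using Forms.induction with
  | h0 => simp
  | h2 a b ha hb => simp [ha, hb]
  | h1 s θ => exact h s θ

/-- The wedge product is a normalised alternation of the pairing, and alternation commutes with
additive maps. This naturality transports products of curvatures through composition with φ, and
through matrix entries. -/
theorem totalWedge_mapForms {B : N₁ →ₗ[R] N₂ →ₗ[R] N₃} {B' : P₁ →ₗ[R] P₂ →ₗ[R] P₃}
    {φ : N₁ →ₗ[R] P₁} {ψ : N₂ →ₗ[R] P₂} {χ : N₃ →ₗ[R] P₃}
    (h : ∀ x y, χ (B x y) = B' (φ x) (ψ y)) (x : Forms R L N₁) (y : Forms R L N₂) :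
    mapForms χ (totalWedge B x y) = totalWedge B' (mapForms φ x) (mapForms ψ y) := by
  induction x using Forms.induction with
  | h0 => simp
  | h2 a b ha hb => simp [ha, hb]
  | h1 p α =>
    induction y using Forms.induction with
    | h0 => simp
    | h2 a b ha hb => simp [ha, hb]
    | h1 q β =>
      simp only [totalWedge_homog, mapForms_homog]
      congr 1
      ext v
      rw [LinearMap.compAlternatingMap_apply, wedge_eq_Alt', wedge_eq_Alt',
        LinearMap.map_smul_of_tower]
      congr 1
      refine (Alt_map χ.toAddMonoidHom _ v).symm.trans ?_
      congr 1
      funext w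
      exact h _ _

theorem mapForms_totalWedge_right {B : N₁ →ₗ[R] N₂ →ₗ[R] N₃} {B' : N₁ →ₗ[R] P₂ →ₗ[R] P₃}
    {ψ : N₂ →ₗ[R] P₂} {χ : N₃ →ₗ[R] P₃}
    (h : ∀ x y, χ (B x y) = B' x (ψ y)) (x : Forms R L N₁) (y : Forms R L N₂) :
    mapForms χ (totalWedge B x y) = totalWedge B' x (mapForms ψ y) := by
  rw [totalWedge_mapForms (φ := LinearMap.id) h]
  congr 2
  induction x using Forms.induction with
  | h0 => simp
  | h2 a b ha hb => simp [ha, hb]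
  | h1 p α => rw [mapForms_homog]; rfl

/-- A parallel map passes through every term of the Koszul formula. The application is to the trace,
as a parallel map from End N to R. -/
theorem mapForms_totalD {φ : N →ₗ[R] P} {D : LinearConnection R L N} {D' : LinearConnection R L P}
    (h : ∀ a e, D'.nabla a (φ e) = φ (D.nabla a e)) (x : Forms R L N) :
    mapForms φ (D.totalD x) = D'.totalD (mapForms φ x) := by
  induction x using Forms.induction with
  | h0 => simp
  | h2 a b ha hb => simp [ha, hb]
  | h1 s θ =>
    simp only [LinearConnection.totalD_homog, mapForms_homog]
    congr 1
    ext v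
    rw [LinearMap.compAlternatingMap_apply, LinearConnection.d_apply, LinearConnection.d_apply]
    simp only [LinearConnection.koszul, LinearConnection.lieTerm, map_sum, map_zsmul, map_sub,
      LinearMap.map_smul_of_tower, LinearMap.compAlternatingMap_apply, h]

theorem gradeInv_totalWedge (B : N₁ →ₗ[R] N₂ →ₗ[R] N₃) (x : Forms R L N₁) (y : Forms R L N₂) :
    gradeInv (totalWedge B x y) = totalWedge B (gradeInv x) (gradeInv y) := by
  induction x using Forms.induction with
  | h0 => simp
  | h2 a b ha hb => simp [ha, hb]
  | h1 p α =>
    induction y using Forms.induction with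
    | h0 => simp
    | h2 a b ha hb => simp [ha, hb]
    | h1 q β => simp [smul_smul, pow_add, mul_comm]

theorem gradeInv_mapForms (φ : N →ₗ[R] P) (x : Forms R L N) :
    gradeInv (mapForms φ x) = mapForms φ (gradeInv x) := by
  induction x using Forms.induction with
  | h0 => simp
  | h2 a b ha hb => simp [ha, hb]
  | h1 s θ => simp

theorem gradeInv_smul (f : R) (x : Forms R L N) : gradeInv (f • x) = f • gradeInv x := by
  induction x using Forms.induction with
  | h0 => simp
  | h2 a b ha hb => simp [ha, hb]
  | h1 s θ => rw [← homog_smul, gradeInv_homog, gradeInv_homog, homog_smul, smul_comm]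

theorem mapForms_smul (φ : N →ₗ[R] P) (f : R) (x : Forms R L N) :
    mapForms φ (f • x) = f • mapForms φ x := by
  induction x using Forms.induction with
  | h0 => simp
  | h2 a b ha hb => simp [ha, hb]
  | h1 s θ =>
    rw [← homog_smul, mapForms_homog, mapForms_homog, ← homog_smul]
    congr 1
    ext v
    simp

theorem zeroForm_wedge_apply (B : N₁ →ₗ[R] N₂ →ₗ[R] N₃) (e : N₁) (y : Forms R L N₂) :
    totalWedge B (zeroForm e) y = mapForms (B e) y := by
  induction y using Forms.induction with
  | h0 => simp
  | h2 a b ha hb => simp [ha, hb]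
  | h1 s θ => rw [zeroForm_wedge, mapForms_homog]

theorem wedge_zeroForm_apply (B : N₁ →ₗ[R] N₂ →ₗ[R] N₃) (x : Forms R L N₁) (e : N₂) :
    totalWedge B x (zeroForm e) = mapForms (B.flip e) x := by
  induction x using Forms.induction with
  | h0 => simp
  | h2 a b ha hb => simp [ha, hb]
  | h1 s θ => rw [wedge_zeroForm, mapForms_homog]

theorem lsmul_wedge_zeroForm (f : R) (x : Forms R L N) :
    totalWedge (LinearMap.lsmul R N) (zeroForm f) x = f • x := by
  rw [zeroForm_wedge_apply]
  induction x using Forms.induction with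
  | h0 => simp
  | h2 a b ha hb => simp [ha, hb]
  | h1 s θ => rw [mapForms_homog, ← homog_smul]; rfl

theorem totalWedge_smul_left (B : N₁ →ₗ[R] N₂ →ₗ[R] N₃) (f : R) (x : Forms R L N₁)
    (y : Forms R L N₂) : totalWedge B (f • x) y = f • totalWedge B x y := by
  rw [← lsmul_wedge_zeroForm, ← lsmul_wedge_zeroForm]
  exact totalWedge_assoc _ _ _ _ (fun a b c => by simp) _ _ _

theorem totalWedge_smul_right (B : N₁ →ₗ[R] N₂ →ₗ[R] N₃) (f : R) (x : Forms R L N₁)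
    (y : Forms R L N₂) : totalWedge B x (f • y) = f • totalWedge B x y := by
  induction x using Forms.induction with
  | h0 => simp
  | h2 a b ha hb => simp [ha, hb]
  | h1 p α =>
    induction y using Forms.induction with
    | h0 => simp
    | h2 a b ha hb => simp only [smul_add, map_add, ha, hb]
    | h1 q β => rw [← homog_smul, totalWedge_homog, totalWedge_homog, map_smul, homog_smul]

/-! ### Framed functions in place of local frames -/

variable (R) in
/-- `ρ` times the identity of `N` factors through `R ^ k`. -/
def IsFramed (N : Type*) [AddCommGroup N] [Module R N] (k : ℕ) (ρ : R) : Prop :=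
  ∃ (s : Fin k → N) (c : Fin k → Module.Dual R N), ∀ e, ρ • e = ∑ i, c i e • s i

variable (R) in
/-- Elements of `P` are detected by the functions `ρ` that are framed on `N`. -/
def FrameSeparated (N : Type*) [AddCommGroup N] [Module R N] (k : ℕ)
    (P : Type*) [AddCommGroup P] [Module R P] : Prop :=
  ∀ z : P, (∀ ρ : R, IsFramed R N k ρ → ρ • z = 0) → z = 0

theorem FrameSeparated.forms {k : ℕ} (h : FrameSeparated R N k P) :
    FrameSeparated R N k (Forms R L P) := by
  intro z hz
  refine DFinsupp.ext fun s => AlternatingMap.ext fun v => ?_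
  refine h _ fun ρ hρ => ?_
  have := congrArg (fun y : Forms R L P => y s v) (hz ρ hρ)
  exact this

/-- A section has degree 0 and passes a form without sign. With the section on the left, the action
of End-valued forms is associative and the Leibniz rule has no sign. -/
theorem lsmul_wedge_zeroForm_right (x : Forms R L R) (e : N) :
    totalWedge (LinearMap.lsmul R N) x (zeroForm e)
      = totalWedge (LinearMap.lsmul R N).flip (zeroForm e) x := by
  rw [zeroForm_wedge_apply, wedge_zeroForm_apply]

/-- An operator on forms that commutes with multiplication by functions vanishes if it vanishes
on all products of a section and a scalar form. -/
theorem eq_zero_of_frame {k : ℕ} (hsep : FrameSeparated R N k P)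
    (T : Forms R L N →ₗ[ℝ] Forms R L P) (hsmul : ∀ (f : R) x, T (f • x) = f • T x)
    (h : ∀ (e : N) (s : ℕ) (θ : Form R L R s),
      T (totalWedge (LinearMap.lsmul R N).flip (zeroForm e) (homog s θ)) = 0) : T = 0 := by
  refine Forms.linearMap_ext fun t η => hsep.forms _ ?_
  rintro ρ ⟨s, c, hc⟩
  rw [← hsmul, ← homog_smul]
  -- The framing, applied to each value of η, writes ρη as a finite sum of products of the sections
  -- s_i with the scalar forms c_i∘η.
  have : ρ • η = ∑ i, ((LinearMap.lsmul R N).flip (s i)).compAlternatingMap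
      ((c i).compAlternatingMap η) := by
    ext v
    refine (hc (η v)).trans (Eq.symm ?_)
    let ev : Form R L N t →+ N := AddMonoidHom.mk' (fun α => α v) fun _ _ => rfl
    exact map_sum ev _ _
  rw [this, map_sum, map_sum]
  refine Finset.sum_eq_zero fun i _ => ?_
  have := h (s i) t ((c i).compAlternatingMap η)
  rwa [zeroForm_wedge] at this

end Maps

/-! ### End-valued forms as operators, curvature and the Bianchi identity -/

section Endomorphisms
variable {R L N : Type*} [CommRing R] [Algebra ℝ R]
  [LieRing L] [LieAlgebra ℝ L] [Module R L] [LieRingModule L R] [LieRinehartRing R L]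
  [LieRinehartAlgebra ℝ R L]
  [AddCommGroup N] [Module ℝ N] [Module R N] [IsScalarTower ℝ R N]

/-- The connection `T ↦ [∇_a, T]` on the endomorphisms. -/
def LinearConnection.endConnection (D : LinearConnection R L N) :
    LinearConnection R L (Module.End R N) where
  nabla :=
    { toFun := fun a =>
        { toFun := fun T =>
            { toFun := fun e => D.nabla a (T e) - T (D.nabla a e)
              map_add' := fun e e' => by simp only [map_add]; abel
              map_smul' := fun f e => by
                simp only [map_smul, D.leibniz, map_add, RingHom.id_apply, smul_sub]; abel }
          map_add' := fun S T => by
            ext e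
            simp only [LinearMap.add_apply, LinearMap.coe_mk, AddHom.coe_mk, map_add]; abel
          map_smul' := fun c T => by
            ext e
            simp only [LinearMap.smul_apply, LinearMap.coe_mk, AddHom.coe_mk, map_smul,
              RingHom.id_apply, smul_sub] }
      map_add' := fun a b => by
        ext T e
        simp only [LinearMap.add_apply, LinearMap.coe_mk, AddHom.coe_mk, map_add]; abel
      map_smul' := fun f a => by
        ext T e
        simp only [LinearMap.smul_apply, LinearMap.coe_mk, AddHom.coe_mk, map_smul,
          RingHom.id_apply, smul_sub] }
  leibniz := fun a f T => by
    ext e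
    simp only [LinearMap.add_apply, LinearMap.smul_apply, LinearMap.coe_mk, AddHom.coe_mk,
      D.leibniz, smul_sub]
    abel

theorem LinearConnection.endConnection_nabla (D : LinearConnection R L N) (a : L)
    (T : Module.End R N) (e : N) :
    D.endConnection.nabla a T e = D.nabla a (T e) - T (D.nabla a e) := rfl

/-- The operator `x ↦ ω ∧ x` on `N`-valued forms, for an `End N`-valued form `ω`. -/
def act : Forms R L (Module.End R N) →ₗ[ℝ] Module.End ℝ (Forms R L N) :=
  totalWedge (LinearMap.id : Module.End R N →ₗ[R] N →ₗ[R] N)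

/-- The product of `End N`-valued forms. -/
abbrev endWedge : Forms R L (Module.End R N) →ₗ[ℝ] Forms R L (Module.End R N) →ₗ[ℝ]
    Forms R L (Module.End R N) := totalWedge (LinearMap.mul R (Module.End R N))

theorem act_endWedge (x y : Forms R L (Module.End R N)) :
    act (endWedge x y) = act x * act y := by
  refine LinearMap.ext fun z => ?_
  exact totalWedge_assoc _ _ _ _ (fun a b c => rfl) x y z

theorem act_zeroForm (x : Forms R L (Module.End R N)) (e : N) :
    act x (zeroForm e) = mapForms (LinearMap.applyₗ e) x :=
  wedge_zeroForm_apply _ _ _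

theorem act_zeroForm_apply (x : Forms R L (Module.End R N)) (e : N) (s : ℕ) (v : Fin s → L) :
    act x (zeroForm e) s v = x s v e := by
  rw [act_zeroForm]
  induction x using Forms.induction with
  | h0 => rw [map_zero]; rfl
  | h2 a b ha hb => rw [map_add]; exact congrArg₂ (· + ·) ha hb
  | h1 t θ =>
    rw [mapForms_homog]
    rcases eq_or_ne t s with rfl | h
    · rw [homog_apply_self, homog_apply_self]; rfl
    · rw [homog_apply_ne _ h, homog_apply_ne _ h]; rfl

/-- Acting on a section e and evaluating at v returns x(v)e, so the action remembers the form.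
Identities between End-valued forms can thus be proved for operators. -/
theorem act_injective :
    Function.Injective (act : Forms R L (Module.End R N) →ₗ[ℝ] Module.End ℝ (Forms R L N)) := by
  intro x y h
  refine DFinsupp.ext fun s => AlternatingMap.ext fun v => LinearMap.ext fun e => ?_
  rw [← act_zeroForm_apply, h, act_zeroForm_apply]

theorem act_smul (x : Forms R L (Module.End R N)) (f : R) (y : Forms R L N) :
    act x (f • y) = f • act x y := totalWedge_smul_right _ _ _ _

theorem act_section_wedge (x : Forms R L (Module.End R N)) (y : Forms R L N) (z : Forms R L R) :
    act x (totalWedge (LinearMap.lsmul R N).flip y z)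
      = totalWedge (LinearMap.lsmul R N).flip (act x y) z :=
  (totalWedge_assoc _ _ _ _ (fun a b c => by simp) x y z).symm

/-- This is the Leibniz rule for the evaluation pairing End N × N → N: the graded commutator of d_∇
with an End-valued form is the covariant differential of that form. -/
theorem totalD_mul_act (D : LinearConnection R L N) (x : Forms R L (Module.End R N)) :
    D.totalD * act x = act (D.endConnection.totalD x) + act (gradeInv x) * D.totalD := by
  refine LinearMap.ext fun y => ?_
  refine D.endConnection.totalD_wedge _ D D (fun a T e => ?_) x y
  simp only [LinearMap.id_apply, D.endConnection_nabla, sub_add_cancel]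

variable (R L) in
/-- `d_A ∘ d_A` vanishes after multiplication by elements of `N`. -/
def SquareZeroOn (N : Type*) [AddCommGroup N] [Module ℝ N] [Module R N] [IsScalarTower ℝ R N] :
    Prop :=
  ∀ (x : Forms R L R) (e : N),
    totalWedge (LinearMap.lsmul R N) (dA R L (dA R L x)) (zeroForm e) = 0

/-- The two cross terms d_∇e ∧ d_A x cancel because d_∇ anticommutes with the grading involution.
The remaining term e ∧ d_A² x is zero by `hd`. -/
theorem totalD_totalD_wedge (hd : SquareZeroOn R L N) (D : LinearConnection R L N) (e : N)
    (x : Forms R L R) :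
    D.totalD (D.totalD (totalWedge (LinearMap.lsmul R N).flip (zeroForm e) x))
      = totalWedge (LinearMap.lsmul R N).flip (D.totalD (D.totalD (zeroForm e))) x := by
  have hB : ∀ (a : L) (e : N) (f : R), D.nabla a ((LinearMap.lsmul R N).flip e f)
      = (LinearMap.lsmul R N).flip (D.nabla a e) f
        + (LinearMap.lsmul R N).flip e ((flatConnection R L).nabla a f) := by
    intro a e f
    simp [D.leibniz]
  have h : totalWedge (LinearMap.lsmul R N).flip (zeroForm e)
      ((flatConnection R L).totalD ((flatConnection R L).totalD x)) = 0 := by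
    rw [← lsmul_wedge_zeroForm_right]
    exact hd x e
  rw [D.totalD_wedge _ _ D hB, map_add, D.totalD_wedge _ _ D hB, D.totalD_wedge _ _ D hB,
    gradeInv_gradeInv, h, D.totalD_gradeInv, map_neg, LinearMap.neg_apply]
  abel

/-- `curvaturePow` records only the component of degree 2i of d_∇^(2i) e; homogeneity ensures that
nothing is lost. -/
theorem totalD_pow_zeroForm (D : LinearConnection R L N) (j : ℕ) (e : N) :
    ∃ θ : Form R L N j, (D.totalD ^ j) (zeroForm e) = homog j θ := by
  induction j with
  | zero => exact ⟨_, rfl⟩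
  | succ j ih =>
    obtain ⟨θ, hθ⟩ := ih
    exact ⟨D.d j θ, by rw [pow_succ', Module.End.mul_apply, hθ, D.totalD_homog]⟩

theorem act_curvaturePow_zeroForm (D : LinearConnection R L N) (i : ℕ) (e : N) :
    act (homog (2 * i) (D.curvaturePow i)) (zeroForm e) = (D.totalD ^ (2 * i)) (zeroForm e) := by
  obtain ⟨θ, hθ⟩ := totalD_pow_zeroForm D (2 * i) e
  rw [act_zeroForm, mapForms_homog, hθ]
  congr 1
  ext v
  change ((D.totalD ^ (2 * i)) (zeroForm e)) (2 * i) v = θ v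
  rw [hθ, homog_apply_self]

theorem eq_of_act_zeroForm {x y : Forms R L (Module.End R N)}
    (h : ∀ e, act x (zeroForm e) = act y (zeroForm e)) : x = y := by
  refine DFinsupp.ext fun s => AlternatingMap.ext fun v => LinearMap.ext fun e => ?_
  rw [← act_zeroForm_apply, h, act_zeroForm_apply]

/-- Both operators are linear over functions, and on e ∧ θ both give d_∇² e ∧ θ, so
`eq_zero_of_frame` applies to their difference. -/
theorem act_curvature {k : ℕ} (hsep : FrameSeparated R N k N) (hd : SquareZeroOn R L N)
    (D : LinearConnection R L N) :
    act (homog (2 * 1) (D.curvaturePow 1)) = D.totalD ^ (2 * 1) := by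
  rw [← sub_eq_zero]
  refine eq_zero_of_frame hsep _ (fun f x => ?_) fun e s θ => ?_
  · rw [LinearMap.sub_apply, LinearMap.sub_apply, act_smul, D.totalD_pow_smul, smul_sub]
  · rw [LinearMap.sub_apply, act_section_wedge, act_curvaturePow_zeroForm, mul_one, pow_two,
      Module.End.mul_apply, Module.End.mul_apply, totalD_totalD_wedge hd, sub_self]

/-- The iterated covariant differential `d_∇ ^ (2 i)` is multiplication by `R_∇ ^ i`. -/
theorem act_curvaturePow {k : ℕ} (hsep : FrameSeparated R N k N) (hd : SquareZeroOn R L N)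
    (D : LinearConnection R L N) (i : ℕ) :
    act (homog (2 * i) (D.curvaturePow i)) = D.totalD ^ (2 * i) := by
  -- It is enough that some form acts as this power: its values on sections then identify it with
  -- `curvaturePow`.
  have h : ∃ x, act x = D.totalD ^ (2 * i) := by
    induction i with
    | zero =>
      refine ⟨zeroForm 1, ?_⟩
      rw [mul_zero, pow_zero]
      refine LinearMap.ext fun y => ?_
      refine (zeroForm_wedge_apply _ _ _).trans ?_
      induction y using Forms.induction with
      | h0 => simp
      | h2 a b ha hb => rw [map_add, map_add, ha, hb]
      | h1 s θ => rw [mapForms_homog]; rfl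
    | succ i ih =>
      obtain ⟨x, hx⟩ := ih
      refine ⟨endWedge (homog (2 * 1) (D.curvaturePow 1)) x, ?_⟩
      rw [act_endWedge, hx, act_curvature hsep hd, ← pow_add]
      congr 1
      ring
  obtain ⟨x, hx⟩ := h
  rw [← hx]
  congr 1
  refine eq_of_act_zeroForm fun e => ?_
  rw [hx, act_curvaturePow_zeroForm]

theorem curvaturePow_succ {k : ℕ} (hsep : FrameSeparated R N k N) (hd : SquareZeroOn R L N)
    (D : LinearConnection R L N) (i : ℕ) :
    homog (2 * (i + 1)) (D.curvaturePow (i + 1))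
      = endWedge (homog (2 * 1) (D.curvaturePow 1)) (homog (2 * i) (D.curvaturePow i)) := by
  refine act_injective ?_
  rw [act_endWedge, act_curvaturePow hsep hd, act_curvaturePow hsep hd, act_curvaturePow hsep hd,
    ← pow_add]
  congr 1
  ring

/-- The Bianchi identity: R_∇^i acts as a power of d_∇, which commutes with d_∇, and for a form of
even degree the graded commutator is the ordinary one. -/
theorem endConnection_curvaturePow {k : ℕ} (hsep : FrameSeparated R N k N)
    (hd : SquareZeroOn R L N) (D : LinearConnection R L N) (i : ℕ) :
    D.endConnection.totalD (homog (2 * i) (D.curvaturePow i)) = 0 := by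
  refine act_injective ?_
  have h := totalD_mul_act D (homog (2 * i) (D.curvaturePow i))
  rw [gradeInv_homog, pow_mul, neg_one_sq, one_pow, one_smul, act_curvaturePow hsep hd,
    ← pow_succ, ← pow_succ'] at h
  rw [map_zero]
  exact LinearMap.ext fun y => right_eq_add.mp (LinearMap.congr_fun h y)

end Endomorphisms

/-! ### Traces determined by their values on rank one endomorphisms -/

section RankOne
variable {R L N P : Type*} [CommRing R] [Algebra ℝ R]
  [LieRing L] [LieAlgebra ℝ L] [Module R L] [LieRingModule L R] [LieRinehartRing R L]
  [LieRinehartAlgebra ℝ R L]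
  [AddCommGroup N] [Module ℝ N] [Module R N] [IsScalarTower ℝ R N]
  [AddCommGroup P] [Module ℝ P] [Module R P] [IsScalarTower ℝ R P]

/-- The functional `tr` has the expected value on endomorphisms of rank one. -/
def IsRankOneTrace (tr : Module.Dual R (Module.End R N)) : Prop :=
  ∀ (c : Module.Dual R N) (s : N), tr (c.smulRight s) = c s

/-- With ρ = ∑ c_i ⊗ s_i on N, both ρ·ST and ρ·TS are sums of rank one maps, namely (c_i∘ST) ⊗ s_i
and (c_i∘S) ⊗ T s_i. Both traces equal ∑ c_i(S T s_i). A framing of N alone suffices. -/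
theorem IsRankOneTrace.comp_comm {k : ℕ} {tr : Module.Dual R (Module.End R N)}
    {tr' : Module.Dual R (Module.End R P)} (h : IsRankOneTrace tr) (h' : IsRankOneTrace tr')
    (hsep : FrameSeparated R N k R) (S : P →ₗ[R] N) (T : N →ₗ[R] P) :
    tr (S ∘ₗ T) = tr' (T ∘ₗ S) := by
  rw [← sub_eq_zero]
  refine hsep _ ?_
  rintro ρ ⟨s, c, hc⟩
  have h1 : ρ • (S ∘ₗ T) = ∑ i, (c i ∘ₗ S ∘ₗ T).smulRight (s i) := by
    ext e
    simpa using hc (S (T e))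
  have h2 : ρ • (T ∘ₗ S) = ∑ i, (c i ∘ₗ S).smulRight (T (s i)) := by
    ext e
    simpa using congrArg T (hc (S e))
  rw [smul_sub, ← map_smul, ← map_smul, h1, h2, map_sum, map_sum, sub_eq_zero]
  refine Finset.sum_congr rfl fun i _ => ?_
  rw [h, h']
  rfl

theorem IsRankOneTrace.endConnection_smulRight {tr : Module.Dual R (Module.End R N)}
    (h : IsRankOneTrace tr) (D : LinearConnection R L N) (a : L) (c : Module.Dual R N) (s : N) :
    tr (D.endConnection.nabla a (c.smulRight s)) = ⁅a, c s⁆ := by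
  -- The derivative of c for the dual connection, so that ∇_a(c ⊗ s) = c ⊗ ∇_a s + c' ⊗ s.
  let c' : Module.Dual R N :=
    { toFun := fun e => ⁅a, c e⁆ - c (D.nabla a e)
      map_add' := fun e e' => by simp only [map_add, lie_add]; abel
      map_smul' := fun f e => by
        simp only [map_smul, D.leibniz, map_add, smul_eq_mul, RingHom.id_apply,
          LieRinehartRing.leibniz_mul_right]
        ring }
  have : D.endConnection.nabla a (c.smulRight s)
      = c.smulRight (D.nabla a s) + c'.smulRight s := by
    ext e
    simp only [D.endConnection_nabla, LinearMap.smulRight_apply, LinearMap.add_apply, D.leibniz]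
    change _ = _ + (⁅a, c e⁆ - c (D.nabla a e)) • s
    rw [sub_smul]
    abel
  rw [this, map_add, h, h]
  exact add_sub_cancel _ _

theorem IsRankOneTrace.endConnection {k : ℕ} {tr : Module.Dual R (Module.End R N)}
    (h : IsRankOneTrace tr) (hsep : FrameSeparated R N k R) (D : LinearConnection R L N) (a : L)
    (T : Module.End R N) : tr (D.endConnection.nabla a T) = ⁅a, tr T⁆ := by
  rw [← sub_eq_zero]
  refine hsep _ ?_
  rintro ρ ⟨s, c, hc⟩
  have h1 : ρ • T = ∑ i, (c i ∘ₗ T).smulRight (s i) := by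
    ext e
    simpa using hc (T e)
  have h2 : tr (D.endConnection.nabla a (ρ • T)) = ⁅a, tr (ρ • T)⁆ := by
    rw [h1, map_sum, map_sum, map_sum, lie_sum]
    refine Finset.sum_congr rfl fun i _ => ?_
    rw [h.endConnection_smulRight, h]
  -- Differentiating the factor ρ contributes ⁅a, ρ⁆ · tr T to both sides, and these contributions
  -- cancel.
  rw [D.endConnection.leibniz, map_add, map_smul, map_smul, map_smul, smul_eq_mul, smul_eq_mul,
    smul_eq_mul, LieRinehartRing.leibniz_mul_right] at h2
  rw [smul_eq_mul, mul_sub]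
  linear_combination h2

theorem IsRankOneTrace.dA_mapForms {k : ℕ} {tr : Module.Dual R (Module.End R N)}
    (h : IsRankOneTrace tr) (hsep : FrameSeparated R N k R) (D : LinearConnection R L N)
    (x : Forms R L (Module.End R N)) :
    dA R L (mapForms tr x) = mapForms tr (D.endConnection.totalD x) :=
  (mapForms_totalD (fun a T => (h.endConnection hsep D a T).symm) x).symm

theorem traceForm_eq_mapForms (tr : Module.Dual R (Module.End R N)) (D : LinearConnection R L N)
    (i : ℕ) : traceForm tr D i = mapForms tr (homog (2 * i) (D.curvaturePow i)) :=
  (mapForms_homog _ _ _).symm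

theorem IsRankOneTrace.traceForm_mem {k : ℕ} {tr : Module.Dual R (Module.End R N)}
    (h : IsRankOneTrace tr) (hsep : FrameSeparated R N k R) (hsep' : FrameSeparated R N k N)
    (hd : SquareZeroOn R L N) (D : LinearConnection R L N) (i : ℕ) :
    traceForm tr D i ∈ closedForms R L := by
  change dA R L _ = 0
  rw [traceForm_eq_mapForms, h.dA_mapForms hsep D, endConnection_curvaturePow hsep' hd, map_zero]

end RankOne

/-! ### The derivative of an even power along a line in an algebra -/

section Transgression

/-- `∑_m P ^ (2 m) B P ^ (2 (l - 1 - m))`. -/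
def transgression {A : Type*} [Ring A] (P B : A) : ℕ → A
  | 0 => 0
  | l + 1 => P ^ 2 * transgression P B l + B * P ^ (2 * l)

/-- With P = a + tb, the derivative of P^(2l) is the anticommutator of P with the transgression Q;
for the odd operators considered later this is a graded commutator. No topology is assumed on the
algebra, so the derivative is tested with linear functionals Φ. The induction runs over all Φ
because the step replaces Φ by its composites with left multiplication by the coefficients of (a +
tb)². -/
theorem hasDerivAt_pow_transgression {A : Type*} [Ring A] [Algebra ℝ A] (a b : A) (l : ℕ) (t : ℝ)
    (Φ : A →ₗ[ℝ] ℝ) :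
    HasDerivAt (fun t : ℝ => Φ ((a + t • b) ^ (2 * l)))
      (Φ ((a + t • b) * transgression (a + t • b) b l
        + transgression (a + t • b) b l * (a + t • b))) t := by
  induction l generalizing Φ with
  | zero => simpa [transgression] using hasDerivAt_const t (Φ 1)
  | succ l ih =>
    have h0 := ih (Φ ∘ₗ LinearMap.mulLeft ℝ (a * a))
    have h1 := ih (Φ ∘ₗ LinearMap.mulLeft ℝ (a * b + b * a))
    have h2 := ih (Φ ∘ₗ LinearMap.mulLeft ℝ (b * b))
    have h3 := (h0.add ((hasDerivAt_id t).mul h1)).add (((hasDerivAt_id t).pow 2).mul h2)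
    have e : ∀ (t : ℝ) (x : A), (a + t • b) ^ 2 * x
        = a * a * x + t • ((a * b + b * a) * x) + t ^ 2 • (b * b * x) := by
      intro t x
      simp only [pow_two, add_mul, mul_add, smul_mul_assoc, mul_smul_comm, smul_smul, smul_add]
      abel
    refine (h3.congr_deriv ?_).congr_of_eventuallyEq (Filter.Eventually.of_forall fun t => ?_)
    · have hc : (a + t • b) ^ (2 * l) * (a + t • b) = (a + t • b) * (a + t • b) ^ (2 * l) :=
        ((Commute.refl (a + t • b)).pow_left (2 * l)).eq
      have e2 : (a + t • b) * transgression (a + t • b) b (l + 1)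
          + transgression (a + t • b) b (l + 1) * (a + t • b)
          = (a + t • b) ^ 2 * ((a + t • b) * transgression (a + t • b) b l
              + transgression (a + t • b) b l * (a + t • b))
            + ((a * b + b * a) * (a + t • b) ^ (2 * l)
              + (2 * t) • (b * b * (a + t • b) ^ (2 * l))) := by
        rw [transgression, add_mul _ _ (a + t • b), mul_assoc b, hc]
        generalize (a + t • b) ^ (2 * l) = X
        generalize transgression (a + t • b) b l = Q
        have : (a * b + b * a) * X + (2 * t) • (b * b * X)
            = (a + t • b) * (b * X) + b * ((a + t • b) * X) := by
          simp only [add_mul, mul_add, smul_mul_assoc, mul_smul_comm, mul_assoc, two_mul, add_smul]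
          abel
        rw [this]
        generalize a + t • b = p
        noncomm_ring
      rw [e2, e]
      generalize (a + t • b) * transgression (a + t • b) b l
        + transgression (a + t • b) b l * (a + t • b) = Y
      generalize (a + t • b) ^ (2 * l) = X
      simp only [LinearMap.comp_apply, LinearMap.mulLeft_apply, id, Pi.pow_apply, map_add,
        map_smul, smul_eq_mul]
      push_cast
      ring
    · change Φ _ = _
      rw [mul_add, mul_one, add_comm (2 * l), pow_add, e]
      simp [mul_assoc]

end Transgression

/-! ### Independence of the connection -/

section ChernWeil
variable {R L N : Type*} [CommRing R] [Algebra ℝ R]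
  [LieRing L] [LieAlgebra ℝ L] [Module R L] [LieRingModule L R] [LieRinehartRing R L]
  [LieRinehartAlgebra ℝ R L]
  [AddCommGroup N] [Module ℝ N] [Module R N] [IsScalarTower ℝ R N]

/-- The connection `∇ + θ`. -/
def LinearConnection.add (D : LinearConnection R L N) (θ : L →ₗ[R] Module.End R N) :
    LinearConnection R L N where
  nabla :=
    { toFun := fun a => D.nabla a + (θ a).restrictScalars ℝ
      map_add' := fun a b => by
        ext e
        simp only [map_add, LinearMap.add_apply, LinearMap.restrictScalars_apply]
        abel
      map_smul' := fun f a => by ext e; simp }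
  leibniz := fun a f e => by
    simp only [LinearMap.coe_mk, AddHom.coe_mk, LinearMap.add_apply, D.leibniz,
      LinearMap.restrictScalars_apply, map_smul, smul_add]
    abel

/-- The difference of two connections. -/
def LinearConnection.sub (D' D : LinearConnection R L N) : L →ₗ[R] Module.End R N where
  toFun a :=
    { toFun := fun e => D'.nabla a e - D.nabla a e
      map_add' := fun e e' => by simp only [map_add]; abel
      map_smul' := fun f e => by
        simp only [D.leibniz, D'.leibniz, RingHom.id_apply, smul_sub]; abel }
  map_add' a b := by
    ext e
    simp only [map_add, LinearMap.add_apply, LinearMap.coe_mk, AddHom.coe_mk]; abel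
  map_smul' f a := by
    ext e
    simp only [map_smul, LinearMap.smul_apply, LinearMap.coe_mk, AddHom.coe_mk, smul_sub,
      RingHom.id_apply]

theorem LinearConnection.add_sub (D D' : LinearConnection R L N) : D.add (D'.sub D) = D' := by
  rcases D with ⟨D, hD⟩
  rcases D' with ⟨D', hD'⟩
  simp only [LinearConnection.add, LinearConnection.sub, LinearConnection.mk.injEq]
  ext a e
  simp

variable (R L N) in
/-- A linear map as a 1-form. -/
def oneForm : (L →ₗ[R] N) →ₗ[ℝ] Forms R L N where
  toFun θ := homog 1 (AlternatingMap.ofSubsingleton R L N (0 : Fin 1) θ)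
  map_add' θ θ' := by rw [← map_add]; rfl
  map_smul' c θ := by rw [RingHom.id_apply, ← map_smul]; rfl

theorem oneForm_apply (θ : L →ₗ[R] N) :
    oneForm R L N θ = homog 1 (AlternatingMap.ofSubsingleton R L N (0 : Fin 1) θ) := rfl

theorem LinearConnection.totalD_smul_eq (D : LinearConnection R L N) (f : R)
    (x : Forms R L N) : D.totalD (f • x)
      = totalWedge (LinearMap.lsmul R N) (dA R L (zeroForm f)) x + f • D.totalD x := by
  have h0 : gradeInv (zeroForm f : Forms R L R) = zeroForm f := by
    refine (gradeInv_homog 0 _).trans ?_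
    rw [pow_zero, one_smul]; rfl
  rw [← lsmul_wedge_zeroForm, ← lsmul_wedge_zeroForm,
    LinearConnection.totalD_wedge _ (flatConnection R L) D D, h0]
  · rfl
  · intro a f e
    simp [D.leibniz, add_comm]

theorem LinearConnection.totalD_section_wedge (D : LinearConnection R L N) (e : N)
    (x : Forms R L R) : D.totalD (totalWedge (LinearMap.lsmul R N).flip (zeroForm e) x)
      = totalWedge (LinearMap.lsmul R N).flip (D.totalD (zeroForm e)) x
        + totalWedge (LinearMap.lsmul R N).flip (zeroForm e) (dA R L x) := by
  have h0 : gradeInv (zeroForm e : Forms R L N) = zeroForm e := by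
    refine (gradeInv_homog 0 _).trans ?_
    rw [pow_zero, one_smul]; rfl
  rw [LinearConnection.totalD_wedge _ D (flatConnection R L) D, h0]
  · rfl
  · intro a e f
    simp [D.leibniz]

theorem LinearConnection.totalD_zeroForm (D : LinearConnection R L N) (e : N) (v : Fin 1 → L) :
    D.totalD (zeroForm e) 1 v = D.nabla (v 0) e := by
  have : D.totalD (zeroForm e) = homog 1 (D.d 0 (AlternatingMap.constOfIsEmpty R L (Fin 0) e)) :=
    D.totalD_homog 0 _
  rw [this, homog_apply_self, D.d_apply]
  simp [LinearConnection.koszul, LinearConnection.lieTerm]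

theorem LinearConnection.totalD_zeroForm_eq (D : LinearConnection R L N) (e : N) :
    D.totalD (zeroForm e) = homog 1 (D.totalD (zeroForm e) 1) := by
  have : D.totalD (zeroForm e) = homog 1 (D.d 0 (AlternatingMap.constOfIsEmpty R L (Fin 0) e)) :=
    D.totalD_homog 0 _
  rw [this, homog_apply_self]

/-- The terms with d_A f cancel in the difference of the two sides, which is therefore linear over
functions. It vanishes on sections by definition of ∇ + θ, hence on their products with scalar
forms. -/
theorem LinearConnection.totalD_add {k : ℕ} (hsep : FrameSeparated R N k N)
    (D : LinearConnection R L N) (θ : L →ₗ[R] Module.End R N) :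
    (D.add θ).totalD = D.totalD + act (oneForm R L _ θ) := by
  rw [← sub_eq_zero]
  have h : ∀ e : N, ((D.add θ).totalD - (D.totalD + act (oneForm R L _ θ))) (zeroForm e) = 0 := by
    intro e
    have h1 : act (oneForm R L _ θ) (zeroForm e) = homog 1 ((LinearMap.applyₗ e).compAlternatingMap
        (AlternatingMap.ofSubsingleton R L (Module.End R N) (0 : Fin 1) θ)) :=
      (act_zeroForm _ e).trans (mapForms_homog _ _ _)
    rw [LinearMap.sub_apply, LinearMap.add_apply, totalD_zeroForm_eq, D.totalD_zeroForm_eq, h1,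
      ← map_add, ← map_sub]
    refine (congrArg (homog 1) ?_).trans (map_zero (homog 1))
    ext v
    rw [AlternatingMap.sub_apply, AlternatingMap.add_apply, totalD_zeroForm, D.totalD_zeroForm]
    exact sub_self _
  refine eq_zero_of_frame hsep _ (fun f x => ?_) fun e s x => ?_
  · simp only [LinearMap.sub_apply, LinearMap.add_apply, totalD_smul_eq, act_smul, smul_sub,
      smul_add]
    abel
  · have h2 := congrArg (fun z => totalWedge (LinearMap.lsmul R N).flip z (homog s x)) (h e)
    rw [LinearMap.sub_apply, LinearMap.add_apply, LinearMap.map_sub₂, LinearMap.map_add₂, map_zero,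
      LinearMap.zero_apply] at h2
    rw [LinearMap.sub_apply, LinearMap.add_apply, totalD_section_wedge, D.totalD_section_wedge,
      act_section_wedge, add_right_comm, add_sub_add_right_eq_sub, h2]

/-- For odd q the graded commutator is the anticommutator, the shape in which the derivative of
d_∇^(2l) appears. -/
theorem totalD_mul_act_of_odd (D : LinearConnection R L N) {q : Forms R L (Module.End R N)}
    (hq : gradeInv q = -q) :
    D.totalD * act q + act q * D.totalD = act (D.endConnection.totalD q) := by
  refine LinearMap.ext fun y => ?_
  have h := LinearMap.congr_fun (totalD_mul_act D q) y
  rw [LinearMap.add_apply, Module.End.mul_apply, Module.End.mul_apply, hq, map_neg,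
    LinearMap.neg_apply] at h
  rw [LinearMap.add_apply, Module.End.mul_apply, Module.End.mul_apply, h]
  abel

/-- Only even powers of d_∇ occur in the transgression. They act as curvature forms, so the whole
operator is multiplication by a form, odd because each summand contains θ once. -/
theorem transgression_eq_act {k : ℕ} (hsep : FrameSeparated R N k N) (hd : SquareZeroOn R L N)
    (D : LinearConnection R L N) (θ : L →ₗ[R] Module.End R N) (l : ℕ) :
    ∃ q : Forms R L (Module.End R N), gradeInv q = -q ∧
      transgression D.totalD (act (oneForm R L _ θ)) l = act q := by
  have hodd : gradeInv (oneForm R L _ θ) = -oneForm R L _ θ := by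
    refine eq_neg_of_add_eq_zero_left ?_
    have h1 : gradeInv (oneForm R L _ θ) = (-1 : ℝ) • oneForm R L _ θ := by
      rw [oneForm_apply, gradeInv_homog, pow_one]
    nth_rewrite 2 [← one_smul ℝ (oneForm R L _ θ)]
    rw [h1, ← add_smul, neg_add_cancel, zero_smul]
  have heven : ∀ i, gradeInv (homog (2 * i) (D.curvaturePow i))
      = homog (2 * i) (D.curvaturePow i) := by
    intro i
    rw [gradeInv_homog, pow_mul, neg_one_sq, one_pow, one_smul]
  induction l with
  | zero => exact ⟨0, by simp, by simp [transgression]⟩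
  | succ l ih =>
    obtain ⟨q, hq, hl⟩ := ih
    refine ⟨endWedge (homog (2 * 1) (D.curvaturePow 1)) q
      + endWedge (oneForm R L _ θ) (homog (2 * l) (D.curvaturePow l)), ?_, ?_⟩
    · rw [map_add, gradeInv_totalWedge, gradeInv_totalWedge, hq, hodd, heven, heven]
      simp only [map_neg, LinearMap.neg_apply]
      abel
    · rw [transgression, hl, map_add, act_endWedge, act_endWedge, act_curvaturePow hsep hd,
        act_curvaturePow hsep hd]

/-- An injection of real vector spaces has a linear left inverse. Only additive monoids are assumed;
negatives come from the scalar -1. -/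
theorem exists_extend_of_injective {V W : Type*} [AddCommMonoid V] [Module ℝ V]
    [AddCommMonoid W] [Module ℝ W] (f : V →ₗ[ℝ] W) (hf : Function.Injective f) (g : V →ₗ[ℝ] ℝ) :
    ∃ Φ : W →ₗ[ℝ] ℝ, ∀ x, Φ (f x) = g x := by
  let _ := Module.addCommMonoidToAddCommGroup ℝ (M := V)
  let _ := Module.addCommMonoidToAddCommGroup ℝ (M := W)
  obtain ⟨τ, hτ⟩ := f.exists_leftInverse_of_injective (LinearMap.ker_eq_bot.mpr hf)
  exact ⟨g ∘ₗ τ, fun x => congrArg g (LinearMap.congr_fun hτ x)⟩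

/-- The cohomology class of `tr (R_∇^l)` does not depend on the connection. -/
theorem IsRankOneTrace.exists_dA_eq_sub {k : ℕ} {tr : Module.Dual R (Module.End R N)}
    (h : IsRankOneTrace tr) (hsep : FrameSeparated R N k R) (hsep' : FrameSeparated R N k N)
    (hd : SquareZeroOn R L N) (D D' : LinearConnection R L N) (l : ℕ) :
    ∃ y, dA R L y = traceForm tr D' l - traceForm tr D l := by
  by_contra hcon
  -- If the difference were not exact, a real functional g vanishing on exact forms would detect it.
  -- This replaces integration of forms along the path of connections by calculus for a real
  -- function.
  obtain ⟨g, hg, hker⟩ := Submodule.exists_le_ker_of_notMem (p := LinearMap.range (dA R L)) hcon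
  -- Extending g∘tr from End-valued forms to all operators makes Φ(d_∇^(2l)) meaningful, with value
  -- g(tr R_∇^l).
  obtain ⟨Φ, hΦ⟩ := exists_extend_of_injective act act_injective (g ∘ₗ mapForms tr)
  obtain ⟨θ, rfl⟩ : ∃ θ, D.add θ = D' := ⟨D'.sub D, D.add_sub D'⟩
  have hP : ∀ t : ℝ, D.totalD + t • act (oneForm R L _ θ) = (D.add (t • θ)).totalD := by
    intro t
    rw [D.totalD_add hsep', map_smul, map_smul]
  have hder : ∀ t : ℝ, HasDerivAt
      (fun t : ℝ => Φ ((D.totalD + t • act (oneForm R L _ θ)) ^ (2 * l))) 0 t := by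
    intro t
    -- The derivative is Φ of an anticommutator, that is g(tr d_∇ q) = g(d_A tr q), which is zero as
    -- g annihilates exact forms.
    refine (hasDerivAt_pow_transgression D.totalD (act (oneForm R L _ θ)) l t Φ).congr_deriv ?_
    rw [hP]
    obtain ⟨q, hq, hl⟩ := transgression_eq_act hsep' hd (D.add (t • θ)) θ l
    rw [hl, totalD_mul_act_of_odd _ hq, hΦ,
      LinearMap.comp_apply, ← h.dA_mapForms hsep]
    exact hker ⟨_, rfl⟩
  have hval : ∀ D : LinearConnection R L N, Φ (D.totalD ^ (2 * l)) = g (traceForm tr D l) := by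
    intro D
    rw [← act_curvaturePow hsep' hd, traceForm_eq_mapForms, hΦ, LinearMap.comp_apply]
  have hc := is_const_of_deriv_eq_zero (fun t => (hder t).differentiableAt)
    (fun t => (hder t).deriv) 1 0
  rw [one_smul, zero_smul, add_zero, ← D.totalD_add hsep', hval, hval] at hc
  rw [map_sub, hc, sub_self] at hg
  exact hg rfl

end ChernWeil

/-! ### The components of a representation up to homotopy -/

section Representation
variable {R L N P : Type*} [CommRing R] [Algebra ℝ R]
  [LieRing L] [LieAlgebra ℝ L] [Module R L] [LieRingModule L R] [LieRinehartRing R L]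
  [LieRinehartAlgebra ℝ R L]
  [AddCommGroup N] [Module ℝ N] [Module R N] [IsScalarTower ℝ R N]
  [AddCommGroup P] [Module ℝ P] [Module R P] [IsScalarTower ℝ R P]

theorem gradeInv_zeroForm (e : N) : gradeInv (zeroForm e : Forms R L N) = zeroForm e := by
  refine (gradeInv_homog 0 _).trans ?_
  rw [pow_zero, one_smul]; rfl

theorem mapForms_apply (φ : N →ₗ[R] P) (x : Forms R L N) (s : ℕ) (v : Fin s → L) :
    mapForms φ x s v = φ (x s v) := by
  induction x using Forms.induction with
  | h0 => rw [map_zero]; exact (map_zero φ).symm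
  | h2 a b ha hb =>
    rw [map_add]
    exact (congrArg₂ (· + ·) ha hb).trans (map_add φ _ _).symm
  | h1 t θ =>
    rw [mapForms_homog]
    rcases eq_or_ne t s with rfl | h
    · rw [homog_apply_self, homog_apply_self]; rfl
    · rw [homog_apply_ne _ h, homog_apply_ne _ h]; exact (map_zero φ).symm

/-- Turns the Leibniz rule of an operator on forms into that of a connection. -/
theorem dA_zeroForm_apply (f : R) (v : Fin 1 → L) : dA R L (zeroForm f) 1 v = ⁅v 0, f⁆ :=
  (flatConnection R L).totalD_zeroForm f v

/-- A derivation of degree 1 on the `N`-valued forms is the covariant differential of a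
connection. -/
theorem exists_totalD_eq {k : ℕ} (hsep : FrameSeparated R N k N)
    (A : Forms R L N →ₗ[ℝ] Forms R L N)
    (hA : ∀ (θ : Forms R L R) x, A (totalWedge (LinearMap.lsmul R N) θ x)
      = totalWedge (LinearMap.lsmul R N) (dA R L θ) x
        + totalWedge (LinearMap.lsmul R N) (gradeInv θ) (A x))
    (h1 : ∀ e : N, A (zeroForm e) = homog 1 (A (zeroForm e) 1)) :
    ∃ D : LinearConnection R L N, D.totalD = A := by
  have hsmul : ∀ (f : R) x, A (f • x)
      = totalWedge (LinearMap.lsmul R N) (dA R L (zeroForm f)) x + f • A x := by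
    intro f x
    rw [← lsmul_wedge_zeroForm, hA, gradeInv_zeroForm, lsmul_wedge_zeroForm]
  let D : LinearConnection R L N :=
    { nabla :=
        { toFun := fun a =>
            { toFun := fun e => A (zeroForm e) 1 fun _ => a
              map_add' := fun e e' => by rw [map_add, map_add]; rfl
              map_smul' := fun c e => by rw [map_smul, map_smul]; rfl }
          map_add' := fun a b => LinearMap.ext fun e =>
            map_add ((AlternatingMap.ofSubsingleton R L N (0 : Fin 1)).symm (A (zeroForm e) 1)) a b
          map_smul' := fun f a => LinearMap.ext fun e =>
            map_smul ((AlternatingMap.ofSubsingleton R L N (0 : Fin 1)).symm (A (zeroForm e) 1))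
              f a }
      leibniz := fun a f e => by
        change A (zeroForm (f • e)) 1 _ = f • A (zeroForm e) 1 _ + _
        rw [zeroForm_smul, hsmul, wedge_zeroForm_apply, add_comm]
        refine congrArg (f • A (zeroForm e) 1 (fun _ => a) + ·) ?_
        refine (mapForms_apply _ _ _ _).trans ?_
        rw [dA_zeroForm_apply]
        rfl }
  have h0 : ∀ e : N, (D.totalD - A) (zeroForm e) = 0 := by
    intro e
    rw [LinearMap.sub_apply, D.totalD_zeroForm_eq, h1, sub_eq_zero]
    congr 1
    ext v
    rw [D.totalD_zeroForm]
    exact congrArg _ (funext fun i => by rw [Subsingleton.elim i 0])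
  refine ⟨D, ?_⟩
  rw [← sub_eq_zero]
  refine eq_zero_of_frame hsep _ (fun f x => ?_) fun e s θ => ?_
  · rw [LinearMap.sub_apply, LinearMap.sub_apply, hsmul, D.totalD_smul_eq, smul_sub,
      add_sub_add_left_eq_sub]
  -- On θ ∧ e the terms d_A θ ∧ e of both derivations cancel, leaving ±θ ∧ (d_∇ e - A e), which
  -- vanishes by `h0`.
  · have h2 := congrArg (fun z =>
      totalWedge (LinearMap.lsmul R N) (gradeInv (homog s θ)) z) (h0 e)
    rw [map_zero, LinearMap.sub_apply, map_sub] at h2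
    rw [← lsmul_wedge_zeroForm_right, LinearMap.sub_apply, hA,
      LinearConnection.totalD_wedge _ (flatConnection R L) D D]
    · refine (add_sub_add_left_eq_sub _ _ _).trans h2
    · intro a f e
      simp [D.leibniz, add_comm]

/-- A degree 0 tensorial operator on forms is induced by a linear map. -/
theorem exists_mapForms_eq {k : ℕ} (hsep : FrameSeparated R N k P)
    (B : Forms R L N →ₗ[ℝ] Forms R L P)
    (hB : ∀ (θ : Forms R L R) x, B (totalWedge (LinearMap.lsmul R N) θ x)
      = totalWedge (LinearMap.lsmul R P) (gradeInv θ) (B x))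
    (h0 : ∀ e : N, B (zeroForm e) = homog 0 (B (zeroForm e) 0)) :
    ∃ φ : N →ₗ[R] P, ∀ x, B x = gradeInv (mapForms φ x) := by
  have hsmul : ∀ (f : R) x, B (f • x) = f • B x := by
    intro f x
    rw [← lsmul_wedge_zeroForm, hB, gradeInv_zeroForm, lsmul_wedge_zeroForm]
  let φ : N →ₗ[R] P :=
    { toFun := fun e => B (zeroForm e) 0 Fin.elim0
      map_add' := fun e e' => by rw [map_add, map_add]; rfl
      map_smul' := fun f e => by rw [zeroForm_smul, hsmul]; rfl }
  have h1 : ∀ e, B (zeroForm e) = zeroForm (φ e) := by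
    intro e
    rw [h0]
    refine congrArg (homog 0) ?_
    ext v
    exact congrArg _ (Subsingleton.elim _ _)
  -- B acquires the sign (-1)^s on passing an s-form, because it is a component of an operator of
  -- degree 1. Hence it equals φ only up to the grading involution.
  have h2 : B - gradeInv ∘ₗ mapForms φ = 0 := by
    refine eq_zero_of_frame hsep _ (fun f x => ?_) fun e s θ => ?_
    · simp only [LinearMap.sub_apply, LinearMap.comp_apply, hsmul, mapForms_smul, gradeInv_smul,
        smul_sub]
    · rw [← lsmul_wedge_zeroForm_right, LinearMap.sub_apply, hB, h1, LinearMap.comp_apply,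
        mapForms_totalWedge_right (B' := LinearMap.lsmul R P) (ψ := φ) (by simp),
        gradeInv_totalWedge, mapForms_zeroForm, gradeInv_zeroForm, sub_self]
  exact ⟨φ, fun x => sub_eq_zero.mp (LinearMap.congr_fun h2 x)⟩

/-- The pairing `(S, T) ↦ S ∘ φ ∘ T`. -/
def sandwich (φ : N →ₗ[R] P) : (P →ₗ[R] N) →ₗ[R] (P →ₗ[R] N) →ₗ[R] (P →ₗ[R] N) :=
  LinearMap.mk₂ R (fun S T => S ∘ₗ φ ∘ₗ T)
    (fun S S' T => by ext; simp) (fun c S T => by ext; simp)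
    (fun S T T' => by ext; simp) (fun c S T => by ext; simp)

/-- Precomposition with `φ`. -/
def precomp (φ : N →ₗ[R] P) : (P →ₗ[R] N) →ₗ[R] Module.End R N where
  toFun S := S ∘ₗ φ
  map_add' S T := by ext; simp
  map_smul' c S := by ext; simp

/-- Postcomposition with `φ`. -/
def postcomp (φ : N →ₗ[R] P) : (P →ₗ[R] N) →ₗ[R] Module.End R P where
  toFun S := φ ∘ₗ S
  map_add' S T := by ext; simp
  map_smul' c S := by ext; simp

/-- The form is z = ζ(φζ)^l, for which (ζφ)^(l+1) = zφ and (φζ)^(l+1) = φz. A single z serves both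
sides, which is what cyclicity of the trace requires. -/
theorem exists_curvaturePow_eq {k k' : ℕ} (hN : FrameSeparated R N k N)
    (hP : FrameSeparated R P k' P) (hdN : SquareZeroOn R L N) (hdP : SquareZeroOn R L P)
    {D : LinearConnection R L N} {D' : LinearConnection R L P} (φ : N →ₗ[R] P)
    (ζ : Forms R L (P →ₗ[R] N))
    (h : homog (2 * 1) (D.curvaturePow 1) = mapForms (precomp φ) ζ)
    (h' : homog (2 * 1) (D'.curvaturePow 1) = mapForms (postcomp φ) ζ) (l : ℕ) :
    ∃ z, homog (2 * (l + 1)) (D.curvaturePow (l + 1)) = mapForms (precomp φ) z ∧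
      homog (2 * (l + 1)) (D'.curvaturePow (l + 1)) = mapForms (postcomp φ) z := by
  induction l with
  | zero => exact ⟨ζ, h, h'⟩
  | succ l ih =>
    obtain ⟨z, h1, h2⟩ := ih
    refine ⟨totalWedge (sandwich φ) ζ z, ?_, ?_⟩
    · rw [curvaturePow_succ hN hdN, h1, h]
      exact (totalWedge_mapForms (fun _ _ => rfl) ζ z).symm
    · rw [curvaturePow_succ hP hdP, h2, h']
      exact (totalWedge_mapForms (fun _ _ => rfl) ζ z).symm

namespace TwoTermRepresentation

theorem leibniz_gradeInv (T : TwoTermRepresentation R L N P)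
    (θ : Forms R L R) (x : Forms R L N × Forms R L P) :
    T.D (wedgePair θ x) = wedgePair (dA R L θ) x + wedgePair (gradeInv θ) (T.D x) := by
  have hadd : ∀ (a b : Forms R L R) (y : Forms R L N × Forms R L P),
      wedgePair (a + b) y = wedgePair a y + wedgePair b y := by
    intro a b y
    simp [wedgePair]
  induction θ using Forms.induction with
  | h0 =>
    have h0 : ∀ y : Forms R L N × Forms R L P, wedgePair 0 y = 0 := fun y => by
      simp [wedgePair]
    simp [h0]
  | h2 a b ha hb => rw [hadd, map_add, ha, hb, map_add, map_add, hadd, hadd]; abel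
  | h1 s θ =>
    rw [T.leibniz, gradeInv_homog]
    simp [wedgePair]

theorem D_D (T : TwoTermRepresentation R L N P) (x : Forms R L N × Forms R L P) :
    T.D (T.D x) = 0 := LinearMap.congr_fun T.square_zero x

/-- Expand T.D(T.D(θ ∧ x)) = 0 by the Leibniz rule: the cross terms cancel, θ ∧ T.D(T.D x) vanishes,
and d_A² θ ∧ x remains. The Chern-Weil argument needs d_A² = 0 in this form only. -/
theorem wedgePair_dA_dA (T : TwoTermRepresentation R L N P)
    (θ : Forms R L R) (x : Forms R L N × Forms R L P) :
    wedgePair (dA R L (dA R L θ)) x = 0 := by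
  have h := T.D_D (wedgePair θ x)
  rw [leibniz_gradeInv, map_add, leibniz_gradeInv, leibniz_gradeInv, T.D_D, gradeInv_gradeInv,
    dA_gradeInv] at h
  simpa [wedgePair] using h

theorem squareZeroOn_left (T : TwoTermRepresentation R L N P) : SquareZeroOn R L N := fun x e =>
  congrArg Prod.fst (T.wedgePair_dA_dA x (zeroForm e, 0))

theorem squareZeroOn_right (T : TwoTermRepresentation R L N P) : SquareZeroOn R L P := fun x e =>
  congrArg Prod.snd (T.wedgePair_dA_dA x (0, zeroForm e))

theorem zeroForm_left_mem (e : N) : (zeroForm e, 0) ∈ totalDegree R L N P 0 :=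
  ⟨fun _ hs => homog_apply_ne _ hs.symm, fun _ _ => rfl⟩

theorem zeroForm_right_mem (e : P) : (0, zeroForm e) ∈ totalDegree R L N P 1 :=
  ⟨fun _ _ => rfl, fun s hs => homog_apply_ne _ fun h => hs (by omega)⟩

/-- The connections on `N` and `P` underlying a representation up to homotopy have curvatures
`ζ ∘ φ` and `φ ∘ ζ`. -/
theorem exists_connections (T : TwoTermRepresentation R L N P) {k k' : ℕ}
    (hN : FrameSeparated R N k N)
    (hP : FrameSeparated R P k' P) (hNP : FrameSeparated R N k P) :
    ∃ (D : LinearConnection R L N) (D' : LinearConnection R L P) (φ : N →ₗ[R] P)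
      (ζ : Forms R L (P →ₗ[R] N)),
      homog (2 * 1) (D.curvaturePow 1) = mapForms (precomp φ) ζ ∧
      homog (2 * 1) (D'.curvaturePow 1) = mapForms (postcomp φ) ζ := by
  have hleft := fun θ x => T.leibniz_gradeInv θ (x, 0)
  have hright := fun θ x => T.leibniz_gradeInv θ (0, x)
  simp only [wedgePair, map_zero] at hleft hright
  -- The diagonal components satisfy the Leibniz rule with the term d_A θ, so they are connections.
  -- That term is absent from the off-diagonal ones, which are tensorial.
  obtain ⟨D, hD⟩ := exists_totalD_eq hN
    (LinearMap.fst ℝ _ _ ∘ₗ T.D ∘ₗ LinearMap.inl ℝ (Forms R L N) (Forms R L P))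
    (fun θ x => congrArg Prod.fst (hleft θ x))
    (fun e => eq_homog_of_forall_ne (T.degree_one 0 _ (zeroForm_left_mem e)).1)
  obtain ⟨D', hD'⟩ := exists_totalD_eq hP
    (LinearMap.snd ℝ _ _ ∘ₗ T.D ∘ₗ LinearMap.inr ℝ (Forms R L N) (Forms R L P))
    (fun θ x => congrArg Prod.snd (hright θ x))
    -- A section of P has total degree 1, so its image has total degree 2 and a P-component of form
    -- degree 1.
    (fun e => eq_homog_of_forall_ne fun s hs =>
      (T.degree_one 1 _ (zeroForm_right_mem e)).2 s (by omega))
  obtain ⟨φ, hφ⟩ := exists_mapForms_eq hNP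
    (LinearMap.snd ℝ _ _ ∘ₗ T.D ∘ₗ LinearMap.inl ℝ (Forms R L N) (Forms R L P))
    (fun θ x => (congrArg Prod.snd (hleft θ x)).trans (by simp))
    (fun e => eq_homog_of_forall_ne fun s hs =>
      (T.degree_one 0 _ (zeroForm_left_mem e)).2 s (by omega))
  have hK : ∀ p : P, (T.D (0, zeroForm p)).1 = homog 2 ((T.D (0, zeroForm p)).1 2) := fun p =>
    eq_homog_of_forall_ne (T.degree_one 1 _ (zeroForm_right_mem p)).1
  -- The N-component of T.D on a section of P has form degree 2. The minus sign absorbs the one that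
  -- arises when T.D ∘ T.D = 0 is solved for the curvatures.
  let ζ : Form R L (P →ₗ[R] N) 2 :=
    { toFun := fun v =>
        { toFun := fun p => -(T.D (0, zeroForm p)).1 2 v
          map_add' := fun p q => by
            have : ((0 : Forms R L N), (zeroForm (p + q) : Forms R L P))
              = (0, zeroForm p) + (0, zeroForm q) := by simp
            rw [this, map_add]
            exact neg_add _ _
          map_smul' := fun f p => by
            have h := congrArg Prod.fst (hright (zeroForm f) (zeroForm p))
            rw [lsmul_wedge_zeroForm, ← zeroForm_smul, gradeInv_zeroForm] at h
            change _ = 0 + totalWedge _ _ _ at h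
            rw [h, zero_add, lsmul_wedge_zeroForm]
            exact (smul_neg f _).symm }
      map_update_add' := fun v i x y => LinearMap.ext fun p =>
        (congrArg Neg.neg (AlternatingMap.map_update_add _ v i x y)).trans (neg_add _ _)
      map_update_smul' := fun v i f x => LinearMap.ext fun p =>
        (congrArg Neg.neg (AlternatingMap.map_update_smul _ v i f x)).trans (smul_neg _ _).symm
      map_eq_zero_of_eq' := fun v i j h hij => LinearMap.ext fun p =>
        neg_eq_zero.mpr (AlternatingMap.map_eq_zero_of_eq _ v h hij) }
  have hζ : ∀ p, homog 2 ((LinearMap.applyₗ p).compAlternatingMap ζ)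
      = -(T.D (0, zeroForm p)).1 := by
    intro p
    rw [hK, ← map_neg]
    rfl
  refine ⟨D, D', φ, homog 2 ζ, eq_of_act_zeroForm fun e => ?_, eq_of_act_zeroForm fun p => ?_⟩
  · rw [act_curvaturePow_zeroForm, mul_one, pow_two, Module.End.mul_apply, act_zeroForm,
      mapForms_homog, mapForms_homog]
    -- The N-component of T.D(T.D e) = 0 is d_∇² e - ζ(φ e) = 0.
    have h1 := congrArg Prod.fst (T.D_D (zeroForm e, 0))
    have h2 : T.D (zeroForm e, 0) = (D.totalD (zeroForm e), 0) + (0, zeroForm (φ e)) := by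
      refine Prod.ext ?_ ?_
      · rw [hD]; simp
      · refine (hφ (zeroForm e)).trans ?_
        rw [mapForms_zeroForm, gradeInv_zeroForm]; simp
    rw [h2, map_add] at h1
    have h3 : D.totalD (D.totalD (zeroForm e)) = (T.D (D.totalD (zeroForm e), 0)).1 :=
      LinearMap.congr_fun hD _
    rw [h3]
    refine (eq_neg_of_add_eq_zero_left h1).trans ?_
    exact (hζ (φ e)).symm
  · rw [act_curvaturePow_zeroForm, mul_one, pow_two, Module.End.mul_apply, act_zeroForm,
      mapForms_homog, mapForms_homog]
    have h1 := congrArg Prod.snd (T.D_D (0, zeroForm p))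
    have h2 : T.D (0, zeroForm p) = ((T.D (0, zeroForm p)).1, 0) + (0, D'.totalD (zeroForm p)) := by
      refine Prod.ext ?_ ?_
      · simp
      · rw [hD']; simp
    rw [h2, map_add] at h1
    have h3 : D'.totalD (D'.totalD (zeroForm p)) = (T.D (0, D'.totalD (zeroForm p))).2 :=
      LinearMap.congr_fun hD' _
    -- The grading involution in front of φ disappears here since its argument is a 2-form.
    have h4 : (T.D ((T.D (0, zeroForm p)).1, 0)).2 = mapForms φ (T.D (0, zeroForm p)).1 := by
      have h5 : gradeInv (T.D (0, zeroForm p)).1 = (T.D (0, zeroForm p)).1 := by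
        rw [hK, gradeInv_homog, neg_one_sq, one_smul]
      refine (hφ _).trans ?_
      rw [gradeInv_mapForms, h5]
    rw [h3]
    refine (eq_neg_of_add_eq_zero_right h1).trans ?_
    rw [h4, ← map_neg, ← hζ, mapForms_homog]
    rfl

end TwoTermRepresentation
end Representation

/-! ### Coefficients of the determinant in terms of traces of powers -/

section NewtonIdentities
open Polynomial

theorem card_roots_charpoly {k : ℕ} (Y : Matrix (Fin k) (Fin k) ℂ) :
    Multiset.card Y.charpoly.roots = k := by
  rw [(splits_iff_card_roots.mp (IsAlgClosed.splits Y.charpoly)), Y.charpoly_natDegree_eq_dim,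
    Fintype.card_fin]

/-- Split f into linear factors over ℂ: the determinant is multiplicative and det(Y - r) is the
product of z - r over the eigenvalues z of Y. -/
theorem det_aeval_eq_prod_roots {k : ℕ} (Y : Matrix (Fin k) (Fin k) ℂ) {f : ℂ[X]} (hf : f.Monic) :
    (aeval Y f).det = (Y.charpoly.roots.map fun z => f.eval z).prod := by
  have hp : ∀ r : ℂ, (Y - algebraMap ℂ _ r).det = (Y.charpoly.roots.map fun z => z - r).prod := by
    intro r
    have h1 : (algebraMap ℂ (Matrix (Fin k) (Fin k) ℂ) r - Y).det = Y.charpoly.eval r := by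
      rw [Matrix.eval_charpoly]; rfl
    have h2 : Y.charpoly.eval r = (Y.charpoly.roots.map fun z => r - z).prod := by
      conv_lhs => rw [(IsAlgClosed.splits Y.charpoly).eq_prod_roots_of_monic Y.charpoly_monic]
      rw [eval_multiset_prod, Multiset.map_map]
      simp
    rw [← neg_sub, Matrix.det_neg, h1, h2, Fintype.card_fin]
    have h3 : ∀ s : Multiset ℂ, (-1) ^ Multiset.card s * (s.map fun z => r - z).prod
        = (s.map fun z => z - r).prod := by
      intro s
      induction s using Multiset.induction with
      | empty => simp
      | cons a s ih =>
        rw [Multiset.card_cons, Multiset.map_cons, Multiset.map_cons, Multiset.prod_cons,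
          Multiset.prod_cons, ← ih, pow_succ]
        ring
    have h4 := h3 Y.charpoly.roots
    rwa [card_roots_charpoly] at h4
  have hfac := (IsAlgClosed.splits f).eq_prod_roots_of_monic hf
  have key : ∀ s : Multiset ℂ, (aeval Y (s.map fun r => X - C r).prod).det
      = (Y.charpoly.roots.map fun z => (s.map fun r => X - C r).prod.eval z).prod := by
    intro s
    induction s using Multiset.induction with
    | empty => simp
    | cons a s ih =>
      simp only [Multiset.map_cons, Multiset.prod_cons, map_mul, Matrix.det_mul, ih, eval_mul,
        Multiset.prod_map_mul, map_sub, aeval_X, aeval_C, hp, eval_sub, eval_X, eval_C]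
  rw [hfac]
  exact key _

/-- Applying the product formula to X^n - r, for every r, shows that the eigenvalues of Y^n with
multiplicity are the n-th powers of those of Y. -/
theorem trace_pow_eq_sum_roots {k : ℕ} (Y : Matrix (Fin k) (Fin k) ℂ) (n : ℕ) (hn : n ≠ 0) :
    (Y ^ n).trace = (Y.charpoly.roots.map fun z => z ^ n).sum := by
  have hcard := card_roots_charpoly Y
  have h : (Y ^ n).charpoly
      = ((Y.charpoly.roots.map fun z => z ^ n).map fun z => X - C z).prod := by
    refine Polynomial.funext fun r => ?_
    have h1 := det_aeval_eq_prod_roots Y (monic_X_pow_sub_C r hn)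
    have h3 : ∀ s : Multiset ℂ, (-1) ^ Multiset.card s * (s.map fun z => z ^ n - r).prod
        = (s.map fun z => r - z ^ n).prod := by
      intro s
      induction s using Multiset.induction with
      | empty => simp
      | cons a s ih =>
        rw [Multiset.card_cons, Multiset.map_cons, Multiset.map_cons, Multiset.prod_cons,
          Multiset.prod_cons, ← ih, pow_succ]
        ring
    have h2 : (Y ^ n).charpoly.eval r = (-1) ^ k * (aeval Y (X ^ n - C r)).det := by
      rw [Matrix.eval_charpoly, map_sub, map_pow, aeval_X, aeval_C, ← neg_sub, Matrix.det_neg,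
        Fintype.card_fin]
      rfl
    rw [h2, h1, eval_multiset_prod, Multiset.map_map, Multiset.map_map]
    simp only [eval_sub, eval_pow, eval_X, eval_C, Function.comp_apply]
    rw [← h3, hcard]
  rw [Matrix.trace_eq_sum_roots_charpoly, h, roots_multiset_prod_X_sub_C]

/-- det(λ + Y) is the characteristic polynomial of -Y, so Vieta's formulas apply. For j > k the
convention f_j = 0 matches the empty elementary symmetric sum. -/
theorem detCoeff_eq_esymm {k : ℕ} (j : ℕ) (Y : Matrix (Fin k) (Fin k) ℂ) :
    detCoeff j Y = (-1) ^ j * (-Y).charpoly.roots.esymm j := by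
  have hcard := card_roots_charpoly (-Y)
  have h : Matrix.det (Matrix.scalar (Fin k) (Polynomial.X : Polynomial ℂ) + Y.map Polynomial.C)
      = (-Y).charpoly := by
    rw [Matrix.charpoly, Matrix.charmatrix, map_neg, sub_neg_eq_add]
    rfl
  rw [detCoeff]
  split_ifs with hj
  · have hdeg : (-Y).charpoly.natDegree = k := by
      rw [Matrix.charpoly_natDegree_eq_dim, Fintype.card_fin]
    rw [h, coeff_eq_esymm_roots_of_splits (IsAlgClosed.splits _) (by omega),
      (Matrix.charpoly_monic _).leadingCoeff, one_mul, hdeg, Nat.sub_sub_self hj]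
  · rw [Multiset.esymm, Multiset.powersetCard_eq_empty _ (by omega)]
    simp

theorem exists_fin_map_eq {α : Type*} {k : ℕ} (s : Multiset α) (h : Multiset.card s = k) :
    ∃ z : Fin k → α, Finset.univ.val.map z = s := by
  subst h
  induction s using Quotient.inductionOn with
  | h l => exact ⟨l.get, (Fin.univ_val_map _).trans (congrArg _ (List.ofFn_get l))⟩

theorem detCoeff_zero {k : ℕ} (Y : Matrix (Fin k) (Fin k) ℂ) : detCoeff 0 Y = 1 := by
  rw [detCoeff_eq_esymm]
  simp [Multiset.esymm]

/-- Newton's identities for the coefficients of `det (λ I + Y)`. -/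
theorem mul_detCoeff {k : ℕ} (j : ℕ) (Y : Matrix (Fin k) (Fin k) ℂ) :
    (j : ℂ) * detCoeff j Y
      = -∑ a ∈ Finset.range j, detCoeff a Y * ((-Y) ^ (j - a)).trace := by
  have hcard := card_roots_charpoly (-Y)
  -- Indexing the eigenvalues of -Y by `Fin k` allows Newton's identity for polynomials in k
  -- variables to be evaluated at them.
  obtain ⟨z, hz⟩ := exists_fin_map_eq _ hcard
  have h := congrArg (MvPolynomial.aeval z) (MvPolynomial.mul_esymm_eq_sum (Fin k) ℂ j)
  have hs : ∀ a, MvPolynomial.aeval z (MvPolynomial.esymm (Fin k) ℂ a)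
      = (-1) ^ a * detCoeff a Y := by
    intro a
    rw [MvPolynomial.aeval_esymm_eq_multiset_esymm, hz, detCoeff_eq_esymm, ← mul_assoc, ← pow_add,
      ← two_mul, pow_mul, neg_one_sq, one_pow, one_mul]
  have hp : ∀ b, b ≠ 0 → MvPolynomial.aeval z (MvPolynomial.psum (Fin k) ℂ b)
      = ((-Y) ^ b).trace := by
    intro b hb
    rw [trace_pow_eq_sum_roots _ b hb, ← hz, Multiset.map_map]
    simp [MvPolynomial.psum, List.sum_ofFn]
  simp only [map_mul, map_sum, map_natCast, map_pow, map_neg, map_one, hs] at h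
  have hsum : ∑ x ∈ Finset.HasAntidiagonal.antidiagonal j with x.1 < j,
      (-1) ^ x.1 * ((-1) ^ x.1 * detCoeff x.1 Y) *
      MvPolynomial.aeval z (MvPolynomial.psum (Fin k) ℂ x.2)
      = ∑ a ∈ Finset.range j, detCoeff a Y * ((-Y) ^ (j - a)).trace := by
    symm
    refine Finset.sum_bij (fun a _ => (a, j - a)) ?_ ?_ ?_ ?_
    · intro a ha
      have := Finset.mem_range.mp ha
      simp only [Finset.mem_filter, Finset.HasAntidiagonal.mem_antidiagonal]
      omega
    · intro a _ b _ hab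
      exact congrArg Prod.fst hab
    · rintro ⟨a, b⟩ hab
      simp only [Finset.mem_filter, Finset.HasAntidiagonal.mem_antidiagonal] at hab
      exact ⟨a, Finset.mem_range.mpr hab.2, by ext <;> simp; omega⟩
    · intro a ha
      have := Finset.mem_range.mp ha
      rw [hp _ (by omega), ← mul_assoc ((-1) ^ a), ← pow_add, ← two_mul, pow_mul, neg_one_sq,
        one_pow, one_mul]
  rw [hsum] at h
  have h1 : ((-1 : ℂ) ^ j) * (-1) ^ j = 1 := by
    rw [← pow_add, ← two_mul, pow_mul, neg_one_sq, one_pow]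
  linear_combination ((-1) ^ j) * h - (j * detCoeff j Y
    + ∑ a ∈ Finset.range j, detCoeff a Y * ((-Y) ^ (j - a)).trace) * h1

/-- The polynomial in the traces of powers that computes the coefficients of `det (λ I - X)`. -/
def newtonPoly : ℕ → FreeAlgebra ℝ ℕ
  | 0 => 1
  | j + 1 => (-(1 / (j + 1 : ℝ))) • ∑ a : Fin (j + 1), newtonPoly a * FreeAlgebra.ι ℝ (j - a)

/-- Strong induction by Newton's identities. The scalar comes out as (-c)^j by homogeneity, leaving
a real polynomial. The variable of index n stands for tr X^(n+1), so index j - a matches the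
exponent j + 1 - a. -/
theorem detCoeff_smul_eq_newtonPoly {k : ℕ} (c : ℂ) (X : Matrix (Fin k) (Fin k) ℝ) (j : ℕ) :
    detCoeff j (c • X.map (fun r : ℝ => (r : ℂ)))
      = (-c) ^ j * (FreeAlgebra.lift ℝ (fun n : ℕ => (X ^ (n + 1)).trace) (newtonPoly j) : ℝ) := by
  induction j using Nat.strong_induction_on with
  | _ j ih =>
    rcases j with _ | j
    · rw [detCoeff_zero, newtonPoly]; simp
    · have ht : ∀ n, ((-(c • X.map (fun r : ℝ => (r : ℂ)))) ^ n).trace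
          = (-c) ^ n * ((X ^ n).trace : ℝ) := by
        intro n
        have : (X.map (fun r : ℝ => (r : ℂ))) ^ n = (X ^ n).map (fun r : ℝ => (r : ℂ)) :=
          (map_pow (Complex.ofRealHom.mapMatrix (m := Fin k)) X n).symm
        rw [← neg_smul, _root_.smul_pow, Matrix.trace_smul, this, smul_eq_mul]
        congr 1
        simp [Matrix.trace]
      have h := mul_detCoeff (j + 1) (c • X.map (fun r : ℝ => (r : ℂ)))
      have h2 : ∑ a ∈ Finset.range (j + 1), detCoeff a (c • X.map (fun r : ℝ => (r : ℂ))) *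
          ((-(c • X.map (fun r : ℝ => (r : ℂ)))) ^ (j + 1 - a)).trace
          = (-c) ^ (j + 1) * ∑ a : Fin (j + 1),
            ((FreeAlgebra.lift ℝ (fun n : ℕ => (X ^ (n + 1)).trace) (newtonPoly a) : ℝ) : ℂ)
              * (((X ^ (j - a + 1)).trace : ℝ) : ℂ) := by
        rw [Finset.sum_range, Finset.mul_sum]
        refine Finset.sum_congr rfl fun a _ => ?_
        rw [ih a a.2, ht, show j + 1 - (a : ℕ) = j - a + 1 by omega]
        have : (-c) ^ (j + 1) = (-c) ^ (a : ℕ) * (-c) ^ (j - (a : ℕ) + 1) := by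
          rw [← pow_add]; congr 1; omega
        rw [this]
        ring
      rw [h2] at h
      have hj : ((j : ℂ) + 1) ≠ 0 := Nat.cast_add_one_ne_zero j
      rw [newtonPoly, map_smul, map_sum]
      simp only [map_mul, FreeAlgebra.lift_ι_apply, smul_eq_mul]
      push_cast at h ⊢
      field_simp
      linear_combination h

/-- The polynomial does not involve k, so it serves bundles of different ranks. The scalar is
(√-1/2π)^(2i), real because the exponent is even. -/
theorem expressesDetCoeff_newtonPoly (k i : ℕ) :
    ExpressesDetCoeff k (2 * i)
      (((-1) ^ i * (1 / (2 * Real.pi)) ^ (2 * i) : ℝ) • newtonPoly (2 * i)) := by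
  intro X
  rw [detCoeff_smul_eq_newtonPoly, map_smul, smul_eq_mul, Complex.ofReal_mul]
  congr 1
  push_cast
  rw [Even.neg_pow (even_two_mul i), div_pow, div_pow, pow_mul Complex.I, Complex.I_sq, one_pow,
    mul_one_div]

theorem lift_trace_pow_mapMatrix {k : ℕ} {S T : Type*} [CommRing S] [Algebra ℝ S] [Ring T]
    [Algebra ℝ T] (f : S →ₐ[ℝ] T) (X : Matrix (Fin k) (Fin k) S) (q : FreeAlgebra ℝ ℕ) :
    FreeAlgebra.lift ℝ (fun n : ℕ => ((f.mapMatrix X) ^ (n + 1)).trace) q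
      = f (FreeAlgebra.lift ℝ (fun n : ℕ => (X ^ (n + 1)).trace) q) := by
  rw [← AlgHom.comp_apply]
  congr 1
  refine FreeAlgebra.hom_ext (funext fun n => ?_)
  have h : (f.mapMatrix X) ^ (n + 1) = f.mapMatrix (X ^ (n + 1)) := (map_pow _ _ _).symm
  simp only [Function.comp_apply, FreeAlgebra.lift_ι_apply, AlgHom.comp_apply, h]
  simp [Matrix.trace]

/-- A polynomial identity between traces of powers of real matrices holds for matrices with
entries in any commutative algebra. -/
theorem lift_trace_pow_eq_zero {k : ℕ} {q : FreeAlgebra ℝ ℕ}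
    (hq : ∀ X : Matrix (Fin k) (Fin k) ℝ,
      FreeAlgebra.lift ℝ (fun n : ℕ => (X ^ (n + 1)).trace) q = 0)
    {S : Type*} [CommRing S] [Algebra ℝ S] (X : Matrix (Fin k) (Fin k) S) :
    FreeAlgebra.lift ℝ (fun n : ℕ => (X ^ (n + 1)).trace) q = 0 := by
  -- For the generic matrix the identity is one of real polynomials, which are determined by their
  -- values at real points; any matrix is a specialisation of the generic one.
  have h : FreeAlgebra.lift ℝ (fun n : ℕ =>
      (Matrix.mvPolynomialX (Fin k) (Fin k) ℝ ^ (n + 1)).trace) q = 0 := by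
    refine MvPolynomial.funext fun x => ?_
    rw [map_zero, ← MvPolynomial.coe_aeval_eq_eval, RingHom.coe_coe, ← lift_trace_pow_mapMatrix, hq]
  rw [← Matrix.mvPolynomialX_mapMatrix_aeval ℝ X, lift_trace_pow_mapMatrix, h, map_zero]

open scoped IsMulCommutative in
/-- A polynomial identity between traces of powers of real matrices holds for matrices with
commuting entries in any algebra. -/
theorem lift_trace_pow_eq_zero_of_commute {k : ℕ} {q : FreeAlgebra ℝ ℕ}
    (hq : ∀ X : Matrix (Fin k) (Fin k) ℝ,
      FreeAlgebra.lift ℝ (fun n : ℕ => (X ^ (n + 1)).trace) q = 0)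
    {S : Type*} [Ring S] [Algebra ℝ S] (X : Matrix (Fin k) (Fin k) S)
    (hX : ∀ i j i' j', X i j * X i' j' = X i' j' * X i j) :
    FreeAlgebra.lift ℝ (fun n : ℕ => (X ^ (n + 1)).trace) q = 0 := by
  let s : Set S := Set.range fun p : Fin k × Fin k => X p.1 p.2
  -- Commuting entries generate a commutative subalgebra, in which the commutative case applies.
  have := Algebra.isMulCommutative_adjoin ℝ (s := s) (by
    rintro _ ⟨p, rfl⟩ _ ⟨p', rfl⟩
    exact hX _ _ _ _)
  let Y : Matrix (Fin k) (Fin k) (Algebra.adjoin ℝ s) := fun i j =>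
    ⟨X i j, Algebra.subset_adjoin ⟨(i, j), rfl⟩⟩
  have h := lift_trace_pow_mapMatrix (Algebra.adjoin ℝ s).val Y q
  rw [lift_trace_pow_eq_zero hq Y, map_zero] at h
  exact h

end NewtonIdentities

/-! ### The matrix of curvature 2-forms in a frame -/

section FrameMatrix
variable {R L N P : Type*} [CommRing R] [Algebra ℝ R]
  [LieRing L] [LieAlgebra ℝ L] [Module R L] [LieRingModule L R] [LieRinehartRing R L]
  [LieRinehartAlgebra ℝ R L]
  [AddCommGroup N] [Module ℝ N] [Module R N] [IsScalarTower ℝ R N]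
  [AddCommGroup P] [Module ℝ P] [Module R P] [IsScalarTower ℝ R P]

/-- Interchanging two blocks of two arguments is an even permutation. -/
theorem homog_two_mul_comm (α β : Form R L R 2) :
    homog 2 α * homog 2 β = homog 2 β * homog 2 α := by
  let τ : Equiv.Perm (Fin (2 + 2)) := finAddFlip
  have hτ : Equiv.Perm.sign τ = 1 := by decide
  rw [mul_def, mul_def, totalWedge_homog, totalWedge_homog]
  congr 1
  ext v
  rw [wedge_eq_Alt', wedge_eq_Alt']
  congr 1
  rw [← one_smul ℤˣ (Alt (tensorFun _ α β) v), ← hτ, ← Alt_domPerm]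
  congr 1
  funext w
  have h1 : (w ∘ τ) ∘ Fin.castAdd 2 = w ∘ Fin.natAdd 2 := by
    funext i; exact congrArg w (finAddFlip_apply_castAdd i 2)
  have h2 : (w ∘ τ) ∘ Fin.natAdd 2 = w ∘ Fin.castAdd 2 := by
    funext i; exact congrArg w (finAddFlip_apply_natAdd i 2)
  simp only [tensorFun, pairingHom_apply, h1, h2, LinearMap.mul_apply']
  exact mul_comm _ _

theorem mapForms_id (x : Forms R L N) : mapForms LinearMap.id x = x := by
  induction x using Forms.induction with
  | h0 => simp
  | h2 a b ha hb => simp only [map_add, ha, hb]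
  | h1 s θ => rw [mapForms_homog]; rfl

theorem smul_mapForms_eq_sum {ι : Type*} [Fintype ι] {ρ : R} {φ : N →ₗ[R] P} {ψ : ι → N →ₗ[R] P}
    (h : ∀ e, ρ • φ e = ∑ i, ψ i e) (x : Forms R L N) :
    ρ • mapForms φ x = ∑ i, mapForms (ψ i) x := by
  induction x using Forms.induction with
  | h0 => simp
  | h2 a b ha hb => simp only [map_add, smul_add, ha, hb, Finset.sum_add_distrib]
  | h1 s θ =>
    simp only [mapForms_homog]
    rw [← map_sum, ← homog_smul]
    congr 1
    ext v
    refine (h (θ v)).trans (Eq.symm ?_)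
    let ev : Form R L P s →+ P := AddMonoidHom.mk' (fun α => α v) fun _ _ => rfl
    exact map_sum ev _ _

/-- The matrix entry `c (T s)` of an endomorphism. -/
def matrixEntry (c : Module.Dual R N) (s : N) : Module.End R N →ₗ[R] R :=
  c ∘ₗ LinearMap.applyₗ s

/-- The sum over j inserts ∑ s_j c_j between x and y. This is ρ rather than the identity, so each
matrix multiplication costs one factor ρ. -/
theorem sum_matrixEntry_mul {k : ℕ} {ρ : R} {s : Fin k → N} {c : Fin k → Module.Dual R N}
    (h : ∀ e, ρ • e = ∑ i, c i e • s i) (x y : Forms R L (Module.End R N)) (i l : Fin k) :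
    ∑ j, mapForms (matrixEntry (c i) (s j)) x * mapForms (matrixEntry (c j) (s l)) y
      = ρ • mapForms (matrixEntry (c i) (s l)) (endWedge x y) := by
  have h1 : ∀ j, mapForms (matrixEntry (c i) (s j)) x * mapForms (matrixEntry (c j) (s l)) y
      = mapForms (matrixEntry (c i) (s l))
        (endWedge x (mapForms (postcomp ((c j).smulRight (s j))) y)) := by
    intro j
    have h2 := mapForms_totalWedge_right (B := sandwich ((c j).smulRight (s j)))
      (B' := LinearMap.mul R (Module.End R N)) (ψ := postcomp ((c j).smulRight (s j)))
      (χ := LinearMap.id) (fun S T => rfl) x y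
    rw [mapForms_id] at h2
    rw [← h2]
    refine (totalWedge_mapForms (fun S T => ?_) x y).symm
    change c i (S (c j (T (s l)) • s j)) = c i (S (s j)) * c j (T (s l))
    rw [map_smul, map_smul, smul_eq_mul, mul_comm]
  rw [Finset.sum_congr rfl fun j _ => h1 j, ← map_sum, ← map_sum, ← mapForms_smul,
    ← totalWedge_smul_right]
  congr 2
  rw [← smul_mapForms_eq_sum (φ := LinearMap.id) (fun T => ?_), mapForms_id]
  refine LinearMap.ext fun e => (h (T e)).trans ?_
  rw [LinearMap.sum_apply]
  rfl

theorem matrix_pow_curvature {k : ℕ} (hsep : FrameSeparated R N k N) (hd : SquareZeroOn R L N)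
    (D : LinearConnection R L N) {ρ : R} {s : Fin k → N} {c : Fin k → Module.Dual R N}
    (h : ∀ e, ρ • e = ∑ i, c i e • s i) (n : ℕ) (i l : Fin k) :
    ((Matrix.of fun i j => mapForms (matrixEntry (c i) (s j))
      (homog (2 * 1) (D.curvaturePow 1))) ^ (n + 1)) i l
      = ρ ^ n • mapForms (matrixEntry (c i) (s l))
        (homog (2 * (n + 1)) (D.curvaturePow (n + 1))) := by
  induction n generalizing i l with
  | zero => rw [zero_add, pow_one, pow_zero, one_smul]; rfl
  | succ n ih =>
    rw [pow_succ', Matrix.mul_apply]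
    simp only [ih, Matrix.of_apply]
    rw [curvaturePow_succ hsep hd D (n + 1), pow_succ, mul_smul, ← sum_matrixEntry_mul h,
      Finset.smul_sum]
    exact Finset.sum_congr rfl fun j _ => totalWedge_smul_right _ _ _ _

/-- The n matrix multiplications give ρ^n, and taking the trace gives one more factor, because ∑
c_i(T s_i) = ρ tr T. -/
theorem IsRankOneTrace.trace_pow_curvature {tr : Module.Dual R (Module.End R N)}
    (htr : IsRankOneTrace tr) {k : ℕ} (hsep : FrameSeparated R N k N) (hd : SquareZeroOn R L N)
    (D : LinearConnection R L N) {ρ : R} {s : Fin k → N} {c : Fin k → Module.Dual R N}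
    (h : ∀ e, ρ • e = ∑ i, c i e • s i) (n : ℕ) :
    ((Matrix.of fun i j => mapForms (matrixEntry (c i) (s j))
      (homog (2 * 1) (D.curvaturePow 1))) ^ (n + 1)).trace = ρ ^ (n + 1) • traceForm tr D (n + 1) := by
  rw [Matrix.trace, traceForm_eq_mapForms, pow_succ ρ, mul_smul,
    smul_mapForms_eq_sum (ψ := fun i => matrixEntry (c i) (s i)), Finset.smul_sum]
  · exact Finset.sum_congr rfl fun i _ => matrix_pow_curvature hsep hd D h n i i
  · intro T
    have h1 : ρ • T = ∑ i, (c i ∘ₗ T).smulRight (s i) := by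
      ext e
      simpa using h (T e)
    rw [← map_smul, h1, map_sum]
    exact Finset.sum_congr rfl fun i _ => htr _ _

/-- The map that multiplies `s`-forms by `ρ ^ s`. -/
def scale (ρ : R) : Forms R L N →ₗ[ℝ] Forms R L N :=
  DirectSum.toModule ℝ ℕ _ fun s =>
    { toFun := fun θ => ρ ^ s • homog s θ
      map_add' := fun a b => by rw [map_add, smul_add]
      map_smul' := fun a b => by rw [map_smul, smul_comm]; rfl }

theorem scale_homog (ρ : R) (s : ℕ) (θ : Form R L N s) :
    scale ρ (homog s θ) = ρ ^ s • homog s θ :=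
  DirectSum.toModule_lof ..

theorem scale_apply (ρ : R) (x : Forms R L N) (s : ℕ) (v : Fin s → L) :
    scale ρ x s v = ρ ^ s • x s v := by
  induction x using Forms.induction with
  | h0 => rw [map_zero]; exact (smul_zero _).symm
  | h2 a b ha hb => rw [map_add]; exact (congrArg₂ (· + ·) ha hb).trans (smul_add _ _ _).symm
  | h1 t θ =>
    rw [scale_homog, ← homog_smul]
    rcases eq_or_ne t s with rfl | h
    · rw [homog_apply_self, homog_apply_self]; rfl
    · rw [homog_apply_ne _ h, homog_apply_ne _ h]; exact (smul_zero _).symm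

/-- The algebra endomorphism that multiplies `s`-forms by `ρ ^ s`. -/
def scaleHom (ρ : R) : Forms R L R →ₐ[ℝ] Forms R L R :=
  AlgHom.ofLinearMap (scale ρ)
    (by
      rw [one_def]
      exact (scale_homog ρ 0 _).trans (by rw [pow_zero, one_smul]; rfl))
    (fun x y => by
      induction x using Forms.induction with
      | h0 => simp
      | h2 a b ha hb => rw [add_mul, map_add, ha, hb, map_add, add_mul]
      | h1 p α =>
        induction y using Forms.induction with
        | h0 => simp
        | h2 a b ha hb => rw [mul_add, map_add, ha, hb, map_add, mul_add]
        | h1 q β =>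
          rw [mul_def, mul_def, totalWedge_homog, scale_homog, scale_homog, scale_homog,
            totalWedge_smul_left, totalWedge_smul_right, totalWedge_homog, smul_smul, ← pow_add])

/-- With ρ² in place of ρ, the n-th trace is multiplied by ρ^(2n), a power given by the degree of tr
R^n. The scaling is then the algebra endomorphism `scaleHom ρ`, which commutes with evaluation of q.
-/
theorem IsFramed.mul_self {k : ℕ} {ρ : R} (h : IsFramed R N k ρ) : IsFramed R N k (ρ * ρ) := by
  obtain ⟨s, c, hc⟩ := h
  refine ⟨fun i => ρ • s i, c, fun e => ?_⟩
  rw [mul_smul, hc e, Finset.smul_sum]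
  exact Finset.sum_congr rfl fun i _ => smul_comm _ _ _

/-- A polynomial identity between the traces of powers of real matrices holds for the trace forms
of a connection. -/
theorem IsRankOneTrace.lift_traceForm_eq_zero [IsReduced R] {tr : Module.Dual R (Module.End R N)}
    (htr : IsRankOneTrace tr) {k : ℕ} (hR : FrameSeparated R N k R) (hN : FrameSeparated R N k N)
    (hd : SquareZeroOn R L N) (D : LinearConnection R L N) {q : FreeAlgebra ℝ ℕ}
    (hq : ∀ X : Matrix (Fin k) (Fin k) ℝ,
      FreeAlgebra.lift ℝ (fun n : ℕ => (X ^ (n + 1)).trace) q = 0) :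
    FreeAlgebra.lift ℝ (fun n => traceForm tr D (n + 1)) q = 0 := by
  refine DFinsupp.ext fun s => AlternatingMap.ext fun v => hR _ fun ρ hρ => ?_
  have h0 : scaleHom ρ (FreeAlgebra.lift ℝ (fun n => traceForm tr D (n + 1)) q) = 0 := by
    obtain ⟨s, c, hc⟩ := hρ.mul_self
    have h1 : ∀ n, (scaleHom ρ : Forms R L R →ₐ[ℝ] Forms R L R) (traceForm tr D (n + 1))
        = ((Matrix.of fun i j => mapForms (matrixEntry (c i) (s j))
          (homog (2 * 1) (D.curvaturePow 1))) ^ (n + 1)).trace := by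
      intro n
      rw [htr.trace_pow_curvature hN hd D hc, ← pow_two, ← pow_mul]
      exact scale_homog _ _ _
    have h2 : (scaleHom ρ).comp (FreeAlgebra.lift ℝ (fun n => traceForm tr D (n + 1)))
        = FreeAlgebra.lift ℝ (fun n => ((Matrix.of fun i j => mapForms (matrixEntry (c i) (s j))
          (homog (2 * 1) (D.curvaturePow 1))) ^ (n + 1)).trace) := by
      refine FreeAlgebra.hom_ext (funext fun n => ?_)
      simp only [Function.comp_apply, AlgHom.comp_apply, FreeAlgebra.lift_ι_apply]
      exact h1 n
    refine (AlgHom.congr_fun h2 q).trans (lift_trace_pow_eq_zero_of_commute hq _ ?_)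
    intro i j i' j'
    simp only [Matrix.of_apply, mapForms_homog]
    exact homog_two_mul_comm _ _
  have h1 := congrArg (fun z : Forms R L R => z s v) h0
  have h2 : ρ ^ s • (FreeAlgebra.lift ℝ (fun n => traceForm tr D (n + 1)) q) s v = 0 :=
    (scale_apply ρ _ s v).symm.trans h1
  rw [smul_eq_mul] at h2 ⊢
  -- What is known is ρ^s z = 0, whereas separation requires ρz = 0. The power (ρz)^(s+1) contains
  -- the factor ρ^s z, also when s = 0, and R is reduced.
  refine IsReduced.eq_zero _ ⟨s + 1, ?_⟩
  rw [show ∀ z : R, (ρ * z) ^ (s + 1) = (ρ ^ s * z) * (ρ * z ^ s) by intro z; ring, h2, zero_mul]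

end FrameMatrix

/-! ### Characteristic classes in cohomology -/

section ClassesOfConnections
variable {R L N P : Type*} [CommRing R] [Algebra ℝ R]
  [LieRing L] [LieAlgebra ℝ L] [Module R L] [LieRingModule L R] [LieRinehartRing R L]
  [LieRinehartAlgebra ℝ R L]
  [AddCommGroup N] [Module ℝ N] [Module R N] [IsScalarTower ℝ R N]
  [AddCommGroup P] [Module ℝ P] [Module R P] [IsScalarTower ℝ R P]

theorem IsClassOf.eq_of_dA_eq_sub {x x' y : Forms R L R} {c c' : Cohomology R L}
    (h : IsClassOf x c) (h' : IsClassOf x' c') (hy : dA R L y = x' - x) : c = c' := by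
  obtain ⟨hx, rfl⟩ := h
  obtain ⟨hx', rfl⟩ := h'
  exact (Ideal.Quotient.eq.mpr (show _ ∈ exactForms R L from Exists.intro y hy)).symm

/-- Evaluation of a polynomial at closed forms takes place in the subalgebra of closed forms, and
the quotient map to cohomology is an algebra homomorphism. -/
theorem lift_eq_lift_of_isClassOf {x : ℕ → Forms R L R} {σ : ℕ → Cohomology R L}
    (h : ∀ n, IsClassOf (x n) (σ n)) {q q' : FreeAlgebra ℝ ℕ}
    (hq : FreeAlgebra.lift ℝ x q = FreeAlgebra.lift ℝ x q') :
    FreeAlgebra.lift ℝ σ q = FreeAlgebra.lift ℝ σ q' := by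
  choose hx hσ using h
  let y : ℕ → closedForms R L := fun n => ⟨x n, hx n⟩
  have h1 : (closedForms R L).val.comp (FreeAlgebra.lift ℝ y) = FreeAlgebra.lift ℝ x :=
    FreeAlgebra.hom_ext (funext fun n => by simp [y])
  have h2 : (Ideal.Quotient.mkₐ ℝ (exactForms R L)).comp (FreeAlgebra.lift ℝ y)
      = FreeAlgebra.lift ℝ σ :=
    FreeAlgebra.hom_ext (funext fun n => by simp [y, hσ])
  have h3 : FreeAlgebra.lift ℝ y q = FreeAlgebra.lift ℝ y q' := by
    refine Subtype.ext ?_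
    exact (AlgHom.congr_fun h1 q).trans (hq.trans (AlgHom.congr_fun h1 q').symm)
  rw [← h2, AlgHom.comp_apply, AlgHom.comp_apply, h3]

variable {tr : Module.Dual R (Module.End R N)} {tr' : Module.Dual R (Module.End R P)} {k k' : ℕ}

/-- The characters do not depend on the connection. -/
theorem IsRankOneTrace.isTraceCharacter_iff (htr : IsRankOneTrace tr)
    (hR : FrameSeparated R N k R) (hN : FrameSeparated R N k N) (hd : SquareZeroOn R L N)
    {D : LinearConnection R L N} {l : ℕ} {c : Cohomology R L} (hc : IsClassOf (traceForm tr D l) c)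
    (c' : Cohomology R L) : IsTraceCharacter tr l c' ↔ c' = c := by
  refine ⟨fun ⟨D', h⟩ => ?_, fun h => ⟨D, h ▸ hc⟩⟩
  obtain ⟨y, hy⟩ := htr.exists_dA_eq_sub hR hN hd D' D l
  exact h.eq_of_dA_eq_sub hc hy

/-- The classes of the determinant coefficients depend neither on the connection nor on the way
they are expressed by traces of powers. -/
theorem IsRankOneTrace.isDetClass_iff [IsReduced R] (htr : IsRankOneTrace tr)
    (hR : FrameSeparated R N k R) (hN : FrameSeparated R N k N) (hd : SquareZeroOn R L N)
    {D : LinearConnection R L N} {σ : ℕ → Cohomology R L}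
    (hσ : ∀ n, IsClassOf (traceForm tr D (n + 1)) (σ n)) {i : ℕ} {q : FreeAlgebra ℝ ℕ}
    (hq : ExpressesDetCoeff k (2 * i) q) (c : Cohomology R L) :
    IsDetClass tr k i c ↔ c = FreeAlgebra.lift ℝ σ q := by
  refine ⟨fun ⟨D', σ', q', hσ', hq', hc⟩ => ?_, fun h => ⟨D, σ, q, hσ, hq, h⟩⟩
  have h1 : σ' = σ := funext fun n =>
    (htr.isTraceCharacter_iff hR hN hd (hσ n) _).mp ⟨D', hσ' n⟩
  rw [hc, h1]
  refine lift_eq_lift_of_isClassOf hσ ?_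
  rw [← sub_eq_zero, ← map_sub]
  -- Both polynomials compute the same coefficient on real matrices, so their difference is a trace
  -- identity.
  refine htr.lift_traceForm_eq_zero hR hN hd D fun X => ?_
  rw [map_sub, sub_eq_zero]
  exact Complex.ofReal_injective ((hq' X).trans (hq X).symm)

/-- The characteristic classes of the two terms of a representation up to homotopy agree. -/
theorem TwoTermRepresentation.characteristic_classes_eq [IsReduced R]
    (T : TwoTermRepresentation R L N P) (htr : IsRankOneTrace tr) (htr' : IsRankOneTrace tr')
    (hNR : FrameSeparated R N k R) (hNN : FrameSeparated R N k N) (hNP : FrameSeparated R N k P)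
    (hPR : FrameSeparated R P k' R) (hPP : FrameSeparated R P k' P) :
    (∀ l ≥ 1, ∃ c : Cohomology R L,
      (∀ c', IsTraceCharacter tr l c' ↔ c' = c) ∧ (∀ c', IsTraceCharacter tr' l c' ↔ c' = c)) ∧
    (∀ i, ∃ c : Cohomology R L,
      (∀ c', IsDetClass tr k i c' ↔ c' = c) ∧ (∀ c', IsDetClass tr' k' i c' ↔ c' = c)) ∧
    characterAlgebra (L := L) tr = characterAlgebra tr' := by
  have hd := T.squareZeroOn_left
  have hd' := T.squareZeroOn_right
  obtain ⟨D, D', φ, ζ, h, h'⟩ := T.exists_connections hNN hPP hNP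
  -- For the two connections coming from T the forms coincide exactly, by tr(zφ) = tr'(φz). The
  -- exponent l + 1 ensures at least one factor to rotate.
  have heq : ∀ l, traceForm tr D (l + 1) = traceForm tr' D' (l + 1) := by
    intro l
    obtain ⟨z, h1, h2⟩ := exists_curvaturePow_eq hNN hPP hd hd' φ ζ h h' l
    rw [traceForm_eq_mapForms, traceForm_eq_mapForms, h1, h2]
    refine DFinsupp.ext fun s => AlternatingMap.ext fun v => ?_
    refine (mapForms_apply _ _ _ _).trans (Eq.trans ?_ (mapForms_apply _ _ _ _).symm)
    refine (congrArg tr (mapForms_apply _ _ _ _)).trans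
      (Eq.trans ?_ (congrArg tr' (mapForms_apply _ _ _ _)).symm)
    exact htr.comp_comm htr' hNR _ _
  have hmem := fun l => htr.traceForm_mem hNR hNN hd D l
  let σ : ℕ → Cohomology R L := fun n => Ideal.Quotient.mk _ ⟨_, hmem (n + 1)⟩
  have hσ : ∀ n, IsClassOf (traceForm tr D (n + 1)) (σ n) := fun n => ⟨hmem _, rfl⟩
  have hσ' : ∀ n, IsClassOf (traceForm tr' D' (n + 1)) (σ n) := fun n => heq n ▸ hσ n
  have hchar : ∀ l ≥ 1, ∃ c : Cohomology R L,
      (∀ c', IsTraceCharacter tr l c' ↔ c' = c) ∧ (∀ c', IsTraceCharacter tr' l c' ↔ c' = c) := by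
    rintro (_ | l) hl
    · omega
    · exact ⟨σ l, htr.isTraceCharacter_iff hNR hNN hd (hσ l),
        htr'.isTraceCharacter_iff hPR hPP hd' (hσ' l)⟩
  refine ⟨hchar, fun i => ?_, ?_⟩
  -- One q for all ranks: evaluated at the common classes σ, it yields the same class for both
  -- modules although k and k' may differ.
  · obtain ⟨q, hq⟩ : ∃ q, ∀ k, ExpressesDetCoeff k (2 * i) q :=
      ⟨_, fun k => expressesDetCoeff_newtonPoly k i⟩
    exact ⟨_, htr.isDetClass_iff hNR hNN hd hσ (hq k),
      htr'.isDetClass_iff hPR hPP hd' hσ' (hq k')⟩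
  · unfold characterAlgebra
    congr 1
    ext c
    refine exists_congr fun l => and_congr_right fun hl => ?_
    obtain ⟨c₀, h1, h2⟩ := hchar l hl
    rw [h1, h2]

end ClassesOfConnections
end LieRinehartForms

namespace SmoothBundle
open LieRinehartForms

/-! ### Frames and the fibrewise trace on smooth vector bundles -/

section Geometry
variable {EM : Type*} [NormedAddCommGroup EM] [NormedSpace ℝ EM] [FiniteDimensional ℝ EM]
  {M : Type*} [TopologicalSpace M] [T2Space M]
  [ChartedSpace EM M] [IsManifold 𝓘(ℝ, EM) ∞ M]
  {FE : Type*} [NormedAddCommGroup FE] [NormedSpace ℝ FE] [FiniteDimensional ℝ FE] {E : M → Type*}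
  [TopologicalSpace (TotalSpace FE E)] [∀ x, TopologicalSpace (E x)] [FiberBundle FE E]
  [∀ x, AddCommGroup (E x)] [∀ x, Module ℝ (E x)] [VectorBundle ℝ FE E]
  [ContMDiffVectorBundle ∞ FE E 𝓘(ℝ, EM)]
  {FF : Type*} [NormedAddCommGroup FF] [NormedSpace ℝ FF] {F : M → Type*}
  [TopologicalSpace (TotalSpace FF F)] [∀ x, TopologicalSpace (F x)] [FiberBundle FF F]
  [∀ x, AddCommGroup (F x)] [∀ x, Module ℝ (F x)] [VectorBundle ℝ FF F]

instance instIsReducedSmoothFunction : IsReduced (SmoothFunction EM M) where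
  eq_zero f := by
    rintro ⟨n, hn⟩
    ext x
    have h : ∀ n : ℕ, (f ^ n) x = f x ^ n := by
      intro n
      induction n with
      | zero => rw [pow_zero, pow_zero]; rfl
      | succ n ih => rw [pow_succ, pow_succ, SmoothFunction.coe_mul, Pi.mul_apply, ih]
    have h1 := congrArg (fun g : SmoothFunction EM M => g x) hn
    exact eq_zero_of_pow_eq_zero ((h n).symm.trans h1)

variable (FE E) in
-- One bump function cuts off the local frame and another factor of it the coefficients, so both
-- become global; the framed function is the square of the bump. The coefficients are linear since
-- the local ones are.
theorem exists_isFramed (x : M) : ∃ ρ : SmoothFunction EM M, ρ x = 1 ∧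
    IsFramed (SmoothFunction EM M) (Section EM FE E) (Module.finrank ℝ FE) ρ := by
  obtain ⟨ρ, s, h1, -, h3⟩ := exists_frame (EM := EM) (FE := FE) (E := E) x
  choose c hc hsum using h3
  have hρ : ρ x = 1 := h1.self_of_nhds
  refine ⟨ρ * ρ, by rw [SmoothFunction.coe_mul, Pi.mul_apply, hρ, one_mul], s, fun i =>
    { toFun := fun e => c e i
      map_add' := fun e e' => ?_
      map_smul' := fun f e => ?_ }, hsum⟩
  · ext y
    change c (e + e') i y = c e i y + c e' i y
    rw [hc, hc, hc, ContMDiffSection.coe_add, Pi.add_apply, map_add, mul_add]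
  · ext y
    change c (f • e) i y = f y * c e i y
    rw [hc, hc, smul_section_apply, map_smul, smul_eq_mul, mul_left_comm]

variable (EM FE E) in
-- Every point has a framed function with value 1 there, so vanishing is tested pointwise. The
-- bundle F need not be E: only the functions ρ depend on the frames of E.
theorem frameSeparated_section : FrameSeparated (SmoothFunction EM M) (Section EM FE E)
    (Module.finrank ℝ FE) (Section EM FF F) := by
  intro z hz
  ext x
  obtain ⟨ρ, hρ, h⟩ := exists_isFramed (EM := EM) FE E x
  have h1 := congrArg (fun w : Section EM FF F => w x) (hz ρ h)
  change (ρ • z) x = 0 at h1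
  rwa [smul_section_apply, hρ, one_smul] at h1

variable (EM FE E) in
theorem frameSeparated_smoothFunction : FrameSeparated (SmoothFunction EM M) (Section EM FE E)
    (Module.finrank ℝ FE) (SmoothFunction EM M) := by
  intro z hz
  ext x
  obtain ⟨ρ, hρ, h⟩ := exists_isFramed (EM := EM) FE E x
  have h1 := congrArg (fun w : SmoothFunction EM M => w x) (hz ρ h)
  change (ρ * z) x = 0 at h1
  rwa [SmoothFunction.coe_mul, Pi.mul_apply, hρ, one_mul] at h1

theorem isRankOneTrace_sectionTrace :
    IsRankOneTrace (sectionTrace (EM := EM) (FE := FE) (E := E)) := by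
  intro c s
  ext x
  -- A functional linear over functions is pointwise: near x, the difference e - e' is a combination
  -- of sections with coefficients vanishing at x.
  have hpt : ∀ e e' : Section EM FE E, e x = e' x → c e x = c e' x := by
    intro e e' h
    obtain ⟨ρ, σ, h1, -, h3⟩ := exists_frame (EM := EM) (FE := FE) (E := E) x
    have hρ : ρ x = 1 := h1.self_of_nhds
    obtain ⟨a, ha, hsum⟩ := h3 (e - e')
    have h4 := congrArg (fun f : SmoothFunction EM M => f x) (congrArg c hsum)
    simp only [map_smul, map_sum, smul_eq_mul] at h4
    let ev : SmoothFunction EM M →+ ℝ := AddMonoidHom.mk' (fun f => f x) fun _ _ => rfl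
    have h5 : (∑ i, a i * c (σ i)) x = 0 := by
      refine (map_sum ev _ _).trans (Finset.sum_eq_zero fun i _ => ?_)
      change (a i * c (σ i)) x = 0
      rw [SmoothFunction.coe_mul, Pi.mul_apply, ha, ContMDiffSection.coe_sub, Pi.sub_apply, h,
        sub_self, map_zero, mul_zero, zero_mul]
    rw [h5, SmoothFunction.coe_mul, Pi.mul_apply, SmoothFunction.coe_mul, Pi.mul_apply, hρ,
      one_mul, one_mul, map_sub] at h4
    exact sub_eq_zero.mp h4
  choose sec hsec using exists_section (EM := EM) (FE := FE) (E := E) x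
  -- The functional induced by c on the fibre. With it the fibre map of c ⊗ s is the rank one map φ
  -- ⊗ s(x), whose trace is φ(s(x)).
  let φ : Module.Dual ℝ (E x) :=
    { toFun := fun v => c (sec v) x
      map_add' := fun v w => by
        refine (hpt _ (sec v + sec w) ?_).trans (congrArg (fun f : SmoothFunction EM M => f x)
          (map_add c (sec v) (sec w)))
        rw [ContMDiffSection.coe_add, Pi.add_apply, hsec, hsec, hsec]
      map_smul' := fun r v => by
        refine (hpt _ (r • sec v) ?_).trans (congrArg (fun f : SmoothFunction EM M => f x)
          (LinearMap.map_smul_of_tower c r (sec v)))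
        rw [ContMDiffSection.coe_smul, Pi.smul_apply, hsec, hsec] }
  have hfib : fibreMap (c.smulRight s) x = φ.smulRight (s x) := by
    ext v
    obtain ⟨e, rfl⟩ := exists_section (EM := EM) (FE := FE) x v
    rw [fibreMap_apply]
    change c e x • s x = c (sec (e x)) x • s x
    rw [hpt _ _ (hsec (e x))]
  have hx : x ∈ (trivializationAt FE E x).baseSet := FiberBundle.mem_baseSet_trivializationAt FE E x
  -- The trivialization carries a basis of the model fibre to E x, which supplies the finiteness
  -- needed for the trace of a rank one map.
  have := Module.Finite.of_basis
    ((trivializationAt FE E x).basisAt (Module.finBasis ℝ FE) hx)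
  change LinearMap.trace ℝ (E x) (fibreMap (c.smulRight s) x) = c s x
  rw [hfib, LinearMap.trace_smulRight]
  exact hpt _ _ (hsec (s x))

end Geometry
end SmoothBundle
end

theorem mainTheorem1
    {EM : Type*} [NormedAddCommGroup EM] [NormedSpace ℝ EM] [FiniteDimensional ℝ EM]
    {M : Type*} [TopologicalSpace M] [T2Space M] [SigmaCompactSpace M]
    [ChartedSpace EM M] [IsManifold 𝓘(ℝ, EM) ∞ M]
    -- the Lie algebroid `A → M`
    {FA : Type*} [NormedAddCommGroup FA] [NormedSpace ℝ FA] [FiniteDimensional ℝ FA]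
    {A : M → Type*} [TopologicalSpace (TotalSpace FA A)] [∀ x, TopologicalSpace (A x)]
    [FiberBundle FA A] [∀ x, AddCommGroup (A x)] [∀ x, Module ℝ (A x)] [VectorBundle ℝ FA A]
    [ContMDiffVectorBundle ∞ FA A 𝓘(ℝ, EM)] [LieAlgebroid EM FA A]
    -- the vector bundle `E → M`
    {FE : Type*} [NormedAddCommGroup FE] [NormedSpace ℝ FE] [FiniteDimensional ℝ FE]
    {E : M → Type*} [TopologicalSpace (TotalSpace FE E)] [∀ x, TopologicalSpace (E x)]
    [FiberBundle FE E] [∀ x, AddCommGroup (E x)] [∀ x, Module ℝ (E x)] [VectorBundle ℝ FE E]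
    [ContMDiffVectorBundle ∞ FE E 𝓘(ℝ, EM)]
    -- the vector bundle `F → M`
    {FF : Type*} [NormedAddCommGroup FF] [NormedSpace ℝ FF] [FiniteDimensional ℝ FF]
    {F : M → Type*} [TopologicalSpace (TotalSpace FF F)] [∀ x, TopologicalSpace (F x)]
    [FiberBundle FF F] [∀ x, AddCommGroup (F x)] [∀ x, Module ℝ (F x)] [VectorBundle ℝ FF F]
    [ContMDiffVectorBundle ∞ FF F 𝓘(ℝ, EM)]
    (hrep : Nonempty (TwoRepresentation EM FA A FE E FF F)) :
    (∀ l ≥ 1, ∃ c : AlgebroidCohomology EM FA A,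
      (∀ c', IsPontryaginCharacter EM FA A FE E l c' ↔ c' = c) ∧
      (∀ c', IsPontryaginCharacter EM FA A FF F l c' ↔ c' = c)) ∧
    (∀ i ≥ 1, ∃ c : AlgebroidCohomology EM FA A,
      (∀ c', IsPontryaginClass EM FA A FE E i c' ↔ c' = c) ∧
      (∀ c', IsPontryaginClass EM FA A FF F i c' ↔ c' = c)) ∧
    PontryaginAlgebra EM FA A FE E = PontryaginAlgebra EM FA A FF F := by
  obtain ⟨T⟩ := hrep
  obtain ⟨h1, h2, h3⟩ := T.characteristic_classes_eq
    (isRankOneTrace_sectionTrace (EM := EM) (FE := FE) (E := E))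
    (isRankOneTrace_sectionTrace (EM := EM) (FE := FF) (E := F))
    (frameSeparated_smoothFunction EM FE E) (frameSeparated_section EM FE E)
    (frameSeparated_section EM FE E)
    (frameSeparated_smoothFunction EM FF F) (frameSeparated_section EM FF F)
  exact ⟨h1, fun i _ => h2 i, h3⟩
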